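/- **Setting.** Work on $\mathbb R^4$ with coordinates $(u,v,x,y)$, signature $(+,-,-,-)$, transversal indices $A,B,\dots\in\{2,3\}$ with $(x^2,x^3)=(x,y)$, and summation over repeated indices. A metric-affine geometry is given by a coframe $\vartheta^a$ (dual frame $e_a$, interior product $e_a\lrcorner$), a constant Lorentzian matrix $g_{ab}$ with which frame indices are raised and lowered, and a connection 1-form $\Gamma_a{}^b$; $\vartheta^{ab}=\vartheta^a\wedge\vartheta^b$, $\star$ is the Hodge dual of $g_{ab}\vartheta^a\otimes\vartheta^b$ and $\mathrm{vol}=\star 1$. Put $$T^a=d\vartheta^a+\Gamma_c{}^a\wedge\vartheta^c,\qquad Q_{ab}=\Gamma_{ab}+\Gamma_{ba},\qquad R_a{}^b=d\Gamma_a{}^b+\Gamma_c{}^b\wedge\Gamma_a{}^c .$$ The irreducible parts are as follows, where round and square brackets on indices denote normalized (anti)symmetrization. *Torsion.* With $T=e_a\lrcorner T^a$: ${}^{(2)}T^a=\frac13\vartheta^a\wedge T$, ${}^{(3)}T^a=\frac13e^a\lrcorner(T^b\wedge\vartheta_b)$, ${}^{(1)}T^a=T^a-{}^{(2)}T^a-{}^{(3)}T^a$.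 *Nonmetricity.* With $Q=\frac14Q_c{}^c$, $\Lambda=\vartheta^a\,e^b\lrcorner(Q_{ab}-g_{ab}Q)$ and $\bar\Lambda_a=\star[(Q_{ac}-g_{ac}Q)\wedge\vartheta^c-\frac13\vartheta_a\wedge\Lambda]$: ${}^{(4)}Q_{ab}=g_{ab}Q$, ${}^{(3)}Q_{ab}=\frac49(\vartheta_{(a}\,e_{b)}\lrcorner\Lambda-\frac14g_{ab}\Lambda)$, ${}^{(2)}Q_{ab}=\frac23\star(\bar\Lambda_{(a}\wedge\vartheta_{b)})$, and ${}^{(1)}Q_{ab}$ is the remainder. *Antisymmetric curvature* $W_{ab}=R_{[ab]}$. With $X^a=e_b\lrcorner W^{ab}$, $X=e_a\lrcorner X^a$, $\bar X^a=\star(W^{ba}\wedge\vartheta_b)$, $\bar X=e_a\lrcorner\bar X^a$, $\Psi_a=X_a-\frac14X\vartheta_a-\frac12e_a\lrcorner(\vartheta^b\wedge X_b)$, $\bar\Psi_a=\bar X_a-\frac14\bar X\vartheta_a-\frac12e_a\lrcorner(\vartheta^b\wedge\bar X_b)$: ${}^{(2)}W_{ab}=-\star(\vartheta_{[a}\wedge\bar\Psi_{b]})$,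 ${}^{(3)}W_{ab}=-\frac1{12}\star(\bar X\,\vartheta_{ab})$, ${}^{(4)}W_{ab}=-\vartheta_{[a}\wedge\Psi_{b]}$, ${}^{(5)}W_{ab}=-\frac12\vartheta_{[a}\wedge e_{b]}\lrcorner(\vartheta^c\wedge X_c)$, ${}^{(6)}W_{ab}=-\frac1{12}X\vartheta_{ab}$, and ${}^{(1)}W_{ab}$ is the remainder. *Symmetric curvature* $Z_{ab}=R_{(ab)}$. With ${}^{(5)}Z_{ab}=\frac14g_{ab}Z_c{}^c$, $Y_a=e^b\lrcorner(Z_{ab}-{}^{(5)}Z_{ab})$, $\bar Y_a=\star[(Z_{ba}-{}^{(5)}Z_{ba})\wedge\vartheta^b]$, $\Phi_a=Y_a-\frac12e_a\lrcorner(\vartheta^b\wedge Y_b)$, $\bar\Phi_a=\bar Y_a-\frac12e_a\lrcorner(\vartheta^b\wedge\bar Y_b)$: ${}^{(2)}Z_{ab}=-\frac12\star(\vartheta_{(a}\wedge\bar\Phi_{b)})$, ${}^{(3)}Z_{ab}=\frac1{12}[4\vartheta_{(a}\wedge e_{b)}\lrcorner(\vartheta^c\wedge Y_c)-2g_{ab}\vartheta^c\wedge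 Y_c]$, ${}^{(4)}Z_{ab}=\frac12\vartheta_{(a}\wedge\Phi_{b)}$, and ${}^{(1)}Z_{ab}$ is the remainder. **Action.** The full even-parity quadratic metric-affine Lagrangian, with real parameters $\kappa\ne0$, $\rho\ne0$, $\lambda$, $a_0,\dots,a_3$, $b_1,\dots,b_5$, $c_1,c_2,c_3$, $w_1,\dots,w_6$, $z_1,\dots,z_5$, $v_1,\dots,v_5$, is $$\begin{aligned}L=&-\tfrac1{2\kappa}\Big[2\lambda\,\mathrm{vol}-a_0R^{ab}\wedge\star\vartheta_{ab}+T^a\wedge\star\sum_{I=1}^3a_I{}^{(I)}T_a+Q_{ab}\wedge\star\sum_{I=1}^4b_I{}^{(I)}Q^{ab}\\&\qquad+2b_5({}^{(3)}Q_{ac}\wedge\vartheta^a)\wedge\star({}^{(4)}Q^{bc}\wedge\vartheta_b)-2\sum_{I=1}^3c_I{}^{(I+1)}Q_{ab}\wedge\vartheta^a\wedge\star T^b\Big]\\&-\tfrac1{2\rho}R_{ab}\wedge\star\Big[\sum_{I=1}^6w_I{}^{(I)}W^{ab}+v_1\vartheta^a\wedge(e_c\lrcorner{}^{(5)}W^{cb})+\sum_{I=1}^5z_I{}^{(I)}Z^{ab}\\&\qquad+v_2\vartheta_c\wedge(e^a\lrcorner{}^{(2)}Z^{cb})+\sum_{I=3}^5v_I\vartheta^a\wedge(e_c\lrcorner{}^{(I)}Z^{cb})\Big].\end{aligned}$$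 A pair $(\vartheta^a,\Gamma_a{}^b)$ is a (vacuum) solution if the first variation of $\int L$ with respect to the coframe and the connection vanishes for all smooth compactly supported variations. **Configuration.** Let $H,\mathcal W,\mathcal V,\mathcal U,\overline{\mathcal W},\overline{\mathcal V},\overline{\mathcal U}$ be smooth real functions of $(u,x,y)$ which decay, together with all their derivatives, at least like $(1+|(x,y)|)^{-3}$ at transversal infinity, locally uniformly in $u$. With $\epsilon_{AB}$ and $\epsilon^{AB}$ antisymmetric and $\epsilon_{23}=\epsilon^{23}=1$, let $$W^A=\tfrac12(\delta^{AB}\partial_B\mathcal W+\epsilon^{AB}\partial_B\overline{\mathcal W}),\quad V^A=\tfrac12(\delta^{AB}\partial_B\mathcal V+\epsilon^{AB}\partial_B\overline{\mathcal V}),\quad U_A=\tfrac12(\partial_A\mathcal U+\epsilon_{AB}\delta^{BC}\partial_C\overline{\mathcal U}),$$ and let $V^a$, $W^a$, $U_a$ have only these transversal components. Consider the pp-wave metric $H\,du^2+2\,du\,dv-dx^2-dy^2$ in the coframe $\vartheta^0=du$, $\vartheta^1=dv+\frac12H\,du$, $\vartheta^2=dx$, $\vartheta^3=dy$ (so $g_{01}=g_{10}=1$,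 $g_{22}=g_{33}=-1$, all other $g_{ab}=0$), with the connection $$\Gamma_a{}^b=-k\,(k_aV^b+k^bW_a)+k_ak^b\,U_c\vartheta^c,\qquad k=k_a\vartheta^a=du .$$ Put $$\mathcal X_0=\mathcal W-\mathcal V,\quad\mathcal X_1=H-\mathcal W+\mathcal U,\quad\mathcal X_2=\mathcal W+\mathcal V+\mathcal U,\quad\mathcal X_3=\mathcal W+\mathcal V-2\,\mathcal U,$$ $$\overline{\mathcal X}_1=-\overline{\mathcal W}+\overline{\mathcal U},\quad\overline{\mathcal X}_2=\overline{\mathcal W}+\overline{\mathcal V}+\overline{\mathcal U},\quad\overline{\mathcal X}_3=\overline{\mathcal W}+\overline{\mathcal V}-2\,\overline{\mathcal U},$$ and let a hat denote the transversal Fourier transform $\hat F(u,q)=(2\pi)^{-2}\int F(u,x,y)\,e^{-iq_Ax^A}\,dx\,dy$. Put also $\varpi_0=3z_1+z_4+2v_4$, $\varpi_1=4(w_1+w_2)$, $\varpi_2=2(w_1+w_2)+v_2$, $\varpi_3=\frac13(z_1+3z_2)$ and $\mathcal Q^2=\frac{\kappa}{4\rho}\,\delta^{AB}q_Aq_B$.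 **Theorem 9.** This configuration is a solution of the action if and only if $\lambda=0$ and, for all $u\in\mathbb R$ and $q\in\mathbb R^2$, $$v_4\,\partial_u\hat{\mathcal X}_0+\tfrac23(\varpi_0-6z_1)\,\partial_u\hat{\mathcal X}_2+\tfrac13\varpi_0\,\partial_u\hat{\mathcal X}_3=0,$$ $$\mathrm M\,(\hat{\mathcal X}_0,\hat{\mathcal X}_1,\hat{\mathcal X}_2,\hat{\mathcal X}_3)^{T}=0,\qquad\overline{\mathrm M}\,(\hat{\overline{\mathcal X}}_1,\hat{\overline{\mathcal X}}_2,\hat{\overline{\mathcal X}}_3)^{T}=0,$$ where $$\mathrm M=\begin{pmatrix}-\frac{a_0}2&a_1&0&c_1\\0&2c_1-a_1&\frac13(a_0-4b_1)&\frac{a_0}6-c_1+\frac43b_2\\2(w_1+w_4)\mathcal Q^2&a_0+a_1&\frac23v_4\mathcal Q^2&\frac{a_0}2+c_1+\frac13v_4\mathcal Q^2\\v_4\mathcal Q^2&0&a_0-4b_1+\frac23\varpi_0\mathcal Q^2&\frac13\varpi_0\mathcal Q^2\end{pmatrix},$$ $$\overline{\mathrm M}=\begin{pmatrix}0&a_0-4b_1+4z_1\mathcal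 Q^2&0\\a_0+2c_1-2\varpi_2\mathcal Q^2&0&\frac23(a_0+2b_2)-(\varpi_2+\varpi_3)\mathcal Q^2\\a_0+a_1-\varpi_1\mathcal Q^2&0&\frac{a_0}2+c_1-\varpi_2\mathcal Q^2\end{pmatrix}.$$ -/

import Mathlib

open scoped ContDiff Matrix

noncomputable section

namespace MAG

/-! ### Frame metric, index gymnastics and forms at a point

All frame indices refer to a coframe `ϑ^0, …, ϑ^3` in which the anholonomic metric is the constant
matrix of `2 ϑ^0 ϑ^1 - (ϑ^2)^2 - (ϑ^3)^2` (signature `(+,-,-,-)`).  A differential form at a point is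
given by its components in the coframe: `α = α_a ϑ^a`, `α = (1/2) α_{ab} ϑ^{ab}`,
`α = (1/6) α_{abc} ϑ^{abc}`. -/

/-- Components of the anholonomic metric `g_{ab}`. -/
def metric : Matrix (Fin 4) (Fin 4) ℝ :=
  !![0, 1, 0, 0; 1, 0, 0, 0; 0, 0, -1, 0; 0, 0, 0, -1]

/-- The matrix of `g_{ab}` is its own inverse, so it also raises indices. -/
theorem metric_mul_metric : metric * metric = 1 := by
  ext i j
  fin_cases i <;> fin_cases j <;> simp [metric, Matrix.mul_apply, Fin.sum_univ_four]

/-- The determinant of `g_{ab}` is `-1`; hence `sgn(g) = -1` and `√|det g| = 1`. -/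
theorem metric_det : metric.det = -1 := by
  simp [metric, Matrix.det_succ_row_zero, Fin.sum_univ_succ, Fin.succAbove]

/-- Components of a 1-form. -/
abbrev Form1 := Fin 4 → ℝ
/-- Components of a 2-form (antisymmetric). -/
abbrev Form2 := Fin 4 → Fin 4 → ℝ
/-- Components of a 3-form (totally antisymmetric). -/
abbrev Form3 := Fin 4 → Fin 4 → Fin 4 → ℝ

/-- Raising (or lowering) the index of a (form-valued) vector. -/
def raise1 {F : Type} [AddCommGroup F] [Module ℝ F] (X : Fin 4 → F) (a : Fin 4) : F :=
  ∑ b, metric a b • X b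

/-- Raising (or lowering) both indices of a (form-valued) 2-tensor. -/
def raise2 {F : Type} [AddCommGroup F] [Module ℝ F] (X : Fin 4 → Fin 4 → F) (a b : Fin 4) : F :=
  ∑ c, ∑ d, (metric a c * metric b d) • X c d

/-- Antisymmetrization `X_{[ab]}`. -/
def antisym {F : Type} [AddCommGroup F] [Module ℝ F] (X : Fin 4 → Fin 4 → F) (a b : Fin 4) : F :=
  (1 / 2 : ℝ) • (X a b - X b a)

/-- Symmetrization `X_{(ab)}`. -/
def symm {F : Type} [AddCommGroup F] [Module ℝ F] (X : Fin 4 → Fin 4 → F) (a b : Fin 4) : F :=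
  (1 / 2 : ℝ) • (X a b + X b a)

/-- The metric trace `X_c{}^c`. -/
def trace {F : Type} [AddCommGroup F] [Module ℝ F] (X : Fin 4 → Fin 4 → F) : F :=
  ∑ a, ∑ b, metric a b • X a b

/-- The coframe 1-form `ϑ^a`. -/
def cof (a : Fin 4) : Form1 := fun b => if b = a then 1 else 0

/-- The 1-form `ϑ_a = g_{ab} ϑ^b`. -/
def cofL (a : Fin 4) : Form1 := fun b => metric a b

/-- Wedge product of two 1-forms. -/
def wedge11 (α β : Form1) : Form2 := fun a b => α a * β b - α b * β a

/-- Wedge product `φ ∧ β` of a 2-form and a 1-form (also equal to `β ∧ φ`). -/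
def wedge21 (φ : Form2) (β : Form1) : Form3 :=
  fun a b c => φ a b * β c + φ b c * β a + φ c a * β b

/-- Interior product `e_a ⌟ α` of a 1-form. -/
def int1 (a : Fin 4) (α : Form1) : ℝ := α a
/-- Interior product `e_a ⌟ φ` of a 2-form. -/
def int2 (a : Fin 4) (φ : Form2) : Form1 := fun b => φ a b
/-- Interior product `e_a ⌟ φ` of a 3-form. -/
def int3 (a : Fin 4) (φ : Form3) : Form2 := fun b c => φ a b c

/-- The Levi-Civita symbol with `ε_{0123} = 1`: the Vandermonde product of the four indices,
divided by `12`. -/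
def levi (a b c d : Fin 4) : ℝ :=
  (((b : ℕ) : ℝ) - ((a : ℕ) : ℝ)) * (((c : ℕ) : ℝ) - ((a : ℕ) : ℝ)) *
  (((d : ℕ) : ℝ) - ((a : ℕ) : ℝ)) * (((c : ℕ) : ℝ) - ((b : ℕ) : ℝ)) *
  (((d : ℕ) : ℝ) - ((b : ℕ) : ℝ)) * (((d : ℕ) : ℝ) - ((c : ℕ) : ℝ)) / 12

theorem levi_normalized : levi 0 1 2 3 = 1 := by norm_num [levi]

theorem levi_swap (a b c d : Fin 4) : levi b a c d = -levi a b c d ∧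
    levi a c b d = -levi a b c d ∧ levi a b d c = -levi a b c d := by
  refine ⟨?_, ?_, ?_⟩ <;> simp only [levi] <;> ring

/-- Hodge dual of a 2-form. -/
def star2 (φ : Form2) : Form2 :=
  fun c d => (1 / 2) * ∑ a, ∑ b, raise2 φ a b * levi a b c d

/-- Hodge dual of a 3-form. -/
def star3 (φ : Form3) : Form1 :=
  fun d => (1 / 6) * ∑ a, ∑ b, ∑ c, raise1 (fun a' => raise2 (φ a') b c) a * levi a b c d

/-- The number `⟨α, β⟩` with `α ∧ ⋆β = ⟨α, β⟩ vol_g`, for 1-forms. -/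
def inner1 (α β : Form1) : ℝ := ∑ a, α a * raise1 β a

/-- The number `⟨α, β⟩` with `α ∧ ⋆β = ⟨α, β⟩ vol_g`, for 2-forms. -/
def inner2 (α β : Form2) : ℝ := (1 / 2) * ∑ a, ∑ b, α a b * raise2 β a b

/-! ### Irreducible parts of the torsion `T^a` (index up) -/

/-- `T = e_a ⌟ T^a`. -/
def torTrace (T : Fin 4 → Form2) : Form1 := ∑ a, int2 a (T a)

/-- `T^b ∧ ϑ_b`. -/
def torAxial (T : Fin 4 → Form2) : Form3 := ∑ b, wedge21 (T b) (cofL b)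

def tor2 (T : Fin 4 → Form2) (a : Fin 4) : Form2 := (1 / 3 : ℝ) • wedge11 (cof a) (torTrace T)

def tor3 (T : Fin 4 → Form2) (a : Fin 4) : Form2 :=
  (1 / 3 : ℝ) • raise1 (fun b => int3 b (torAxial T)) a

def tor1 (T : Fin 4 → Form2) (a : Fin 4) : Form2 := T a - tor2 T a - tor3 T a

/-! ### Irreducible parts of the nonmetricity `Q_{ab}` (indices down) -/

/-- The Weyl 1-form `Q = (1/4) Q_c{}^c`. -/
def weylForm (Q : Fin 4 → Fin 4 → Form1) : Form1 := (1 / 4 : ℝ) • trace Q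

/-- The traceless part `Q_{ab} - g_{ab} Q`. -/
def nmTf (Q : Fin 4 → Fin 4 → Form1) (a b : Fin 4) : Form1 := Q a b - metric a b • weylForm Q

/-- `Λ = ϑ^a (e^b ⌟ (Q_{ab} - g_{ab} Q))`. -/
def lamForm (Q : Fin 4 → Fin 4 → Form1) : Form1 :=
  ∑ a, (∑ b, ∑ c, metric b c * int1 c (nmTf Q a b)) • cof a

/-- `Λ̄_a = ⋆[(Q_{ac} - g_{ac} Q) ∧ ϑ^c - (1/3) ϑ_a ∧ Λ]`. -/
def lamBar (Q : Fin 4 → Fin 4 → Form1) (a : Fin 4) : Form2 :=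
  star2 ((∑ c, wedge11 (nmTf Q a c) (cof c)) - (1 / 3 : ℝ) • wedge11 (cofL a) (lamForm Q))

def nm4 (Q : Fin 4 → Fin 4 → Form1) (a b : Fin 4) : Form1 := metric a b • weylForm Q

def nm3 (Q : Fin 4 → Fin 4 → Form1) (a b : Fin 4) : Form1 :=
  (4 / 9 : ℝ) • (symm (fun c d => int1 d (lamForm Q) • cofL c) a b
    - (1 / 4 * metric a b) • lamForm Q)

def nm2 (Q : Fin 4 → Fin 4 → Form1) (a b : Fin 4) : Form1 :=
  (2 / 3 : ℝ) • star3 (symm (fun c d => wedge21 (lamBar Q c) (cofL d)) a b)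

def nm1 (Q : Fin 4 → Fin 4 → Form1) (a b : Fin 4) : Form1 :=
  Q a b - nm2 Q a b - nm3 Q a b - nm4 Q a b

/-! ### Irreducible parts of the antisymmetric curvature `W_{ab} = R_{[ab]}` (indices down) -/

/-- `X^a = e_b ⌟ W^{ab}`. -/
def wX (W : Fin 4 → Fin 4 → Form2) (a : Fin 4) : Form1 := ∑ b, int2 b (raise2 W a b)

/-- `X = e_a ⌟ X^a`. -/
def wXs (W : Fin 4 → Fin 4 → Form2) : ℝ := ∑ a, int1 a (wX W a)

/-- `X̄^a = ⋆(W^{ba} ∧ ϑ_b)`. -/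
def wXb (W : Fin 4 → Fin 4 → Form2) (a : Fin 4) : Form1 :=
  star3 (∑ b, wedge21 (raise2 W b a) (cofL b))

/-- `X̄ = e_a ⌟ X̄^a`. -/
def wXbs (W : Fin 4 → Fin 4 → Form2) : ℝ := ∑ a, int1 a (wXb W a)

/-- `ϑ^c ∧ X_c`. -/
def wXa (W : Fin 4 → Fin 4 → Form2) : Form2 := ∑ c, wedge11 (cof c) (raise1 (wX W) c)

/-- `ϑ^c ∧ X̄_c`. -/
def wXba (W : Fin 4 → Fin 4 → Form2) : Form2 := ∑ c, wedge11 (cof c) (raise1 (wXb W) c)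

/-- `Ψ_a = X_a - (1/4) X ϑ_a - (1/2) e_a ⌟ (ϑ^b ∧ X_b)`. -/
def wPsi (W : Fin 4 → Fin 4 → Form2) (a : Fin 4) : Form1 :=
  raise1 (wX W) a - (1 / 4 * wXs W) • cofL a - (1 / 2 : ℝ) • int2 a (wXa W)

/-- `Ψ̄_a = X̄_a - (1/4) ϑ_a ∧ X̄ - (1/2) e_a ⌟ (ϑ^b ∧ X̄_b)`. -/
def wPsib (W : Fin 4 → Fin 4 → Form2) (a : Fin 4) : Form1 :=
  raise1 (wXb W) a - (1 / 4 * wXbs W) • cofL a - (1 / 2 : ℝ) • int2 a (wXba W)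

def cw2 (W : Fin 4 → Fin 4 → Form2) (a b : Fin 4) : Form2 :=
  -star2 (antisym (fun c d => wedge11 (cofL c) (wPsib W d)) a b)

def cw3 (W : Fin 4 → Fin 4 → Form2) (a b : Fin 4) : Form2 :=
  (-(1 / 12) : ℝ) • star2 (wXbs W • wedge11 (cofL a) (cofL b))

def cw4 (W : Fin 4 → Fin 4 → Form2) (a b : Fin 4) : Form2 :=
  -antisym (fun c d => wedge11 (cofL c) (wPsi W d)) a b

def cw5 (W : Fin 4 → Fin 4 → Form2) (a b : Fin 4) : Form2 :=
  (-(1 / 2) : ℝ) • antisym (fun c d => wedge11 (cofL c) (int2 d (wXa W))) a b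

def cw6 (W : Fin 4 → Fin 4 → Form2) (a b : Fin 4) : Form2 :=
  (-(1 / 12) * wXs W) • wedge11 (cofL a) (cofL b)

def cw1 (W : Fin 4 → Fin 4 → Form2) (a b : Fin 4) : Form2 :=
  W a b - cw2 W a b - cw3 W a b - cw4 W a b - cw5 W a b - cw6 W a b

/-! ### Irreducible parts of the symmetric curvature `Z_{ab} = R_{(ab)}` (indices down) -/

def cz5 (Z : Fin 4 → Fin 4 → Form2) (a b : Fin 4) : Form2 := (1 / 4 * metric a b) • trace Z

/-- `Z_{ab} - ⁽⁵⁾Z_{ab}`. -/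
def zTf (Z : Fin 4 → Fin 4 → Form2) (a b : Fin 4) : Form2 := Z a b - cz5 Z a b

/-- `Y_a = e^b ⌟ (Z_{ab} - ⁽⁵⁾Z_{ab})`. -/
def zY (Z : Fin 4 → Fin 4 → Form2) (a : Fin 4) : Form1 :=
  ∑ b, raise1 (fun c => int2 c (zTf Z a b)) b

/-- `Ȳ_a = ⋆[(Z_{ba} - ⁽⁵⁾Z_{ba}) ∧ ϑ^b]`. -/
def zYb (Z : Fin 4 → Fin 4 → Form2) (a : Fin 4) : Form1 :=
  star3 (∑ b, wedge21 (zTf Z b a) (cof b))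

/-- `ϑ^b ∧ Y_b`. -/
def zYa (Z : Fin 4 → Fin 4 → Form2) : Form2 := ∑ b, wedge11 (cof b) (zY Z b)

/-- `ϑ^b ∧ Ȳ_b`. -/
def zYba (Z : Fin 4 → Fin 4 → Form2) : Form2 := ∑ b, wedge11 (cof b) (zYb Z b)

/-- `Φ_a = Y_a - (1/2) e_a ⌟ (ϑ^b ∧ Y_b)`. -/
def zPhi (Z : Fin 4 → Fin 4 → Form2) (a : Fin 4) : Form1 :=
  zY Z a - (1 / 2 : ℝ) • int2 a (zYa Z)

/-- `Φ̄_a = Ȳ_a - (1/2) e_a ⌟ (ϑ^b ∧ Ȳ_b)`. -/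
def zPhib (Z : Fin 4 → Fin 4 → Form2) (a : Fin 4) : Form1 :=
  zYb Z a - (1 / 2 : ℝ) • int2 a (zYba Z)

def cz2 (Z : Fin 4 → Fin 4 → Form2) (a b : Fin 4) : Form2 :=
  (-(1 / 2) : ℝ) • star2 (symm (fun c d => wedge11 (cofL c) (zPhib Z d)) a b)

def cz3 (Z : Fin 4 → Fin 4 → Form2) (a b : Fin 4) : Form2 :=
  (1 / 12 : ℝ) • ((4 : ℝ) • symm (fun c d => wedge11 (cofL c) (int2 d (zYa Z))) a b
    - (2 * metric a b) • zYa Z)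

def cz4 (Z : Fin 4 → Fin 4 → Form2) (a b : Fin 4) : Form2 :=
  (1 / 2 : ℝ) • symm (fun c d => wedge11 (cofL c) (zPhi Z d)) a b

def cz1 (Z : Fin 4 → Fin 4 → Form2) (a b : Fin 4) : Form2 :=
  Z a b - cz2 Z a b - cz3 Z a b - cz4 Z a b - cz5 Z a b

/-! ### The even-parity quadratic metric-affine Lagrangian -/

/-- Coupling constants of the action: `κ`, `ρ`, the cosmological constant `lam`, and the 28
dimensionless parameters. -/
structure Params where
  (κ ρ lam : ℝ)
  (a0 a1 a2 a3 : ℝ)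
  (b1 b2 b3 b4 b5 : ℝ)
  (c1 c2 c3 : ℝ)
  (w1 w2 w3 w4 w5 w6 : ℝ)
  (z1 z2 z3 z4 z5 : ℝ)
  (v1 v2 v3 v4 v5 : ℝ)

/-- The coefficient of `vol_g` in the weak-gravity Lagrangian 4-form
`-(1/2κ)[2λ vol - a₀ R^{ab} ∧ ⋆ϑ_{ab} + T^a ∧ ⋆∑ a_I ⁽ᴵ⁾T_a + Q_{ab} ∧ ⋆∑ b_I ⁽ᴵ⁾Q^{ab}
+ 2 b₅ (⁽³⁾Q_{ac} ∧ ϑ^a) ∧ ⋆(⁽⁴⁾Q^{bc} ∧ ϑ_b) - 2 ∑ c_I ⁽ᴵ⁺¹⁾Q_{ab} ∧ ϑ^a ∧ ⋆T^b]`,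
with arguments `T^a`, `Q_{ab}`, `R_{ab}`. -/
def lagWeak (p : Params) (T : Fin 4 → Form2) (Q : Fin 4 → Fin 4 → Form1)
    (R : Fin 4 → Fin 4 → Form2) : ℝ :=
  -(1 / (2 * p.κ)) * (2 * p.lam
    - p.a0 * (∑ a, ∑ b, inner2 (raise2 R a b) (wedge11 (cofL a) (cofL b)))
    + (∑ a, inner2 (T a)
        (raise1 (fun b => p.a1 • tor1 T b + p.a2 • tor2 T b + p.a3 • tor3 T b) a))
    + (∑ a, ∑ b, inner1 (Q a b)
        (raise2 (fun c d => p.b1 • nm1 Q c d + p.b2 • nm2 Q c d + p.b3 • nm3 Q c d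
          + p.b4 • nm4 Q c d) a b))
    + 2 * p.b5 * (∑ c, inner2 (∑ a, wedge11 (nm3 Q a c) (cof a))
        (∑ b, wedge11 (raise2 (nm4 Q) b c) (cofL b)))
    - 2 * (∑ b, inner2 (∑ a, wedge11
        (p.c1 • nm2 Q a b + p.c2 • nm3 Q a b + p.c3 • nm4 Q a b) (cof a)) (T b)))

/-- `ϑ^a ∧ (e_c ⌟ X^{cb})` for `X` with indices down. -/
def traceIns (X : Fin 4 → Fin 4 → Form2) (a b : Fin 4) : Form2 :=
  wedge11 (cof a) (∑ c, int2 c (raise2 X c b))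

/-- `ϑ_c ∧ (e^a ⌟ X^{cb})` for `X` with indices down. -/
def crossIns (X : Fin 4 → Fin 4 → Form2) (a b : Fin 4) : Form2 :=
  ∑ c, wedge11 (cofL c) (raise1 (fun d => int2 d (raise2 X c b)) a)

/-- The coefficient of `vol_g` in the strong-gravity Lagrangian 4-form
`-(1/2ρ) R_{ab} ∧ ⋆[∑ w_I ⁽ᴵ⁾W^{ab} + v₁ ϑ^a ∧ (e_c ⌟ ⁽⁵⁾W^{cb}) + ∑ z_I ⁽ᴵ⁾Z^{ab}
+ v₂ ϑ_c ∧ (e^a ⌟ ⁽²⁾Z^{cb}) + ∑_{I=3}^5 v_I ϑ^a ∧ (e_c ⌟ ⁽ᴵ⁾Z^{cb})]`, with argument `R_{ab}`. -/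
def lagStrong (p : Params) (R : Fin 4 → Fin 4 → Form2) : ℝ :=
  -(1 / (2 * p.ρ)) * ∑ a, ∑ b, inner2 (R a b)
    (raise2 (fun c d => p.w1 • cw1 (antisym R) c d + p.w2 • cw2 (antisym R) c d
        + p.w3 • cw3 (antisym R) c d + p.w4 • cw4 (antisym R) c d
        + p.w5 • cw5 (antisym R) c d + p.w6 • cw6 (antisym R) c d) a b
      + p.v1 • traceIns (cw5 (antisym R)) a b
      + raise2 (fun c d => p.z1 • cz1 (symm R) c d + p.z2 • cz2 (symm R) c d
        + p.z3 • cz3 (symm R) c d + p.z4 • cz4 (symm R) c d + p.z5 • cz5 (symm R) c d) a b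
      + p.v2 • crossIns (cz2 (symm R)) a b
      + p.v3 • traceIns (cz3 (symm R)) a b + p.v4 • traceIns (cz4 (symm R)) a b
      + p.v5 • traceIns (cz5 (symm R)) a b)

/-! ### Fields on `ℝ⁴`, the action and its stationary points -/

/-- Points of the spacetime `ℝ⁴`, with coordinates `(u, v, x, y) = (x^0, x^1, x^2, x^3)`. -/
abbrev Pt := Fin 4 → ℝ

/-- A field of coframes: `e x μ a` is `e_μ{}^a`, that is `ϑ^a = e_μ{}^a dx^μ`. -/
abbrev CoframeField := Pt → Fin 4 → Fin 4 → ℝ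

/-- A connection 1-form: `Γ x μ a b` is the component `Γ_{μ a}{}^b`, that is
`Γ_a{}^b = Γ_{μ a}{}^b dx^μ`. -/
abbrev ConnField := Pt → Fin 4 → Fin 4 → Fin 4 → ℝ

/-- The partial derivative `∂_μ f`. -/
def pderiv (μ : Fin 4) (f : Pt → ℝ) (x : Pt) : ℝ := fderiv ℝ f x (Pi.single μ 1)

/-- The dual frame: `frame e x a μ` is `e^μ{}_a`, that is `e_a = e^μ{}_a ∂_μ`. -/
def frame (e : CoframeField) (x : Pt) : Matrix (Fin 4) (Fin 4) ℝ := (Matrix.of (e x))⁻¹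

/-- Frame components of a 1-form given in coordinate components. -/
def toFrame1 (e : CoframeField) (x : Pt) (α : Fin 4 → ℝ) : Form1 :=
  fun a => ∑ μ, frame e x a μ * α μ

/-- Frame components of a 2-form given in coordinate components. -/
def toFrame2 (e : CoframeField) (x : Pt) (φ : Fin 4 → Fin 4 → ℝ) : Form2 :=
  fun a b => ∑ μ, ∑ ν, frame e x a μ * frame e x b ν * φ μ ν

/-- The torsion `T^a = dϑ^a + Γ_c{}^a ∧ ϑ^c`. -/
def torsion (e : CoframeField) (Γ : ConnField) (x : Pt) (a : Fin 4) : Form2 :=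
  toFrame2 e x fun μ ν =>
    pderiv μ (fun y => e y ν a) x - pderiv ν (fun y => e y μ a) x
      + ∑ c, (Γ x μ c a * e x ν c - Γ x ν c a * e x μ c)

/-- The nonmetricity `Q_{ab} = -D g_{ab} = Γ_a{}^c g_{cb} + Γ_b{}^c g_{ac}` (`g_{ab}` is
constant). -/
def nonmetricity (e : CoframeField) (Γ : ConnField) (x : Pt) (a b : Fin 4) : Form1 :=
  toFrame1 e x fun μ => ∑ c, (Γ x μ a c * metric c b + Γ x μ b c * metric a c)

/-- The curvature `R_a{}^b = dΓ_a{}^b + Γ_c{}^b ∧ Γ_a{}^c`. -/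
def curvatureMixed (e : CoframeField) (Γ : ConnField) (x : Pt) (a b : Fin 4) : Form2 :=
  toFrame2 e x fun μ ν =>
    pderiv μ (fun y => Γ y ν a b) x - pderiv ν (fun y => Γ y μ a b) x
      + ∑ c, (Γ x μ c b * Γ x ν a c - Γ x ν c b * Γ x μ a c)

/-- The curvature `R_{ab} = R_a{}^c g_{cb}`. -/
def curvature (e : CoframeField) (Γ : ConnField) (x : Pt) (a b : Fin 4) : Form2 :=
  raise1 (curvatureMixed e Γ x a) b

/-- The Lagrangian density: the coefficient of `du ∧ dv ∧ dx ∧ dy` in the full even-parity quadratic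
metric-affine Lagrangian 4-form. -/
def lagDensity (p : Params) (e : CoframeField) (Γ : ConnField) (x : Pt) : ℝ :=
  (Matrix.of (e x)).det *
    (lagWeak p (torsion e Γ x) (nonmetricity e Γ x) (curvature e Γ x)
      + lagStrong p (curvature e Γ x))

/-- `(e, Γ)` solves the vacuum field equations of the action: the first variation of the action
with respect to the coframe and the connection vanishes for all smooth compactly supported
variations `δϑ = η`, `δΓ = γ`. -/
def IsSolution (p : Params) (e : CoframeField) (Γ : ConnField) : Prop :=
  ∀ (η : CoframeField) (γ : ConnField), ContDiff ℝ ∞ η → HasCompactSupport η →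
    ContDiff ℝ ∞ γ → HasCompactSupport γ →
    ∫ x, deriv (fun t : ℝ => lagDensity p (fun y => e y + t • η y) (fun y => Γ y + t • γ y) x) 0 = 0

/-! ### The pp-wave metric and the connection Ansatz -/

/-- A function of `(u, x, y)`. -/
abbrev Fun3 := ℝ × ℝ × ℝ → ℝ

/-- The coordinates `(u, x, y)` of a point. -/
def uxy (x : Pt) : ℝ × ℝ × ℝ := (x 0, x 2, x 3)

/-- The semi-null coframe `ϑ^0 = du`, `ϑ^1 = dv + (H/2) du`, `ϑ^2 = dx`, `ϑ^3 = dy` of the pp-wave. -/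
def ppCoframe (H : Fun3) : CoframeField := fun x =>
  ![![1, H (uxy x) / 2, 0, 0], ![0, 1, 0, 0], ![0, 0, 1, 0], ![0, 0, 0, 1]]

/-- The coordinate metric of the coframe is `H du² + 2 du dv - dx² - dy²`. -/
theorem ppCoframe_metric (H : Fun3) (x : Pt) :
    Matrix.of (ppCoframe H x) * metric * (Matrix.of (ppCoframe H x))ᵀ =
      !![H (uxy x), 1, 0, 0; 1, 0, 0, 0; 0, 0, -1, 0; 0, 0, 0, -1] := by
  ext i j
  fin_cases i <;> fin_cases j <;>
    simp [metric, ppCoframe, Matrix.mul_apply, Fin.sum_univ_four]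

/-- The wave form `k = k_a ϑ^a = du`. -/
def kL (a : Fin 4) : ℝ := if a = 0 then 1 else 0

/-- A transversal vector or covector, from its components `A = 2, 3`. -/
def transv (F : Fin 2 → ℝ) : Fin 4 → ℝ := ![0, 0, F 0, F 1]

/-- The connection `Γ_a{}^b = -k (k_a V^b + k^b W_a) + k_a k^b U_c ϑ^c`, where `V^b`, `W^a` and
`U_c` have only the transversal components `V^A`, `W^A`, `U_A`. -/
def ansatzConn (H : Fun3) (W V U : Fin 2 → Fun3) : ConnField := fun x μ a b =>
  ∑ c, ppCoframe H x μ c *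
    (-(kL c * (kL a * transv (fun A => V A (uxy x)) b
        + raise1 kL b * raise1 (transv fun A => W A (uxy x)) a))
      + kL a * raise1 kL b * transv (fun A => U A (uxy x)) c)

/-! ### Potentials, copotentials and the transversal Fourier transform -/

/-- The transversal partial derivative `∂_A` (`∂_x` for `A = 0`, `∂_y` for `A = 1`). -/
def tderiv (A : Fin 2) (F : Fun3) (r : ℝ × ℝ × ℝ) : ℝ :=
  fderiv ℝ F r (![(0, 1, 0), (0, 0, 1)] A)

/-- The two-dimensional Levi-Civita symbol of the transversal plane. -/
def eps2 : Matrix (Fin 2) (Fin 2) ℝ := !![0, 1; -1, 0]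

/-- `F = (1/2)(∂_A 𝓕 + ε_{AB} ∂_B 𝓕̄)`, the vector with potential `P` and copotential `Pb`. -/
def potVec (P Pb : Fun3) (A : Fin 2) (r : ℝ × ℝ × ℝ) : ℝ :=
  (1 / 2) * (tderiv A P r + ∑ B, eps2 A B * tderiv B Pb r)

/-- `F` is smooth, and `F` and all its derivatives decay at least like `(1 + |(x, y)|)⁻³` at
transversal infinity, locally uniformly in `u`. -/
def TransverseDecay (F : Fun3) : Prop :=
  ContDiff ℝ ∞ F ∧ ∀ (n : ℕ) (K : ℝ), ∃ C : ℝ, ∀ (u : ℝ) (s : ℝ × ℝ), |u| ≤ K →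
    (1 + ‖s‖) ^ 3 * ‖iteratedFDeriv ℝ n F (u, s)‖ ≤ C

/-- The transversal Fourier amplitude `F̂(u, q)`, normalized so that
`F(u, x, y) = ∫ F̂(u, q) exp(i (q₁ x + q₂ y)) d²q`. -/
def hat (F : Fun3) (u : ℝ) (q : ℝ × ℝ) : ℂ :=
  (1 / (2 * Real.pi) ^ 2 : ℂ) * ∫ s : ℝ × ℝ,
    (F (u, s) : ℂ) * Complex.exp (-Complex.I * (((q.1 * s.1 + q.2 * s.2 : ℝ)) : ℂ))

/-! ### The algebraic system -/

def varpi0 (p : Params) : ℝ := 3 * p.z1 + p.z4 + 2 * p.v4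
def varpi1 (p : Params) : ℝ := 4 * (p.w1 + p.w2)
def varpi2 (p : Params) : ℝ := 2 * (p.w1 + p.w2) + p.v2
def varpi3 (p : Params) : ℝ := (1 / 3) * (p.z1 + 3 * p.z2)

/-- `𝒬² = (κ / 4ρ) (q₁² + q₂²)`. -/
def qSq (p : Params) (q : ℝ × ℝ) : ℝ := p.κ / (4 * p.ρ) * (q.1 ^ 2 + q.2 ^ 2)

/-- The matrix `M` of the even-parity system. -/
def evenMatrix (p : Params) (q : ℝ × ℝ) : Matrix (Fin 4) (Fin 4) ℝ :=
  !![-(p.a0 / 2), p.a1, 0, p.c1;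
     0, 2 * p.c1 - p.a1, (1 / 3) * (p.a0 - 4 * p.b1), p.a0 / 6 - p.c1 + (4 / 3) * p.b2;
     2 * (p.w1 + p.w4) * qSq p q, p.a0 + p.a1, (2 / 3) * p.v4 * qSq p q,
       p.a0 / 2 + p.c1 + (1 / 3) * p.v4 * qSq p q;
     p.v4 * qSq p q, 0, p.a0 - 4 * p.b1 + (2 / 3) * varpi0 p * qSq p q,
       (1 / 3) * qSq p q * varpi0 p]

/-- The matrix `M̄` of the odd-parity system. -/
def oddMatrix (p : Params) (q : ℝ × ℝ) : Matrix (Fin 3) (Fin 3) ℝ :=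
  !![0, p.a0 - 4 * p.b1 + 4 * p.z1 * qSq p q, 0;
     p.a0 + 2 * p.c1 - 2 * varpi2 p * qSq p q, 0,
       2 * (p.a0 + 2 * p.b2) / 3 - (varpi2 p + varpi3 p) * qSq p q;
     p.a0 + p.a1 - varpi1 p * qSq p q, 0, p.a0 / 2 + p.c1 - varpi2 p * qSq p q]

/-- The even variables `𝒳₀ = 𝒲 - 𝒱`, `𝒳₁ = H - 𝒲 + 𝒰`, `𝒳₂ = 𝒲 + 𝒱 + 𝒰`,
`𝒳₃ = 𝒲 + 𝒱 - 2𝒰`. -/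
def evenVars (H PW PV PU : Fun3) : Fin 4 → Fun3 :=
  ![PW - PV, H - PW + PU, PW + PV + PU, PW + PV - (2 : ℝ) • PU]

/-- The odd variables `𝒳̄₁ = -𝒲̄ + 𝒰̄`, `𝒳̄₂ = 𝒲̄ + 𝒱̄ + 𝒰̄`, `𝒳̄₃ = 𝒲̄ + 𝒱̄ - 2𝒰̄`. -/
def oddVars (QW QV QU : Fun3) : Fin 3 → Fun3 :=
  ![-QW + QU, QW + QV + QU, QW + QV - (2 : ℝ) • QU]

end MAG

end

noncomputable section

namespace MAG

/-! ### Linearity of the algebraic operations -/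

section Linearity

variable {F : Type} [AddCommGroup F] [Module ℝ F]

/-! Apart from the cosmological term and the curvature scalar, which is linear, the Lagrangian is a
quadratic form in torsion, nonmetricity and curvature. Its first variation is therefore a
polarization: the field strengths of the configuration are paired with the variations of the field
strengths.

The configuration is null. Let a lower frame index 0 count +1 and a lower index 1 count -1 (boost
weight). Every component of torsion, nonmetricity and curvature of the wave has weight at least 2.
The pairing conserves weight and the irreducible decompositions respect it, so the wave sees only
components of weight at most -2 of the variations. This has three effects. All quadratic invariants
of the wave vanish, and the Lagrangian reduces to its cosmological term (`lag_wave`). The relevant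
components of the variations contain no background field, so the field equations are linear in the
wave amplitudes; the curvature scalar is treated separately in `scal_curvatureVar_wave`. Finally,
most irreducible parts of the wave are zero, so that only a0, a1, b1, b2, c1, w1, w2, w4, z1, z2,
z4, v2, v4 and the cosmological constant remain (`torPolar_waveTor`, `nmPolar_waveNm`,
`nmTorPolar_wave`, `curvPolar_waveR`).

The first variation is an expression algebraic in the variations plus the divergence of a compactly
supported flux (`deriv_lagDensity_eq`). The fundamental lemma of the calculus of variations turns
stationarity into the vanishing of the cosmological constant, two scalar equations and three
transversal vector equations (`isSolution_iff`).

These equations have constant coefficients in the transversal plane. Cubic decay in two dimensions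
makes every slice of constant u integrable, so the transversal Fourier transform is continuous,
turns derivatives into multiplication by i q, and is injective (`TransverseDecay.eq_zero_of_hat`).
With gradient potentials and curl copotentials, each vector equation has a transform with a part
along q built from the potentials and a part orthogonal to q built from the copotentials. The parts
along q are invertible constant combinations of the last three rows of the even system, the
orthogonal parts of the three rows of the odd system (`connection_eqs_iff`). The scalar equations
are q² times the first even row and times the dynamical equation. The factors q² and q are cancelled
for q ≠ 0, and continuity supplies q = 0. -/

theorem raise1_lin (X Y : Fin 4 → F) (r : ℝ) (a : Fin 4) :
    raise1 (X + r • Y) a = raise1 X a + r • raise1 Y a := by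
  simp only [raise1, Pi.add_apply, Pi.smul_apply, smul_add, Finset.sum_add_distrib,
    Finset.smul_sum, smul_comm r]

theorem raise2_lin (X Y : Fin 4 → Fin 4 → F) (r : ℝ) (a b : Fin 4) :
    raise2 (X + r • Y) a b = raise2 X a b + r • raise2 Y a b := by
  simp only [raise2, Pi.add_apply, Pi.smul_apply, smul_add, Finset.sum_add_distrib,
    Finset.smul_sum, smul_comm r]

theorem antisym_lin (X Y : Fin 4 → Fin 4 → F) (r : ℝ) :
    antisym (X + r • Y) = antisym X + r • antisym Y := by
  ext a b
  simp only [antisym, Pi.add_apply, Pi.smul_apply]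
  module

theorem symm_lin (X Y : Fin 4 → Fin 4 → F) (r : ℝ) :
    symm (X + r • Y) = symm X + r • symm Y := by
  ext a b
  simp only [symm, Pi.add_apply, Pi.smul_apply]
  module

theorem trace_lin (X Y : Fin 4 → Fin 4 → F) (r : ℝ) :
    trace (X + r • Y) = trace X + r • trace Y := by
  simp only [trace, Pi.add_apply, Pi.smul_apply, smul_add, Finset.sum_add_distrib,
    Finset.smul_sum, smul_comm r]

theorem sum_lin {ι : Type} [Fintype ι] (f g : ι → F) (r : ℝ) :
    ∑ i, (f i + r • g i) = ∑ i, f i + r • ∑ i, g i := by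
  rw [Finset.sum_add_distrib, Finset.smul_sum]

end Linearity

theorem wedge11_lin (α β γ : Form1) (r : ℝ) :
    wedge11 α (β + r • γ) = wedge11 α β + r • wedge11 α γ := by
  ext a b
  simp only [wedge11, Pi.add_apply, Pi.smul_apply, smul_eq_mul]
  ring

theorem wedge11_lin_left (α β γ : Form1) (r : ℝ) :
    wedge11 (β + r • γ) α = wedge11 β α + r • wedge11 γ α := by
  ext a b
  simp only [wedge11, Pi.add_apply, Pi.smul_apply, smul_eq_mul]
  ring

theorem wedge21_lin (φ ψ : Form2) (β : Form1) (r : ℝ) :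
    wedge21 (φ + r • ψ) β = wedge21 φ β + r • wedge21 ψ β := by
  ext a b c
  simp only [wedge21, Pi.add_apply, Pi.smul_apply, smul_eq_mul]
  ring

theorem int1_lin (a : Fin 4) (α β : Form1) (r : ℝ) :
    int1 a (α + r • β) = int1 a α + r • int1 a β := rfl

theorem int2_lin (a : Fin 4) (α β : Form2) (r : ℝ) :
    int2 a (α + r • β) = int2 a α + r • int2 a β := rfl

theorem int3_lin (a : Fin 4) (α β : Form3) (r : ℝ) :
    int3 a (α + r • β) = int3 a α + r • int3 a β := rfl

theorem star2_lin (φ ψ : Form2) (r : ℝ) : star2 (φ + r • ψ) = star2 φ + r • star2 ψ := by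
  ext c d
  simp only [star2, raise2_lin, Pi.add_apply, Pi.smul_apply, smul_eq_mul, add_mul,
    Finset.sum_add_distrib, mul_add, mul_assoc, ← Finset.mul_sum]
  ring

theorem star3_lin (φ ψ : Form3) (r : ℝ) : star3 (φ + r • ψ) = star3 φ + r • star3 ψ := by
  ext d
  have h : ∀ a b c, raise1 (fun a' => raise2 (φ a' + r • ψ a') b c) a
      = raise1 (fun a' => raise2 (φ a') b c) a + r • raise1 (fun a' => raise2 (ψ a') b c) a := by
    intro a b c
    rw [← raise1_lin]
    congr 1
    funext a'
    exact raise2_lin _ _ _ _ _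
  simp only [star3, h, Pi.add_apply, Pi.smul_apply, smul_eq_mul, add_mul,
    Finset.sum_add_distrib, mul_add, mul_assoc, ← Finset.mul_sum]
  ring

/-- Definitional, but needed for rewriting: the linearity lemmas match a sum of families, whereas
unfolding produces a family of sums under a binder. -/
theorem lin_fun {ι : Type} {F : Type} [AddCommGroup F] [Module ℝ F] (f g : ι → F) (r : ℝ) :
    (fun i => f i + r • g i) = f + r • g := rfl

theorem lin_fun2 {ι κ : Type} {F : Type} [AddCommGroup F] [Module ℝ F] (f g : ι → κ → F) (r : ℝ) :
    (fun i j => f i j + r • g i j) = f + r • g := rfl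

/-! ### Linearity of the irreducible parts of the torsion -/

section Torsion

variable (T S : Fin 4 → Form2) (r : ℝ)

theorem torTrace_lin : torTrace (T + r • S) = torTrace T + r • torTrace S := by
  simp only [torTrace, Pi.add_apply, Pi.smul_apply, int2_lin, sum_lin]

theorem torAxial_lin : torAxial (T + r • S) = torAxial T + r • torAxial S := by
  simp only [torAxial, Pi.add_apply, Pi.smul_apply, wedge21_lin, sum_lin]

theorem tor2_lin : tor2 (T + r • S) = tor2 T + r • tor2 S := by
  funext a
  simp only [tor2, torTrace_lin, wedge11_lin, Pi.add_apply, Pi.smul_apply]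
  module

theorem tor3_lin : tor3 (T + r • S) = tor3 T + r • tor3 S := by
  funext a
  simp only [tor3, torAxial_lin, int3_lin, lin_fun, raise1_lin, Pi.add_apply, Pi.smul_apply]
  module

theorem tor1_lin : tor1 (T + r • S) = tor1 T + r • tor1 S := by
  funext a
  simp only [tor1, tor2_lin, tor3_lin, Pi.add_apply, Pi.smul_apply]
  module

end Torsion

/-! ### Linearity of the irreducible parts of the nonmetricity -/

section Nonmetricity

variable (Q S : Fin 4 → Fin 4 → Form1) (r : ℝ)

theorem weylForm_lin : weylForm (Q + r • S) = weylForm Q + r • weylForm S := by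
  simp only [weylForm, trace_lin]
  module

theorem nm4_lin : nm4 (Q + r • S) = nm4 Q + r • nm4 S := by
  funext a b
  simp only [nm4, weylForm_lin, Pi.add_apply, Pi.smul_apply]
  module

theorem nmTf_lin (a b : Fin 4) : nmTf (Q + r • S) a b = nmTf Q a b + r • nmTf S a b := by
  simp only [nmTf, weylForm_lin, Pi.add_apply, Pi.smul_apply]
  module

theorem lamForm_lin : lamForm (Q + r • S) = lamForm Q + r • lamForm S := by
  have h : ∀ a, (∑ b, ∑ c, metric b c * int1 c (nmTf (Q + r • S) a b))
      = (∑ b, ∑ c, metric b c * int1 c (nmTf Q a b))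
        + r * ∑ b, ∑ c, metric b c * int1 c (nmTf S a b) := by
    intro a
    simp only [nmTf_lin, int1_lin, mul_add, Finset.sum_add_distrib, Finset.mul_sum, smul_eq_mul,
      mul_left_comm r]
  simp only [lamForm, h, add_smul, mul_smul, sum_lin]

theorem lamBar_lin (a : Fin 4) : lamBar (Q + r • S) a = lamBar Q a + r • lamBar S a := by
  rw [lamBar, lamBar, lamBar, ← star2_lin]
  simp only [nmTf_lin, lamForm_lin, wedge11_lin_left, wedge11_lin, sum_lin]
  congr 1
  module

theorem nm3_lin : nm3 (Q + r • S) = nm3 Q + r • nm3 S := by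
  funext a b
  simp only [nm3, lamForm_lin, symm, int1_lin, Pi.add_apply, Pi.smul_apply, smul_eq_mul]
  module

theorem nm2_lin : nm2 (Q + r • S) = nm2 Q + r • nm2 S := by
  funext a b
  simp only [nm2, lamBar_lin, wedge21_lin, lin_fun2, symm_lin, star3_lin, Pi.add_apply,
    Pi.smul_apply]
  module

theorem nm1_lin : nm1 (Q + r • S) = nm1 Q + r • nm1 S := by
  funext a b
  simp only [nm1, nm2_lin, nm3_lin, nm4_lin, Pi.add_apply, Pi.smul_apply]
  module

end Nonmetricity

/-! ### Linearity of the irreducible parts of the curvature -/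

section Curvature

variable (W S : Fin 4 → Fin 4 → Form2) (r : ℝ)

theorem wX_lin : wX (W + r • S) = wX W + r • wX S := by
  funext a
  simp only [wX, raise2_lin, int2_lin, sum_lin, Pi.add_apply, Pi.smul_apply]

theorem wXs_lin : wXs (W + r • S) = wXs W + r • wXs S := by
  simp only [wXs, wX_lin, Pi.add_apply, Pi.smul_apply, int1_lin, sum_lin]

theorem wXb_lin : wXb (W + r • S) = wXb W + r • wXb S := by
  funext a
  simp only [wXb, raise2_lin, wedge21_lin, sum_lin, star3_lin, Pi.add_apply, Pi.smul_apply]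

theorem wXbs_lin : wXbs (W + r • S) = wXbs W + r • wXbs S := by
  simp only [wXbs, wXb_lin, Pi.add_apply, Pi.smul_apply, int1_lin, sum_lin]

theorem wXa_lin : wXa (W + r • S) = wXa W + r • wXa S := by
  simp only [wXa, wX_lin, raise1_lin, wedge11_lin, sum_lin]

theorem wXba_lin : wXba (W + r • S) = wXba W + r • wXba S := by
  simp only [wXba, wXb_lin, raise1_lin, wedge11_lin, sum_lin]

theorem wPsi_lin (a : Fin 4) : wPsi (W + r • S) a = wPsi W a + r • wPsi S a := by
  simp only [wPsi, wX_lin, raise1_lin, wXs_lin, wXa_lin, int2_lin, smul_eq_mul]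
  module

theorem wPsib_lin (a : Fin 4) : wPsib (W + r • S) a = wPsib W a + r • wPsib S a := by
  simp only [wPsib, wXb_lin, raise1_lin, wXbs_lin, wXba_lin, int2_lin, smul_eq_mul]
  module

theorem star2_neg (φ : Form2) : star2 (-φ) = -star2 φ := by
  have h := star2_lin 0 φ (-1)
  have h0 := star2_lin 0 0 1
  simp only [smul_zero, add_zero, one_smul, left_eq_add, zero_add, neg_smul] at h h0
  rw [h, h0, zero_add]

theorem cw2_lin : cw2 (W + r • S) = cw2 W + r • cw2 S := by
  funext a b
  simp only [cw2, wPsib_lin, wedge11_lin, lin_fun2, antisym_lin, star2_lin, Pi.add_apply,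
    Pi.smul_apply]
  module

theorem cw3_lin : cw3 (W + r • S) = cw3 W + r • cw3 S := by
  funext a b
  simp only [cw3, wXbs_lin, add_smul, smul_assoc, star2_lin, Pi.add_apply, Pi.smul_apply]
  module

theorem cw4_lin : cw4 (W + r • S) = cw4 W + r • cw4 S := by
  funext a b
  simp only [cw4, wPsi_lin, wedge11_lin, lin_fun2, antisym_lin, Pi.add_apply, Pi.smul_apply]
  module

theorem cw5_lin : cw5 (W + r • S) = cw5 W + r • cw5 S := by
  funext a b
  simp only [cw5, wXa_lin, int2_lin, wedge11_lin, lin_fun2, antisym_lin, Pi.add_apply,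
    Pi.smul_apply]
  module

theorem cw6_lin : cw6 (W + r • S) = cw6 W + r • cw6 S := by
  funext a b
  simp only [cw6, wXs_lin, Pi.add_apply, Pi.smul_apply, smul_eq_mul]
  module

theorem cw1_lin : cw1 (W + r • S) = cw1 W + r • cw1 S := by
  funext a b
  simp only [cw1, cw2_lin, cw3_lin, cw4_lin, cw5_lin, cw6_lin, Pi.add_apply, Pi.smul_apply]
  module

theorem cz5_lin : cz5 (W + r • S) = cz5 W + r • cz5 S := by
  funext a b
  simp only [cz5, trace_lin, Pi.add_apply, Pi.smul_apply]
  module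

theorem zTf_lin (a b : Fin 4) : zTf (W + r • S) a b = zTf W a b + r • zTf S a b := by
  simp only [zTf, cz5_lin, Pi.add_apply, Pi.smul_apply]
  module

theorem zY_lin : zY (W + r • S) = zY W + r • zY S := by
  funext a
  simp only [zY, zTf_lin, int2_lin, lin_fun, raise1_lin, sum_lin, Pi.add_apply, Pi.smul_apply]

theorem zYb_lin : zYb (W + r • S) = zYb W + r • zYb S := by
  funext a
  simp only [zYb, zTf_lin, wedge21_lin, sum_lin, star3_lin, Pi.add_apply, Pi.smul_apply]

theorem zYa_lin : zYa (W + r • S) = zYa W + r • zYa S := by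
  simp only [zYa, zY_lin, wedge11_lin, sum_lin, Pi.add_apply, Pi.smul_apply]

theorem zYba_lin : zYba (W + r • S) = zYba W + r • zYba S := by
  simp only [zYba, zYb_lin, wedge11_lin, sum_lin, Pi.add_apply, Pi.smul_apply]

theorem zPhi_lin (a : Fin 4) : zPhi (W + r • S) a = zPhi W a + r • zPhi S a := by
  simp only [zPhi, zY_lin, zYa_lin, int2_lin, Pi.add_apply, Pi.smul_apply]
  module

theorem zPhib_lin (a : Fin 4) : zPhib (W + r • S) a = zPhib W a + r • zPhib S a := by
  simp only [zPhib, zYb_lin, zYba_lin, int2_lin, Pi.add_apply, Pi.smul_apply]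
  module

theorem cz2_lin : cz2 (W + r • S) = cz2 W + r • cz2 S := by
  funext a b
  simp only [cz2, zPhib_lin, wedge11_lin, lin_fun2, symm_lin, star2_lin, Pi.add_apply,
    Pi.smul_apply]
  module

theorem cz3_lin : cz3 (W + r • S) = cz3 W + r • cz3 S := by
  funext a b
  simp only [cz3, zYa_lin, int2_lin, wedge11_lin, lin_fun2, symm_lin, Pi.add_apply,
    Pi.smul_apply]
  module

theorem cz4_lin : cz4 (W + r • S) = cz4 W + r • cz4 S := by
  funext a b
  simp only [cz4, zPhi_lin, wedge11_lin, lin_fun2, symm_lin, Pi.add_apply, Pi.smul_apply]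
  module

theorem cz1_lin : cz1 (W + r • S) = cz1 W + r • cz1 S := by
  funext a b
  simp only [cz1, cz2_lin, cz3_lin, cz4_lin, cz5_lin, Pi.add_apply, Pi.smul_apply]
  module

theorem traceIns_lin : traceIns (W + r • S) = traceIns W + r • traceIns S := by
  funext a b
  simp only [traceIns, raise2_lin, int2_lin, sum_lin, wedge11_lin, Pi.add_apply, Pi.smul_apply]

theorem crossIns_lin : crossIns (W + r • S) = crossIns W + r • crossIns S := by
  funext a b
  simp only [crossIns, raise2_lin, int2_lin, lin_fun, raise1_lin, wedge11_lin, sum_lin,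
    Pi.add_apply, Pi.smul_apply]

end Curvature

/-- The linear map `T ↦ ∑ a_I ⁽ᴵ⁾T^a` with the index lowered. -/
def torOp (p : Params) (T : Fin 4 → Form2) : Fin 4 → Form2 :=
  raise1 (fun b => p.a1 • tor1 T b + p.a2 • tor2 T b + p.a3 • tor3 T b)

/-- The linear map `Q ↦ ∑ b_I ⁽ᴵ⁾Q^{ab}`. -/
def nmOp (p : Params) (Q : Fin 4 → Fin 4 → Form1) : Fin 4 → Fin 4 → Form1 :=
  raise2 (fun c d => p.b1 • nm1 Q c d + p.b2 • nm2 Q c d + p.b3 • nm3 Q c d + p.b4 • nm4 Q c d)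

/-- The linear map `Q ↦ ⁽³⁾Q_{ac} ∧ ϑ^a`. -/
def nmShear (Q : Fin 4 → Fin 4 → Form1) (c : Fin 4) : Form2 := ∑ a, wedge11 (nm3 Q a c) (cof a)

/-- The linear map `Q ↦ ⁽⁴⁾Q^{bc} ∧ ϑ_b`. -/
def nmWeyl (Q : Fin 4 → Fin 4 → Form1) (c : Fin 4) : Form2 :=
  ∑ b, wedge11 (raise2 (nm4 Q) b c) (cofL b)

/-- The linear map `Q ↦ ∑ c_I ⁽ᴵ⁺¹⁾Q_{ab} ∧ ϑ^a`. -/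
def nmTor (p : Params) (Q : Fin 4 → Fin 4 → Form1) (b : Fin 4) : Form2 :=
  ∑ a, wedge11 (p.c1 • nm2 Q a b + p.c2 • nm3 Q a b + p.c3 • nm4 Q a b) (cof a)

/-- The linear map of the curvature-squared part of the Lagrangian. -/
def curvOp (p : Params) (R : Fin 4 → Fin 4 → Form2) (a b : Fin 4) : Form2 :=
  raise2 (fun c d => p.w1 • cw1 (antisym R) c d + p.w2 • cw2 (antisym R) c d
        + p.w3 • cw3 (antisym R) c d + p.w4 • cw4 (antisym R) c d
        + p.w5 • cw5 (antisym R) c d + p.w6 • cw6 (antisym R) c d) a b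
      + p.v1 • traceIns (cw5 (antisym R)) a b
      + raise2 (fun c d => p.z1 • cz1 (symm R) c d + p.z2 • cz2 (symm R) c d
        + p.z3 • cz3 (symm R) c d + p.z4 • cz4 (symm R) c d + p.z5 • cz5 (symm R) c d) a b
      + p.v2 • crossIns (cz2 (symm R)) a b
      + p.v3 • traceIns (cz3 (symm R)) a b + p.v4 • traceIns (cz4 (symm R)) a b
      + p.v5 • traceIns (cz5 (symm R)) a b

/-- The single identity for `x + r • y` contains both axioms: `r = 1` is additivity, and `x = 0` is
homogeneity once `f 0 = 0`, which follows from the identity at `0, 0, 1`. -/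
theorem isLinearMap_of_lin {E F : Type*} [AddCommGroup E] [Module ℝ E] [AddCommGroup F]
    [Module ℝ F] {f : E → F} (h : ∀ x y (r : ℝ), f (x + r • y) = f x + r • f y) :
    IsLinearMap ℝ f := by
  have h0 : f 0 = 0 := by simpa using h 0 0 1
  exact ⟨fun x y => by simpa using h x y 1, fun r x => by simpa [h0] using h 0 x r⟩

theorem isLinearMap_torOp (p : Params) : IsLinearMap ℝ (torOp p) := by
  refine isLinearMap_of_lin fun T S r => ?_
  funext a
  rw [torOp, torOp, torOp, Pi.add_apply, Pi.smul_apply, ← raise1_lin]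
  congr 1
  funext b
  simp only [tor1_lin, tor2_lin, tor3_lin, Pi.add_apply, Pi.smul_apply]
  module

theorem isLinearMap_nmOp (p : Params) : IsLinearMap ℝ (nmOp p) := by
  refine isLinearMap_of_lin fun T S r => ?_
  funext a b
  rw [nmOp, nmOp, nmOp, Pi.add_apply, Pi.smul_apply, Pi.add_apply, Pi.smul_apply, ← raise2_lin]
  congr 1
  funext c d
  simp only [nm1_lin, nm2_lin, nm3_lin, nm4_lin, Pi.add_apply, Pi.smul_apply]
  module

theorem isLinearMap_nmShear : IsLinearMap ℝ nmShear := by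
  refine isLinearMap_of_lin fun T S r => ?_
  funext c
  simp only [nmShear, nm3_lin, Pi.add_apply, Pi.smul_apply, wedge11_lin_left, sum_lin]

theorem isLinearMap_nmWeyl : IsLinearMap ℝ nmWeyl := by
  refine isLinearMap_of_lin fun T S r => ?_
  funext c
  simp only [nmWeyl, nm4_lin, raise2_lin, Pi.add_apply, Pi.smul_apply, wedge11_lin_left, sum_lin]

theorem isLinearMap_nmTor (p : Params) : IsLinearMap ℝ (nmTor p) := by
  refine isLinearMap_of_lin fun T S r => ?_
  funext c
  have h : ∀ a, p.c1 • nm2 (T + r • S) a c + p.c2 • nm3 (T + r • S) a c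
        + p.c3 • nm4 (T + r • S) a c
      = (p.c1 • nm2 T a c + p.c2 • nm3 T a c + p.c3 • nm4 T a c)
        + r • (p.c1 • nm2 S a c + p.c2 • nm3 S a c + p.c3 • nm4 S a c) := by
    intro a
    simp only [nm2_lin, nm3_lin, nm4_lin, Pi.add_apply, Pi.smul_apply]
    module
  simp only [nmTor, h, wedge11_lin_left, sum_lin, Pi.add_apply, Pi.smul_apply]

theorem isLinearMap_curvOp (p : Params) : IsLinearMap ℝ (curvOp p) := by
  refine isLinearMap_of_lin fun T S r => ?_
  funext a b
  have h : (fun c d => p.w1 • cw1 (antisym (T + r • S)) c d + p.w2 • cw2 (antisym (T + r • S)) c d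
        + p.w3 • cw3 (antisym (T + r • S)) c d + p.w4 • cw4 (antisym (T + r • S)) c d
        + p.w5 • cw5 (antisym (T + r • S)) c d + p.w6 • cw6 (antisym (T + r • S)) c d)
      = (fun c d => p.w1 • cw1 (antisym T) c d + p.w2 • cw2 (antisym T) c d
        + p.w3 • cw3 (antisym T) c d + p.w4 • cw4 (antisym T) c d
        + p.w5 • cw5 (antisym T) c d + p.w6 • cw6 (antisym T) c d)
        + r • (fun c d => p.w1 • cw1 (antisym S) c d + p.w2 • cw2 (antisym S) c d
        + p.w3 • cw3 (antisym S) c d + p.w4 • cw4 (antisym S) c d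
        + p.w5 • cw5 (antisym S) c d + p.w6 • cw6 (antisym S) c d) := by
    funext c d
    simp only [antisym_lin, cw1_lin, cw2_lin, cw3_lin, cw4_lin, cw5_lin, cw6_lin, Pi.add_apply,
      Pi.smul_apply]
    module
  have h' : (fun c d => p.z1 • cz1 (symm (T + r • S)) c d + p.z2 • cz2 (symm (T + r • S)) c d
        + p.z3 • cz3 (symm (T + r • S)) c d + p.z4 • cz4 (symm (T + r • S)) c d
        + p.z5 • cz5 (symm (T + r • S)) c d)
      = (fun c d => p.z1 • cz1 (symm T) c d + p.z2 • cz2 (symm T) c d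
        + p.z3 • cz3 (symm T) c d + p.z4 • cz4 (symm T) c d + p.z5 • cz5 (symm T) c d)
        + r • (fun c d => p.z1 • cz1 (symm S) c d + p.z2 • cz2 (symm S) c d
        + p.z3 • cz3 (symm S) c d + p.z4 • cz4 (symm S) c d + p.z5 • cz5 (symm S) c d) := by
    funext c d
    simp only [symm_lin, cz1_lin, cz2_lin, cz3_lin, cz4_lin, cz5_lin, Pi.add_apply,
      Pi.smul_apply]
    module
  rw [Pi.add_apply, Pi.add_apply, Pi.smul_apply, Pi.smul_apply, curvOp, h, h']
  simp only [curvOp, raise2_lin, antisym_lin, symm_lin, cw5_lin, cz2_lin, cz3_lin, cz4_lin,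
    cz5_lin, traceIns_lin, crossIns_lin, Pi.add_apply, Pi.smul_apply]
  module

/-! ### Derivative of the Lagrangian along a curve of field strengths -/

/-- A linear map on a finite-dimensional space is continuous, hence its own derivative. -/
theorem IsLinearMap.hasDerivAt_comp {E F : Type*} [NormedAddCommGroup E] [NormedSpace ℝ E]
    [FiniteDimensional ℝ E] [NormedAddCommGroup F] [NormedSpace ℝ F] {f : E → F}
    (hf : IsLinearMap ℝ f) {c : ℝ → E} {c' : E} {t : ℝ} (h : HasDerivAt c c' t) :
    HasDerivAt (fun s => f (c s)) (f c') t :=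
  ((hf.mk' f).toContinuousLinearMap).hasFDerivAt.comp_hasDerivAt t h

theorem hasDerivAt_inner1 {α β : ℝ → Form1} {α' β' : Form1} {t : ℝ} (hα : HasDerivAt α α' t)
    (hβ : HasDerivAt β β' t) :
    HasDerivAt (fun s => inner1 (α s) (β s)) (inner1 α' (β t) + inner1 (α t) β') t := by
  have hr : IsLinearMap ℝ (fun γ : Form1 => raise1 γ) :=
    isLinearMap_of_lin fun x y r => by funext a; exact raise1_lin x y r a
  have hβ' := hasDerivAt_pi.1 (IsLinearMap.hasDerivAt_comp hr hβ)
  have := HasDerivAt.fun_sum (u := Finset.univ) fun a _ => (hasDerivAt_pi.1 hα a).mul (hβ' a)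
  refine HasDerivAt.congr_deriv this ?_
  simp only [inner1, Finset.sum_add_distrib]

theorem hasDerivAt_inner2 {α β : ℝ → Form2} {α' β' : Form2} {t : ℝ} (hα : HasDerivAt α α' t)
    (hβ : HasDerivAt β β' t) :
    HasDerivAt (fun s => inner2 (α s) (β s)) (inner2 α' (β t) + inner2 (α t) β') t := by
  have hr : IsLinearMap ℝ (fun γ : Form2 => (raise2 γ : Form2)) :=
    isLinearMap_of_lin fun x y r => by funext a b; exact raise2_lin x y r a b
  have hβ' := fun a => hasDerivAt_pi.1 (hasDerivAt_pi.1 (IsLinearMap.hasDerivAt_comp hr hβ) a)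
  have := (HasDerivAt.fun_sum (u := Finset.univ) fun a _ => HasDerivAt.fun_sum (u := Finset.univ)
    fun b _ => (hasDerivAt_pi.1 (hasDerivAt_pi.1 hα a) b).mul (hβ' a b)).const_mul (1 / 2 : ℝ)
  refine HasDerivAt.congr_deriv this ?_
  simp only [inner2, Finset.sum_add_distrib, mul_add]

/-- The scalar `R^{ab} ∧ ⋆ϑ_{ab}`. -/
def scal (R : Fin 4 → Fin 4 → Form2) : ℝ :=
  ∑ a, ∑ b, inner2 (raise2 R a b) (wedge11 (cofL a) (cofL b))

/-- Polarization of the torsion-squared part of the Lagrangian. -/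
def torPolar (p : Params) (T T' : Fin 4 → Form2) : ℝ :=
  ∑ a, (inner2 (T' a) (torOp p T a) + inner2 (T a) (torOp p T' a))

/-- Polarization of the nonmetricity-squared part of the Lagrangian. -/
def nmPolar (p : Params) (Q Q' : Fin 4 → Fin 4 → Form1) : ℝ :=
  ∑ a, ∑ b, (inner1 (Q' a b) (nmOp p Q a b) + inner1 (Q a b) (nmOp p Q' a b))

/-- Polarization of the term of the Lagrangian that mixes shear and Weyl covector. -/
def nmCrossPolar (Q Q' : Fin 4 → Fin 4 → Form1) : ℝ :=
  ∑ c, (inner2 (nmShear Q' c) (nmWeyl Q c) + inner2 (nmShear Q c) (nmWeyl Q' c))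

/-- Polarization of the terms of the Lagrangian that mix nonmetricity and torsion. -/
def nmTorPolar (p : Params) (T T' : Fin 4 → Form2) (Q Q' : Fin 4 → Fin 4 → Form1) : ℝ :=
  ∑ b, (inner2 (nmTor p Q' b) (T b) + inner2 (nmTor p Q b) (T' b))

/-- Polarization of the curvature-squared part of the Lagrangian. -/
def curvPolar (p : Params) (R R' : Fin 4 → Fin 4 → Form2) : ℝ :=
  ∑ a, ∑ b, (inner2 (R' a b) (curvOp p R a b) + inner2 (R a b) (curvOp p R' a b))

/-- Derivative of `lagWeak`. -/
def lagWeakDeriv (p : Params) (T T' : Fin 4 → Form2) (Q Q' : Fin 4 → Fin 4 → Form1)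
    (R' : Fin 4 → Fin 4 → Form2) : ℝ :=
  -(1 / (2 * p.κ)) * (-(p.a0 * scal R') + torPolar p T T' + nmPolar p Q Q'
    + 2 * p.b5 * nmCrossPolar Q Q' - 2 * nmTorPolar p T T' Q Q')

/-- Derivative of `lagStrong`. -/
def lagStrongDeriv (p : Params) (R R' : Fin 4 → Fin 4 → Form2) : ℝ :=
  -(1 / (2 * p.ρ)) * curvPolar p R R'

/-- The operators above only name subexpressions of the Lagrangian. In this form it is visibly a sum
of bilinear pairings of linear maps, to which the product rule applies. -/
theorem lagWeak_eq (p : Params) (T : Fin 4 → Form2) (Q : Fin 4 → Fin 4 → Form1)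
    (R : Fin 4 → Fin 4 → Form2) : lagWeak p T Q R =
      -(1 / (2 * p.κ)) * (2 * p.lam - p.a0 * scal R + (∑ a, inner2 (T a) (torOp p T a))
        + (∑ a, ∑ b, inner1 (Q a b) (nmOp p Q a b))
        + 2 * p.b5 * (∑ c, inner2 (nmShear Q c) (nmWeyl Q c))
        - 2 * (∑ b, inner2 (nmTor p Q b) (T b))) := rfl

theorem lagStrong_eq (p : Params) (R : Fin 4 → Fin 4 → Form2) : lagStrong p R =
    -(1 / (2 * p.ρ)) * ∑ a, ∑ b, inner2 (R a b) (curvOp p R a b) := rfl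

theorem isLinearMap_scal : IsLinearMap ℝ scal := by
  refine isLinearMap_of_lin fun R S r => ?_
  simp only [scal, raise2_lin, smul_eq_mul]
  have h : ∀ (α β γ : Form2), inner2 (α + r • β) γ = inner2 α γ + r • inner2 β γ := by
    intro α β γ
    simp only [inner2, Pi.add_apply, Pi.smul_apply, smul_eq_mul, add_mul, Finset.sum_add_distrib,
      mul_add, mul_assoc, ← Finset.mul_sum]
    ring
  simp only [h, smul_eq_mul, Finset.sum_add_distrib, Finset.mul_sum]

/-- The product rule on each pairing produces exactly the polarizations. The cosmological term is
constant and the curvature scalar is linear, so neither `lam` nor the undifferentiated curvature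
survives. -/
theorem hasDerivAt_lagWeak (p : Params) {T : ℝ → Fin 4 → Form2} {T' : Fin 4 → Form2}
    {Q : ℝ → Fin 4 → Fin 4 → Form1} {Q' : Fin 4 → Fin 4 → Form1}
    {R : ℝ → Fin 4 → Fin 4 → Form2} {R' : Fin 4 → Fin 4 → Form2} {t : ℝ}
    (hT : HasDerivAt T T' t) (hQ : HasDerivAt Q Q' t) (hR : HasDerivAt R R' t) :
    HasDerivAt (fun s => lagWeak p (T s) (Q s) (R s)) (lagWeakDeriv p (T t) T' (Q t) Q' R') t := by
  simp only [lagWeak_eq]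
  refine HasDerivAt.const_mul _ ?_
  have h1 := (IsLinearMap.hasDerivAt_comp isLinearMap_scal hR).const_mul p.a0
  have h2 := HasDerivAt.fun_sum (u := Finset.univ) fun a _ => hasDerivAt_inner2
    (hasDerivAt_pi.1 hT a) (hasDerivAt_pi.1 (IsLinearMap.hasDerivAt_comp (isLinearMap_torOp p) hT) a)
  have h3 := HasDerivAt.fun_sum (u := Finset.univ) fun a _ => HasDerivAt.fun_sum (u := Finset.univ)
    fun b _ => hasDerivAt_inner1 (hasDerivAt_pi.1 (hasDerivAt_pi.1 hQ a) b) (hasDerivAt_pi.1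
      (hasDerivAt_pi.1 (IsLinearMap.hasDerivAt_comp (isLinearMap_nmOp p) hQ) a) b)
  have h4 := (HasDerivAt.fun_sum (u := Finset.univ) fun a _ => hasDerivAt_inner2
    (hasDerivAt_pi.1 (IsLinearMap.hasDerivAt_comp isLinearMap_nmShear hQ) a)
    (hasDerivAt_pi.1 (IsLinearMap.hasDerivAt_comp isLinearMap_nmWeyl hQ) a)).const_mul (2 * p.b5)
  have h5 := (HasDerivAt.fun_sum (u := Finset.univ) fun a _ => hasDerivAt_inner2
    (hasDerivAt_pi.1 (IsLinearMap.hasDerivAt_comp (isLinearMap_nmTor p) hQ) a)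
    (hasDerivAt_pi.1 hT a)).const_mul (2 : ℝ)
  exact ((((h1.const_sub (2 * p.lam)).add h2).add h3).add h4).sub h5

theorem hasDerivAt_lagStrong (p : Params) {R : ℝ → Fin 4 → Fin 4 → Form2}
    {R' : Fin 4 → Fin 4 → Form2} {t : ℝ} (hR : HasDerivAt R R' t) :
    HasDerivAt (fun s => lagStrong p (R s)) (lagStrongDeriv p (R t) R') t := by
  simp only [lagStrong_eq]
  refine HasDerivAt.const_mul _ ?_
  exact HasDerivAt.fun_sum (u := Finset.univ) fun a _ => HasDerivAt.fun_sum (u := Finset.univ)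
    fun b _ => hasDerivAt_inner2 (hasDerivAt_pi.1 (hasDerivAt_pi.1 hR a) b) (hasDerivAt_pi.1
      (hasDerivAt_pi.1 (IsLinearMap.hasDerivAt_comp (isLinearMap_curvOp p) hR) a) b)

/-! ### Explicit components of the algebraic operations -/

section
variable {F : Type} [AddCommGroup F] [Module ℝ F]

/-- In the semi-null frame, raising or lowering exchanges the indices 0 and 1 and changes the sign
of the transversal ones. This exchange is why a wave with lower indices 0 is paired with components
with lower indices 1. -/
theorem raise1_zero (X : Fin 4 → F) : raise1 X 0 = X 1 := by
  simp [raise1, metric, Fin.sum_univ_four]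
theorem raise1_one (X : Fin 4 → F) : raise1 X 1 = X 0 := by
  simp [raise1, metric, Fin.sum_univ_four]
theorem raise1_two (X : Fin 4 → F) : raise1 X 2 = -X 2 := by
  simp [raise1, metric, Fin.sum_univ_four]
theorem raise1_three (X : Fin 4 → F) : raise1 X 3 = -X 3 := by
  simp [raise1, metric, Fin.sum_univ_four]

theorem raise2_eq_raise1 (X : Fin 4 → Fin 4 → F) (a b : Fin 4) :
    raise2 X a b = raise1 (fun c => raise1 (X c) b) a := by
  simp only [raise2, raise1, Finset.smul_sum, smul_smul]

theorem trace_apply (X : Fin 4 → Fin 4 → F) : trace X = X 0 1 + X 1 0 - X 2 2 - X 3 3 := by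
  simp only [trace, metric, Fin.sum_univ_four, Matrix.of_apply, Matrix.cons_val, zero_smul,
    one_smul, neg_smul]
  abel

end

theorem forall_four {P : Fin 4 → Prop} : (∀ a, P a) ↔ P 0 ∧ P 1 ∧ P 2 ∧ P 3 := by
  simp [Fin.forall_fin_succ]

/-- Antisymmetry of the argument is not assumed, so the components appear as halved differences. -/
theorem star2_apply (φ : Form2) :
    star2 φ 0 0 = 0 ∧ star2 φ 0 1 = (φ 2 3 - φ 3 2) / 2 ∧ star2 φ 0 2 = (φ 0 3 - φ 3 0) / 2 ∧
    star2 φ 0 3 = (φ 2 0 - φ 0 2) / 2 ∧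
    star2 φ 1 0 = (φ 3 2 - φ 2 3) / 2 ∧ star2 φ 1 1 = 0 ∧ star2 φ 1 2 = (φ 3 1 - φ 1 3) / 2 ∧
    star2 φ 1 3 = (φ 1 2 - φ 2 1) / 2 ∧
    star2 φ 2 0 = (φ 3 0 - φ 0 3) / 2 ∧ star2 φ 2 1 = (φ 1 3 - φ 3 1) / 2 ∧ star2 φ 2 2 = 0 ∧
    star2 φ 2 3 = (φ 1 0 - φ 0 1) / 2 ∧
    star2 φ 3 0 = (φ 0 2 - φ 2 0) / 2 ∧ star2 φ 3 1 = (φ 2 1 - φ 1 2) / 2 ∧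
    star2 φ 3 2 = (φ 0 1 - φ 1 0) / 2 ∧ star2 φ 3 3 = 0 := by
  refine ⟨?_, ?_, ?_, ?_, ?_, ?_, ?_, ?_, ?_, ?_, ?_, ?_, ?_, ?_, ?_, ?_⟩
  all_goals
    simp only [star2, raise2_eq_raise1, Fin.sum_univ_four, raise1_zero, raise1_one, raise1_two,
      raise1_three]
    norm_num [levi]
    try ring1

theorem star3_apply (φ : Form3) :
    star3 φ 0 = -(φ 0 2 3 - φ 0 3 2 - φ 2 0 3 + φ 2 3 0 + φ 3 0 2 - φ 3 2 0) / 6 ∧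
    star3 φ 1 = (φ 1 2 3 - φ 1 3 2 - φ 2 1 3 + φ 2 3 1 + φ 3 1 2 - φ 3 2 1) / 6 ∧
    star3 φ 2 = -(φ 0 1 3 - φ 0 3 1 - φ 1 0 3 + φ 1 3 0 + φ 3 0 1 - φ 3 1 0) / 6 ∧
    star3 φ 3 = (φ 0 1 2 - φ 0 2 1 - φ 1 0 2 + φ 1 2 0 + φ 2 0 1 - φ 2 1 0) / 6 := by
  refine ⟨?_, ?_, ?_, ?_⟩
  all_goals
    simp only [star3, raise2_eq_raise1, Fin.sum_univ_four, raise1_zero, raise1_one, raise1_two,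
      raise1_three]
    norm_num [levi]
    ring1

theorem inner1_apply (α β : Form1) :
    inner1 α β = α 0 * β 1 + α 1 * β 0 - α 2 * β 2 - α 3 * β 3 := by
  simp only [inner1, Fin.sum_univ_four, raise1_zero, raise1_one, raise1_two, raise1_three]
  ring

/-- Antisymmetry of one argument suffices: it projects the other onto its antisymmetric part, whence
the differences of components of `β`. -/
theorem inner2_apply {α : Form2} (hα : ∀ a b, α a b = -α b a) (β : Form2) :
    inner2 α β = (1 / 2) * (-(α 0 1 * (β 0 1 - β 1 0)) - α 0 2 * (β 1 2 - β 2 1)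
      - α 0 3 * (β 1 3 - β 3 1) - α 1 2 * (β 0 2 - β 2 0) - α 1 3 * (β 0 3 - β 3 0)
      + α 2 3 * (β 2 3 - β 3 2)) := by
  have h0 : ∀ a, α a a = 0 := fun a => by linarith [hα a a]
  simp only [inner2, Fin.sum_univ_four, raise2_eq_raise1, raise1_zero, raise1_one, raise1_two,
    raise1_three, h0, hα 1 0, hα 2 0, hα 3 0, hα 2 1, hα 3 1, hα 3 2]
  ring

theorem cofL_eq : cofL 0 = ![0, 1, 0, 0] ∧ cofL 1 = ![1, 0, 0, 0] ∧ cofL 2 = ![0, 0, -1, 0] ∧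
    cofL 3 = ![0, 0, 0, -1] := by
  refine ⟨?_, ?_, ?_, ?_⟩ <;> (funext a; revert a; rw [forall_four]; simp [cofL, metric])

theorem cof_eq : cof 0 = ![1, 0, 0, 0] ∧ cof 1 = ![0, 1, 0, 0] ∧ cof 2 = ![0, 0, 1, 0] ∧
    cof 3 = ![0, 0, 0, 1] := by
  refine ⟨?_, ?_, ?_, ?_⟩ <;> (funext a; revert a; rw [forall_four]; simp [cof])

theorem metric_apply : metric 0 0 = 0 ∧ metric 0 1 = 1 ∧ metric 0 2 = 0 ∧ metric 0 3 = 0 ∧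
    metric 1 0 = 1 ∧ metric 1 1 = 0 ∧ metric 1 2 = 0 ∧ metric 1 3 = 0 ∧
    metric 2 0 = 0 ∧ metric 2 1 = 0 ∧ metric 2 2 = -1 ∧ metric 2 3 = 0 ∧
    metric 3 0 = 0 ∧ metric 3 1 = 0 ∧ metric 3 2 = 0 ∧ metric 3 3 = -1 := by
  simp [metric]

/-! ### Components of lowest boost weight of the irreducible parts of the curvature -/

section Lowest

theorem alt_self {X : Fin 4 → Fin 4 → Form2} (hX : ∀ a b c d, X a b c d = -X a b d c)
    (a b c : Fin 4) : X a b c c = 0 := by linarith [hX a b c c]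

variable {W Z : Fin 4 → Fin 4 → Form2}

/-- The decomposition commutes with boosts, so the component of weight -2 of `Ψ` can involve only
components of weight -2 of `W`. What is left is the transversal trace of `W_{1A}` along `ϑ^{1B}`. -/
theorem wPsi_lowest (hW : ∀ a b c d, W a b c d = -W a b d c) (hW' : ∀ a b, W a b = -W b a) :
    wPsi W 1 1 = W 1 2 1 2 + W 1 3 1 3 := by
  have h11 : W 1 1 = 0 := by
    have := hW' 1 1
    funext c d; have := congrFun (congrFun this c) d; simp at this ⊢; linarith
  simp only [wPsi, wXa, wX, int2, wedge11, raise2_eq_raise1, raise1_zero, raise1_one,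
    Fin.sum_univ_four, raise1_two, raise1_three, Pi.add_apply, Pi.neg_apply, Pi.smul_apply,
    Pi.sub_apply, cofL, metric_apply, smul_eq_mul, alt_self hW, h11, Pi.zero_apply]
  rw [hW 1 2 2 1, hW 1 3 3 1]
  ring

theorem wPsib_lowest (hW : ∀ a b c d, W a b c d = -W a b d c) (hW' : ∀ a b, W a b = -W b a) :
    wPsib W 1 1 = W 1 2 1 3 - W 1 3 1 2 := by
  have h11 : W 1 1 = 0 := by
    have := hW' 1 1
    funext c d; have := congrFun (congrFun this c) d; simp at this ⊢; linarith
  simp only [wPsib, wXba, wXb, int2, wedge11, raise1_zero, raise1_one, star3_apply, wedge21,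
    Fin.sum_univ_four, raise1_two, raise1_three, Pi.add_apply, Pi.neg_apply, Pi.smul_apply,
    raise2_eq_raise1, Pi.sub_apply, cofL, metric_apply, smul_eq_mul, h11,
    Pi.zero_apply, hW' 2 1, hW' 3 1]
  rw [hW 1 2 3 1, hW 1 2 3 2, hW 1 2 2 1, hW 1 3 3 1, hW 1 3 3 2, hW 1 3 2 1]
  ring

/-- At this weight the curvature is the 2×2 matrix of components of `W_{1A}` along `ϑ^{1B}`. The
second part is its antisymmetric part, the fourth its trace, and the first is left with the
symmetric traceless rest. -/
theorem cw2_lowest (hW : ∀ a b c d, W a b c d = -W a b d c) (hW' : ∀ a b, W a b = -W b a) :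
    cw2 W 1 2 1 2 = 0 ∧ cw2 W 1 2 1 3 = (W 1 2 1 3 - W 1 3 1 2) / 2 ∧
    cw2 W 1 3 1 2 = -(W 1 2 1 3 - W 1 3 1 2) / 2 ∧ cw2 W 1 3 1 3 = 0 := by
  simp only [← wPsib_lowest hW hW']
  refine ⟨?_, ?_, ?_, ?_⟩ <;>
    simp only [cw2, antisym, Pi.neg_apply, star2_apply, Pi.smul_apply, Pi.sub_apply, wedge11, cofL,
      metric_apply, smul_eq_mul] <;> ring

theorem cw4_lowest (hW : ∀ a b c d, W a b c d = -W a b d c) (hW' : ∀ a b, W a b = -W b a) :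
    cw4 W 1 2 1 2 = (W 1 2 1 2 + W 1 3 1 3) / 2 ∧ cw4 W 1 2 1 3 = 0 ∧ cw4 W 1 3 1 2 = 0 ∧
    cw4 W 1 3 1 3 = (W 1 2 1 2 + W 1 3 1 3) / 2 := by
  simp only [← wPsi_lowest hW hW']
  refine ⟨?_, ?_, ?_, ?_⟩ <;>
    simp only [cw4, antisym, Pi.neg_apply, Pi.smul_apply, Pi.sub_apply, wedge11, cofL,
      metric_apply, smul_eq_mul] <;> ring

/-- The third part is a boost-invariant scalar times a tensor made from the metric and the volume
form, so it has weight zero only. The same holds for the sixth part, whereas the fifth fails to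
reach this weight because its 2-form has no component 11. -/
theorem cw3_lowest (W : Fin 4 → Fin 4 → Form2) : cw3 W 1 2 1 2 = 0 ∧ cw3 W 1 2 1 3 = 0 ∧
    cw3 W 1 3 1 2 = 0 ∧ cw3 W 1 3 1 3 = 0 := by
  refine ⟨?_, ?_, ?_, ?_⟩ <;>
    simp only [cw3, star2_apply, Pi.smul_apply, wedge11, cofL, metric_apply, smul_eq_mul] <;> ring

theorem cw5_lowest (W : Fin 4 → Fin 4 → Form2) : cw5 W 1 2 1 2 = 0 ∧ cw5 W 1 2 1 3 = 0 ∧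
    cw5 W 1 3 1 2 = 0 ∧ cw5 W 1 3 1 3 = 0 := by
  have h : wXa W 1 1 = 0 := by simp only [wXa, wedge11, Fin.sum_univ_four, Pi.add_apply]; ring
  refine ⟨?_, ?_, ?_, ?_⟩ <;>
    simp only [cw5, antisym, Pi.smul_apply, Pi.sub_apply, wedge11, cofL, metric_apply,
      smul_eq_mul, int2, h] <;> ring

theorem cw6_lowest (W : Fin 4 → Fin 4 → Form2) : cw6 W 1 2 1 2 = 0 ∧ cw6 W 1 2 1 3 = 0 ∧
    cw6 W 1 3 1 2 = 0 ∧ cw6 W 1 3 1 3 = 0 := by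
  refine ⟨?_, ?_, ?_, ?_⟩ <;>
    simp only [cw6, Pi.smul_apply, wedge11, cofL, metric_apply, smul_eq_mul] <;> ring

theorem zTf_lowest (Z : Fin 4 → Fin 4 → Form2) : zTf Z 1 1 = Z 1 1 ∧ zTf Z 1 2 = Z 1 2 ∧
    zTf Z 1 3 = Z 1 3 ∧ zTf Z 2 1 = Z 2 1 ∧ zTf Z 3 1 = Z 3 1 := by
  simp [zTf, cz5, metric_apply]

/-- The form indices 01 have weight zero, so `Z_{11}` along `ϑ^{01}` has the same weight as the
transversal trace and joins it. -/
theorem zPhi_lowest (hZ : ∀ a b c d, Z a b c d = -Z a b d c) :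
    zPhi Z 1 1 = Z 1 1 0 1 + Z 1 2 1 2 + Z 1 3 1 3 := by
  have h : zYa Z 1 1 = 0 := by simp only [zYa, wedge11, Fin.sum_univ_four, Pi.add_apply]; ring
  have h' : zTf Z 1 0 1 1 = 0 := by
    simp only [zTf, cz5, trace_apply, Pi.sub_apply, Pi.add_apply, Pi.smul_apply, alt_self hZ,
      smul_eq_mul]
    ring
  simp only [zPhi, Pi.sub_apply, Pi.smul_apply, int2, h, zY, Fin.sum_univ_four, raise1_zero,
    raise1_one, raise1_two, raise1_three, Pi.add_apply, Pi.neg_apply, h', zTf_lowest, smul_eq_mul]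
  rw [hZ 1 2 2 1, hZ 1 3 3 1]
  ring

theorem zPhib_lowest (hZ : ∀ a b c d, Z a b c d = -Z a b d c) (hZ' : ∀ a b, Z a b = Z b a) :
    zPhib Z 1 1 = Z 1 1 2 3 - Z 1 2 1 3 + Z 1 3 1 2 := by
  have h : zYba Z 1 1 = 0 := by simp only [zYba, wedge11, Fin.sum_univ_four, Pi.add_apply]; ring
  simp only [zPhib, Pi.sub_apply, Pi.smul_apply, int2, h, zYb, Fin.sum_univ_four,
    star3_apply, Pi.add_apply, wedge21, cof_eq, Matrix.cons_val, zTf_lowest, smul_eq_mul]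
  rw [hZ' 2 1, hZ' 3 1, hZ 1 2 3 1, hZ 1 3 2 1, hZ 1 1 3 2]
  ring

theorem cz2_lowest (hZ : ∀ a b c d, Z a b c d = -Z a b d c) (hZ' : ∀ a b, Z a b = Z b a) :
    cz2 Z 1 1 1 2 = 0 ∧ cz2 Z 1 1 1 3 = 0 ∧
    cz2 Z 1 1 2 3 = (Z 1 1 2 3 - Z 1 2 1 3 + Z 1 3 1 2) / 2 ∧
    cz2 Z 1 2 1 2 = 0 ∧ cz2 Z 1 2 1 3 = -(Z 1 1 2 3 - Z 1 2 1 3 + Z 1 3 1 2) / 4 ∧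
    cz2 Z 1 3 1 2 = (Z 1 1 2 3 - Z 1 2 1 3 + Z 1 3 1 2) / 4 ∧ cz2 Z 1 3 1 3 = 0 := by
  simp only [← zPhib_lowest hZ hZ']
  refine ⟨?_, ?_, ?_, ?_, ?_, ?_, ?_⟩ <;>
    simp only [cz2, symm, Pi.add_apply, star2_apply, Pi.smul_apply, wedge11, cofL,
      metric_apply, smul_eq_mul] <;> ring

theorem cz2_symm (Z : Fin 4 → Fin 4 → Form2) (a b : Fin 4) : cz2 Z a b = cz2 Z b a := by
  simp only [cz2, symm, add_comm]

theorem cz2_alt (Z : Fin 4 → Fin 4 → Form2) (a b c d : Fin 4) : cz2 Z a b c d = -cz2 Z a b d c := by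
  revert c d
  simp only [forall_four, cz2, Pi.smul_apply, star2_apply, smul_eq_mul]
  refine ⟨⟨?_, ?_, ?_, ?_⟩, ⟨?_, ?_, ?_, ?_⟩, ⟨?_, ?_, ?_, ?_⟩, ⟨?_, ?_, ?_, ?_⟩⟩ <;> ring

theorem cz3_lowest (Z : Fin 4 → Fin 4 → Form2) : cz3 Z 1 1 1 2 = 0 ∧ cz3 Z 1 1 1 3 = 0 ∧
    cz3 Z 1 1 2 3 = 0 ∧ cz3 Z 1 2 1 2 = 0 ∧ cz3 Z 1 2 1 3 = 0 ∧ cz3 Z 1 3 1 2 = 0 ∧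
    cz3 Z 1 3 1 3 = 0 := by
  have h : zYa Z 1 1 = 0 := by simp only [zYa, wedge11, Fin.sum_univ_four, Pi.add_apply]; ring
  refine ⟨?_, ?_, ?_, ?_, ?_, ?_, ?_⟩ <;>
    simp only [cz3, symm, Pi.add_apply, Pi.smul_apply, Pi.sub_apply, wedge11, cofL,
      metric_apply, smul_eq_mul, int2, h] <;> ring

theorem cz4_lowest (hZ : ∀ a b c d, Z a b c d = -Z a b d c) :
    cz4 Z 1 1 1 2 = 0 ∧ cz4 Z 1 1 1 3 = 0 ∧ cz4 Z 1 1 2 3 = 0 ∧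
    cz4 Z 1 2 1 2 = (Z 1 1 0 1 + Z 1 2 1 2 + Z 1 3 1 3) / 4 ∧ cz4 Z 1 2 1 3 = 0 ∧
    cz4 Z 1 3 1 2 = 0 ∧ cz4 Z 1 3 1 3 = (Z 1 1 0 1 + Z 1 2 1 2 + Z 1 3 1 3) / 4 ∧
    cz4 Z 1 1 0 1 = (Z 1 1 0 1 + Z 1 2 1 2 + Z 1 3 1 3) / 2 := by
  simp only [← zPhi_lowest hZ]
  refine ⟨?_, ?_, ?_, ?_, ?_, ?_, ?_, ?_⟩ <;>
    simp only [cz4, symm, Pi.add_apply, Pi.smul_apply, wedge11, cofL,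
      metric_apply, smul_eq_mul] <;> ring

theorem cz4_symm (Z : Fin 4 → Fin 4 → Form2) (a b : Fin 4) : cz4 Z a b = cz4 Z b a := by
  simp only [cz4, symm, add_comm]

theorem cz4_alt (Z : Fin 4 → Fin 4 → Form2) (a b c d : Fin 4) : cz4 Z a b c d = -cz4 Z a b d c := by
  simp only [cz4, symm, wedge11, Pi.smul_apply, Pi.add_apply, smul_eq_mul]
  ring

theorem cz5_lowest (Z : Fin 4 → Fin 4 → Form2) : cz5 Z 1 1 = 0 ∧ cz5 Z 1 2 = 0 ∧ cz5 Z 1 3 = 0 := by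
  simp [cz5, metric_apply]

/-- The contraction `e_c ⌟ X^{cb}` along `e_1` with `b = 0`. -/
theorem traceIns_apply (X : Fin 4 → Fin 4 → Form2) :
    traceIns X 0 0 1 2 = 0 ∧ traceIns X 0 0 1 3 = 0 ∧ traceIns X 0 0 2 3 = 0 ∧
    traceIns X 0 2 1 2 = 0 ∧ traceIns X 0 2 1 3 = 0 ∧ traceIns X 0 3 1 2 = 0 ∧
    traceIns X 0 3 1 3 = 0 ∧
    traceIns X 2 0 1 2 = -(X 1 1 0 1 + X 0 1 1 1 - X 2 1 2 1 - X 3 1 3 1) ∧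
    traceIns X 2 0 1 3 = 0 ∧ traceIns X 3 0 1 2 = 0 ∧
    traceIns X 3 0 1 3 = -(X 1 1 0 1 + X 0 1 1 1 - X 2 1 2 1 - X 3 1 3 1) := by
  refine ⟨?_, ?_, ?_, ?_, ?_, ?_, ?_, ?_, ?_, ?_, ?_⟩ <;>
    simp only [traceIns, wedge11, cof_eq, Matrix.cons_val, Fin.sum_univ_four, Pi.add_apply, int2,
      raise2_eq_raise1, raise1_zero, raise1_one, raise1_two, raise1_three, Pi.neg_apply] <;> ring

theorem crossIns_apply (X : Fin 4 → Fin 4 → Form2) :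
    crossIns X 0 0 1 2 = X 1 1 1 2 - X 2 1 1 1 ∧ crossIns X 0 0 1 3 = X 1 1 1 3 - X 3 1 1 1 ∧
    crossIns X 0 0 2 3 = X 2 1 1 3 - X 3 1 1 2 ∧
    crossIns X 0 2 1 2 = X 2 2 1 1 - X 1 2 1 2 ∧ crossIns X 0 2 1 3 = X 3 2 1 1 - X 1 2 1 3 ∧
    crossIns X 0 3 1 2 = X 2 3 1 1 - X 1 3 1 2 ∧ crossIns X 0 3 1 3 = X 3 3 1 1 - X 1 3 1 3 ∧
    crossIns X 2 0 1 2 = X 2 1 2 1 - X 1 1 2 2 ∧ crossIns X 2 0 1 3 = X 3 1 2 1 - X 1 1 2 3 ∧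
    crossIns X 3 0 1 2 = X 2 1 3 1 - X 1 1 3 2 ∧ crossIns X 3 0 1 3 = X 3 1 3 1 - X 1 1 3 3 := by
  refine ⟨?_, ?_, ?_, ?_, ?_, ?_, ?_, ?_, ?_, ?_, ?_⟩ <;>
    simp only [crossIns, wedge11, cofL, metric_apply, Fin.sum_univ_four, Pi.add_apply, int2,
      raise2_eq_raise1, raise1_zero, raise1_one, raise1_two, raise1_three, Pi.neg_apply] <;> ring

/-! ### Antisymmetry in the form indices -/

theorem wedge11_alt (α β : Form1) (a b : Fin 4) : wedge11 α β a b = -wedge11 α β b a := by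
  simp only [wedge11]
  ring

theorem star2_alt (φ : Form2) (a b : Fin 4) : star2 φ a b = -star2 φ b a := by
  revert a b
  simp only [forall_four, star2_apply]
  refine ⟨⟨?_, ?_, ?_, ?_⟩, ⟨?_, ?_, ?_, ?_⟩, ⟨?_, ?_, ?_, ?_⟩, ⟨?_, ?_, ?_, ?_⟩⟩ <;> ring

theorem traceIns_alt (X : Fin 4 → Fin 4 → Form2) (a b c d : Fin 4) :
    traceIns X a b c d = -traceIns X a b d c := wedge11_alt _ _ _ _

theorem crossIns_alt (X : Fin 4 → Fin 4 → Form2) (a b c d : Fin 4) :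
    crossIns X a b c d = -crossIns X a b d c := by
  simp only [crossIns, Finset.sum_apply, ← Finset.sum_neg_distrib]
  exact Finset.sum_congr rfl fun _ _ => wedge11_alt _ _ _ _

theorem raise2_alt {X : Fin 4 → Fin 4 → Form2} (hX : ∀ a b c d, X a b c d = -X a b d c)
    (a b c d : Fin 4) : raise2 X a b c d = -raise2 X a b d c := by
  simp only [raise2, Finset.sum_apply, Pi.smul_apply, ← Finset.sum_neg_distrib, smul_eq_mul,
    ← mul_neg]
  exact Finset.sum_congr rfl fun _ _ => Finset.sum_congr rfl fun _ _ => by rw [hX]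

theorem antisym_alt {X : Fin 4 → Fin 4 → Form2} (hX : ∀ a b c d, X a b c d = -X a b d c)
    (a b c d : Fin 4) : antisym X a b c d = -antisym X a b d c := by
  simp only [antisym, Pi.smul_apply, Pi.sub_apply, smul_eq_mul]
  rw [hX, hX b a c d]
  ring

theorem symm_alt {X : Fin 4 → Fin 4 → Form2} (hX : ∀ a b c d, X a b c d = -X a b d c)
    (a b c d : Fin 4) : symm X a b c d = -symm X a b d c := by
  simp only [symm, Pi.smul_apply, Pi.add_apply, smul_eq_mul]
  rw [hX, hX b a c d]
  ring

/-- Each summand is built from wedge products, Hodge duals or the curvature itself. The antisymmetry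
allows pairings with `curvOp p R` to be written in independent form components. -/
theorem curvOp_alt (p : Params) {R : Fin 4 → Fin 4 → Form2}
    (hR : ∀ a b c d, R a b c d = -R a b d c) (a b c d : Fin 4) :
    curvOp p R a b c d = -curvOp p R a b d c := by
  have hW := antisym_alt hR
  have hZ := symm_alt hR
  have h2 : ∀ a b c d, cw2 (antisym R) a b c d = -cw2 (antisym R) a b d c := fun a b c d => by
    simp only [cw2, Pi.neg_apply]
    rw [star2_alt]
  have h3 : ∀ a b c d, cw3 (antisym R) a b c d = -cw3 (antisym R) a b d c := fun a b c d => by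
    simp only [cw3, Pi.smul_apply]
    rw [star2_alt, smul_neg]
  have h4 : ∀ a b c d, cw4 (antisym R) a b c d = -cw4 (antisym R) a b d c := fun a b c d => by
    simp only [cw4, antisym, Pi.neg_apply, Pi.smul_apply, Pi.sub_apply, wedge11, smul_eq_mul]
    ring
  have h5 : ∀ a b c d, cw5 (antisym R) a b c d = -cw5 (antisym R) a b d c := fun a b c d => by
    simp only [cw5, antisym, Pi.smul_apply, Pi.sub_apply, wedge11, smul_eq_mul]
    ring
  have h6 : ∀ a b c d, cw6 (antisym R) a b c d = -cw6 (antisym R) a b d c := fun a b c d => by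
    simp only [cw6, Pi.smul_apply]
    rw [wedge11_alt, smul_neg]
  have h1 : ∀ a b c d, cw1 (antisym R) a b c d = -cw1 (antisym R) a b d c := fun a b c d => by
    simp only [cw1, Pi.sub_apply]
    rw [h2, h3, h4, h5, h6, hW]
    ring
  have k3 : ∀ a b c d, cz3 (symm R) a b c d = -cz3 (symm R) a b d c := fun a b c d => by
    simp only [cz3, symm, zYa, Pi.smul_apply, Pi.sub_apply, Pi.add_apply, wedge11, smul_eq_mul,
      Fin.sum_univ_four]
    ring
  have k5 : ∀ a b c d, cz5 (symm R) a b c d = -cz5 (symm R) a b d c := fun a b c d => by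
    simp only [cz5, trace_apply, Pi.smul_apply, Pi.sub_apply, Pi.add_apply, smul_eq_mul]
    rw [hZ, hZ 1 0 c d, hZ 2 2 c d, hZ 3 3 c d]
    ring
  have k1 : ∀ a b c d, cz1 (symm R) a b c d = -cz1 (symm R) a b d c := fun a b c d => by
    simp only [cz1, Pi.sub_apply]
    rw [cz2_alt, k3, cz4_alt, k5, hZ]
    ring
  have hA := raise2_alt (X := fun c d => p.w1 • cw1 (antisym R) c d + p.w2 • cw2 (antisym R) c d
        + p.w3 • cw3 (antisym R) c d + p.w4 • cw4 (antisym R) c d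
        + p.w5 • cw5 (antisym R) c d + p.w6 • cw6 (antisym R) c d) (fun a b c d => by
    simp only [Pi.add_apply, Pi.smul_apply, smul_eq_mul]
    rw [h1, h2, h3, h4, h5, h6]
    ring) a b c d
  have hB := raise2_alt (X := fun c d => p.z1 • cz1 (symm R) c d + p.z2 • cz2 (symm R) c d
        + p.z3 • cz3 (symm R) c d + p.z4 • cz4 (symm R) c d + p.z5 • cz5 (symm R) c d)
    (fun a b c d => by
      simp only [Pi.add_apply, Pi.smul_apply, smul_eq_mul]
      rw [k1, cz2_alt, k3, cz4_alt, k5]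
      ring) a b c d
  simp only [curvOp, Pi.add_apply, Pi.smul_apply, smul_eq_mul]
  linear_combination hA + hB + p.v1 * traceIns_alt (cw5 (antisym R)) a b c d
    + p.v2 * crossIns_alt (cz2 (symm R)) a b c d + p.v3 * traceIns_alt (cz3 (symm R)) a b c d
    + p.v4 * traceIns_alt (cz4 (symm R)) a b c d + p.v5 * traceIns_alt (cz5 (symm R)) a b c d

end Lowest

/-! ### Curvature tensors of a plane wave -/

/-- The 2-form `x ϑ^{02} + y ϑ^{03} + c ϑ^{23}`. -/
def nullForm (x y c : ℝ) : Form2 := ![![0, 0, x, y], ![0, 0, 0, 0], ![-x, 0, 0, c], ![-y, 0, -c, 0]]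

theorem nullForm_apply (x y c : ℝ) : nullForm x y c 0 0 = 0 ∧ nullForm x y c 0 1 = 0 ∧
    nullForm x y c 0 2 = x ∧ nullForm x y c 0 3 = y ∧ nullForm x y c 1 0 = 0 ∧
    nullForm x y c 1 1 = 0 ∧ nullForm x y c 1 2 = 0 ∧ nullForm x y c 1 3 = 0 ∧
    nullForm x y c 2 0 = -x ∧ nullForm x y c 2 1 = 0 ∧ nullForm x y c 2 2 = 0 ∧
    nullForm x y c 2 3 = c ∧ nullForm x y c 3 0 = -y ∧ nullForm x y c 3 1 = 0 ∧
    nullForm x y c 3 2 = -c ∧ nullForm x y c 3 3 = 0 :=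
  ⟨rfl, rfl, rfl, rfl, rfl, rfl, rfl, rfl, rfl, rfl, rfl, rfl, rfl, rfl, rfl, rfl⟩

/-- The tensor-valued form with components `A`, `B`, `C`, `D`, `E` at the index pairs `00`, `02`,
`03`, `20`, `30`. -/
def waveTensor {F : Type} [Zero F] (A B C D E : F) : Fin 4 → Fin 4 → F :=
  ![![A, 0, B, C], ![0, 0, 0, 0], ![D, 0, 0, 0], ![E, 0, 0, 0]]

theorem waveTensor_apply {F : Type} [Zero F] (A B C D E : F) :
    waveTensor A B C D E 0 0 = A ∧ waveTensor A B C D E 0 1 = 0 ∧ waveTensor A B C D E 0 2 = B ∧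
    waveTensor A B C D E 0 3 = C ∧ waveTensor A B C D E 1 0 = 0 ∧ waveTensor A B C D E 1 1 = 0 ∧
    waveTensor A B C D E 1 2 = 0 ∧ waveTensor A B C D E 1 3 = 0 ∧ waveTensor A B C D E 2 0 = D ∧
    waveTensor A B C D E 2 1 = 0 ∧ waveTensor A B C D E 2 2 = 0 ∧ waveTensor A B C D E 2 3 = 0 ∧
    waveTensor A B C D E 3 0 = E ∧ waveTensor A B C D E 3 1 = 0 ∧ waveTensor A B C D E 3 2 = 0 ∧
    waveTensor A B C D E 3 3 = 0 :=
  ⟨rfl, rfl, rfl, rfl, rfl, rfl, rfl, rfl, rfl, rfl, rfl, rfl, rfl, rfl, rfl, rfl⟩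

/-- Antisymmetric wave curvature. -/
def waveW (q r s t : ℝ) : Fin 4 → Fin 4 → Form2 :=
  waveTensor 0 (nullForm q r 0) (nullForm s t 0) (nullForm (-q) (-r) 0) (nullForm (-s) (-t) 0)

/-- Symmetric wave curvature. -/
def waveZ (x y c q r s t : ℝ) : Fin 4 → Fin 4 → Form2 :=
  waveTensor (nullForm x y c) (nullForm q r 0) (nullForm s t 0) (nullForm q r 0) (nullForm s t 0)

/-- The wave curvature `R_{ab}`. -/
def waveR (x y c n22 n23 n32 n33 m22 m23 m32 m33 : ℝ) : Fin 4 → Fin 4 → Form2 :=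
  waveTensor (nullForm x y c) (nullForm n22 n23 0) (nullForm n32 n33 0) (nullForm m22 m23 0)
    (nullForm m32 m33 0)

/-! ### Irreducible decomposition of the wave curvature -/

section Wave

variable (x y c q r s t : ℝ)

theorem wX_waveW (a b : Fin 4) :
    wX (waveW q r s t) a b = if a = 1 ∧ b = 0 then q + t else 0 := by
  revert a b
  simp only [forall_four, wX, Finset.sum_apply, Fin.sum_univ_four, int2, raise2_eq_raise1,
    raise1_zero, raise1_one, raise1_two, raise1_three, waveW, waveTensor_apply, Pi.neg_apply,
    nullForm_apply, Pi.zero_apply, neg_zero, neg_neg, add_zero, zero_add]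
  simp

theorem wXb_waveW (a b : Fin 4) :
    wXb (waveW q r s t) a b = if a = 1 ∧ b = 0 then s - r else 0 := by
  revert a b
  simp only [forall_four, wXb, star3_apply, Fin.sum_univ_four, wedge21, raise2_eq_raise1,
    raise1_zero, raise1_one, raise1_two, raise1_three, waveW, waveTensor_apply, Pi.neg_apply,
    nullForm_apply, Pi.zero_apply, Pi.add_apply, neg_zero, cofL, metric_apply, mul_zero, zero_mul,
    add_zero, zero_add, sub_zero]
  simp
  ring

theorem wPsi_waveW (a b : Fin 4) :
    wPsi (waveW q r s t) a b = if a = 0 ∧ b = 0 then q + t else 0 := by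
  have h : wXs (waveW q r s t) = 0 := by simp [wXs, int1, wX_waveW, Fin.sum_univ_four]
  have h' : ∀ a b, wXa (waveW q r s t) a b = 0 := by
    simp [forall_four, wXa, wedge11, Fin.sum_univ_four, raise1_zero, raise1_one, raise1_two,
      raise1_three, wX_waveW, cof_eq]
  revert a b
  simp [forall_four, wPsi, h, h', int2, raise1_zero, raise1_one, raise1_two, raise1_three, wX_waveW]

theorem wPsib_waveW (a b : Fin 4) :
    wPsib (waveW q r s t) a b = if a = 0 ∧ b = 0 then s - r else 0 := by
  have h : wXbs (waveW q r s t) = 0 := by simp [wXbs, int1, wXb_waveW, Fin.sum_univ_four]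
  have h' : ∀ a b, wXba (waveW q r s t) a b = 0 := by
    simp [forall_four, wXba, wedge11, Fin.sum_univ_four, raise1_zero, raise1_one, raise1_two,
      raise1_three, wXb_waveW, cof_eq]
  revert a b
  simp [forall_four, wPsib, h, h', int2, raise1_zero, raise1_one, raise1_two, raise1_three,
    wXb_waveW]

/-- An antisymmetric wave curvature amounts to the 2×2 matrix with rows `q, r` and `s, t`. Its
irreducible parts are the antisymmetric part (second), the trace (fourth) and the symmetric
traceless part (first); all others are zero. -/
theorem cw2_waveW : cw2 (waveW q r s t) = waveW 0 ((r - s) / 2) (-(r - s) / 2) 0 := by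
  funext a b c d
  revert a b c d
  simp only [forall_four, cw2, Pi.neg_apply, star2_apply, antisym, Pi.smul_apply, Pi.sub_apply,
    wedge11, cofL, metric_apply, wPsib_waveW, smul_eq_mul, Fin.reduceEq, and_self, and_false,
    false_and, reduceIte]
  simp only [waveW, waveTensor_apply, nullForm_apply, Pi.zero_apply]
  norm_num
  constructorm* _ ∧ _ <;> ring

theorem cw4_waveW : cw4 (waveW q r s t) = waveW ((q + t) / 2) 0 0 ((q + t) / 2) := by
  funext a b c d
  revert a b c d
  simp only [forall_four, cw4, Pi.neg_apply, antisym, Pi.smul_apply, Pi.sub_apply,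
    wedge11, cofL, metric_apply, wPsi_waveW, smul_eq_mul, Fin.reduceEq, and_self, and_false,
    false_and, reduceIte]
  simp only [waveW, waveTensor_apply, nullForm_apply, Pi.zero_apply]
  norm_num
  constructorm* _ ∧ _ <;> ring

theorem cw3_waveW : cw3 (waveW q r s t) = 0 := by
  have h : wXbs (waveW q r s t) = 0 := by simp [wXbs, int1, wXb_waveW, Fin.sum_univ_four]
  funext a b c d
  revert c d
  simp [forall_four, cw3, h, star2_apply]

theorem cw5_waveW : cw5 (waveW q r s t) = 0 := by
  have h' : ∀ a b, wXa (waveW q r s t) a b = 0 := by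
    simp [forall_four, wXa, wedge11, Fin.sum_univ_four, raise1_zero, raise1_one, raise1_two,
      raise1_three, wX_waveW, cof_eq]
  funext a b c d
  simp [cw5, antisym, int2, h', wedge11]

theorem cw6_waveW : cw6 (waveW q r s t) = 0 := by
  have h : wXs (waveW q r s t) = 0 := by simp [wXs, int1, wX_waveW, Fin.sum_univ_four]
  funext a b c d
  simp [cw6, h]

theorem cw1_waveW : cw1 (waveW q r s t) =
    waveW ((q - t) / 2) ((r + s) / 2) ((r + s) / 2) (-(q - t) / 2) := by
  funext a b c d
  simp only [cw1, cw2_waveW, cw3_waveW, cw4_waveW, cw5_waveW, cw6_waveW, Pi.sub_apply,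
    Pi.zero_apply]
  revert a b c d
  simp only [forall_four, waveW, waveTensor_apply, nullForm_apply, Pi.zero_apply]
  norm_num
  constructorm* _ ∧ _ <;> ring

theorem cz5_waveZ : cz5 (waveZ x y c q r s t) = 0 := by
  funext a b
  simp [cz5, trace_apply, waveZ, waveTensor_apply]

theorem zTf_waveZ : zTf (waveZ x y c q r s t) = waveZ x y c q r s t := by
  funext a b
  simp [zTf, cz5_waveZ]

theorem zY_waveZ (a b : Fin 4) :
    zY (waveZ x y c q r s t) a b = if a = 0 ∧ b = 0 then q + t else 0 := by
  revert a b
  simp only [zY, zTf_waveZ]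
  simp only [forall_four, Finset.sum_apply, Fin.sum_univ_four, int2,
    raise1_zero, raise1_one, raise1_two, raise1_three, waveZ, waveTensor_apply, Pi.neg_apply,
    nullForm_apply, Pi.zero_apply, neg_zero, neg_neg, add_zero, zero_add]
  simp

theorem zYb_waveZ (a b : Fin 4) :
    zYb (waveZ x y c q r s t) a b = if a = 0 ∧ b = 0 then r - s - c else 0 := by
  revert a b
  simp only [zYb, zTf_waveZ]
  simp only [forall_four, star3_apply, Fin.sum_univ_four, wedge21, waveZ, waveTensor_apply,
    nullForm_apply, Pi.zero_apply, Pi.add_apply, cof_eq, Matrix.cons_val, mul_zero,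
    zero_mul, add_zero, zero_add, sub_zero, Fin.reduceEq, and_self, and_false, false_and, reduceIte]
  norm_num
  ring

theorem zYa_waveZ (a b : Fin 4) : zYa (waveZ x y c q r s t) a b = 0 := by
  revert a b
  simp [forall_four, zYa, wedge11, Fin.sum_univ_four, zY_waveZ, cof_eq]

theorem zYba_waveZ (a b : Fin 4) : zYba (waveZ x y c q r s t) a b = 0 := by
  revert a b
  simp [forall_four, zYba, wedge11, Fin.sum_univ_four, zYb_waveZ, cof_eq]

theorem zPhi_waveZ (a b : Fin 4) :
    zPhi (waveZ x y c q r s t) a b = if a = 0 ∧ b = 0 then q + t else 0 := by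
  simp [zPhi, zY_waveZ, int2, zYa_waveZ]

theorem zPhib_waveZ (a b : Fin 4) :
    zPhib (waveZ x y c q r s t) a b = if a = 0 ∧ b = 0 then r - s - c else 0 := by
  simp [zPhib, zYb_waveZ, int2, zYba_waveZ]

/-- Only the combination `r - s - c` enters `Φ̄`, so the second parts form a one-parameter family
with the components `c, r, s` in the fixed ratio 2 : -1 : 1. -/
theorem cz2_waveZ : cz2 (waveZ x y c q r s t) =
    waveZ 0 0 (-(r - s - c) / 2) 0 ((r - s - c) / 4) (-(r - s - c) / 4) 0 := by
  funext a b i j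
  revert a b i j
  simp only [forall_four, cz2, star2_apply, symm, Pi.smul_apply, Pi.add_apply,
    wedge11, cofL, metric_apply, zPhib_waveZ, smul_eq_mul, Fin.reduceEq, and_self, and_false,
    false_and, reduceIte]
  simp only [waveZ, waveTensor_apply, nullForm_apply, Pi.zero_apply]
  norm_num
  constructorm* _ ∧ _ <;> ring

theorem cz3_waveZ : cz3 (waveZ x y c q r s t) = 0 := by
  funext a b i j
  simp [cz3, symm, int2, zYa_waveZ, wedge11]

/-- The symmetric wave curvature with a single trace, the fourth irreducible part. -/
def waveTr (z : ℝ) : Fin 4 → Fin 4 → Form2 :=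
  waveTensor (-(2 * z) • wedge11 (cof 0) (cof 1)) (nullForm z 0 0) (nullForm 0 z 0)
    (nullForm z 0 0) (nullForm 0 z 0)

/-- The fourth part leaves the family `waveZ`: the term `ϑ_0 ∧ Φ_0` puts a component along `ϑ^{01}`
into the frame indices 00. Through it the variation of `R_{11}` along `ϑ^{01}` enters the field
equations. -/
theorem cz4_waveZ : cz4 (waveZ x y c q r s t) = waveTr ((q + t) / 4) := by
  funext a b i j
  revert a b i j
  simp only [forall_four, cz4, symm, Pi.smul_apply, Pi.add_apply,
    wedge11, cofL, metric_apply, zPhi_waveZ, smul_eq_mul, Fin.reduceEq, and_self, and_false,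
    false_and, reduceIte]
  simp only [waveTr, waveTensor_apply, nullForm_apply, Pi.zero_apply, Pi.smul_apply, wedge11,
    cof_eq, Matrix.cons_val]
  norm_num
  constructorm* _ ∧ _ <;> ring

theorem cz1_waveZ : cz1 (waveZ x y c q r s t) = waveZ x y c q r s t
    - waveZ 0 0 (-(r - s - c) / 2) 0 ((r - s - c) / 4) (-(r - s - c) / 4) 0
    - waveTr ((q + t) / 4) := by
  funext a b
  simp only [cz1, cz2_waveZ, cz3_waveZ, cz4_waveZ, cz5_waveZ, Pi.sub_apply,
    Pi.zero_apply, sub_zero]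

theorem antisym_waveR (n22 n23 n32 n33 m22 m23 m32 m33 : ℝ) :
    antisym (waveR x y c n22 n23 n32 n33 m22 m23 m32 m33) =
      waveW ((n22 - m22) / 2) ((n23 - m23) / 2) ((n32 - m32) / 2) ((n33 - m33) / 2) := by
  funext a b i j
  revert a b i j
  simp only [forall_four, antisym, Pi.smul_apply, Pi.sub_apply, waveR, waveW, waveTensor_apply,
    nullForm_apply, Pi.zero_apply, smul_eq_mul]
  norm_num
  constructorm* _ ∧ _ <;> ring

theorem symm_waveR (n22 n23 n32 n33 m22 m23 m32 m33 : ℝ) :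
    symm (waveR x y c n22 n23 n32 n33 m22 m23 m32 m33) =
      waveZ x y c ((n22 + m22) / 2) ((n23 + m23) / 2) ((n32 + m32) / 2) ((n33 + m33) / 2) := by
  funext a b i j
  revert a b i j
  simp only [forall_four, symm, Pi.smul_apply, Pi.add_apply, waveR, waveZ, waveTensor_apply,
    nullForm_apply, Pi.zero_apply, smul_eq_mul]
  norm_num
  constructorm* _ ∧ _ <;> ring

end Wave

/-! ### Polarized curvature Lagrangian at a plane wave -/

theorem inner2_add (α β γ : Form2) : inner2 α (β + γ) = inner2 α β + inner2 α γ := by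
  simp only [inner2, raise2_eq_raise1, raise1, Pi.add_apply, smul_eq_mul, mul_add,
    Finset.sum_add_distrib]

theorem inner2_smul (α β : Form2) (r : ℝ) : inner2 α (r • β) = r * inner2 α β := by
  have h : ∀ a b, raise2 (r • β) a b = r * raise2 β a b := fun a b => by
    simpa [raise2] using raise2_lin (0 : Form2) β r a b
  simp only [inner2, h, Finset.mul_sum]
  refine Finset.sum_congr rfl fun a _ => Finset.sum_congr rfl fun b _ => by ring

/-- The pairing `∑ R_{ab} ∧ ⋆ K^{ab}`. -/
def pair (R K : Fin 4 → Fin 4 → Form2) : ℝ := ∑ a, ∑ b, inner2 (R a b) (K a b)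

theorem pair_add (R K L : Fin 4 → Fin 4 → Form2) : pair R (K + L) = pair R K + pair R L := by
  simp only [pair, Pi.add_apply, inner2_add, Finset.sum_add_distrib]

theorem pair_smul (R K : Fin 4 → Fin 4 → Form2) (r : ℝ) : pair R (r • K) = r * pair R K := by
  simp only [pair, Pi.smul_apply, inner2_smul, Finset.mul_sum]

variable {R : Fin 4 → Fin 4 → Form2}

theorem pair_apply (hR : ∀ a b c d, R a b c d = -R a b d c) (K : Fin 4 → Fin 4 → Form2) :
    pair R K = ∑ a, ∑ b, (1 / 2) * (-(R a b 0 1 * (K a b 0 1 - K a b 1 0))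
      - R a b 0 2 * (K a b 1 2 - K a b 2 1)
      - R a b 0 3 * (K a b 1 3 - K a b 3 1) - R a b 1 2 * (K a b 0 2 - K a b 2 0)
      - R a b 1 3 * (K a b 0 3 - K a b 3 0) + R a b 2 3 * (K a b 2 3 - K a b 3 2)) := by
  simp only [pair, inner2_apply (hR _ _)]

/-- Raising the frame indices and the form indices turns each 0 of the wave into a 1, which selects
the components of `R` of weight -2 and -3. -/
theorem pair_raise2_waveZ (hR : ∀ a b c d, R a b c d = -R a b d c) (x y c q r s t : ℝ) :
    pair R (raise2 (waveZ x y c q r s t)) =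
      c * R 1 1 2 3 - x * R 1 1 1 2 - y * R 1 1 1 3 + q * (R 1 2 1 2 + R 2 1 1 2)
      + r * (R 1 2 1 3 + R 2 1 1 3) + s * (R 1 3 1 2 + R 3 1 1 2) + t * (R 1 3 1 3
        + R 3 1 1 3) := by
  rw [pair_apply hR]
  simp only [Fin.sum_univ_four, raise2_eq_raise1, raise1_zero, raise1_one, raise1_two, raise1_three,
    waveZ, waveTensor_apply, nullForm_apply, Pi.neg_apply, Pi.zero_apply]
  ring

theorem pair_raise2_waveW (hR : ∀ a b c d, R a b c d = -R a b d c) (q r s t : ℝ) :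
    pair R (raise2 (waveW q r s t)) = q * (R 1 2 1 2 - R 2 1 1 2)
      + r * (R 1 2 1 3 - R 2 1 1 3) + s * (R 1 3 1 2 - R 3 1 1 2) + t * (R 1 3 1 3
        - R 3 1 1 3) := by
  rw [pair_apply hR]
  simp only [Fin.sum_univ_four, raise2_eq_raise1, raise1_zero, raise1_one, raise1_two, raise1_three,
    waveW, waveTensor_apply, nullForm_apply, Pi.neg_apply, Pi.zero_apply]
  ring

theorem pair_raise2_waveTr (hR : ∀ a b c d, R a b c d = -R a b d c) (z : ℝ) :
    pair R (raise2 (waveTr z)) = z * (2 * R 1 1 0 1 + R 1 2 1 2 + R 2 1 1 2 + R 1 3 1 3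
      + R 3 1 1 3) := by
  rw [pair_apply hR]
  simp only [Fin.sum_univ_four, raise2_eq_raise1, raise1_zero, raise1_one, raise1_two, raise1_three,
    waveTr, waveTensor_apply, nullForm_apply, Pi.neg_apply, Pi.zero_apply, Pi.smul_apply, wedge11,
    cof_eq, Matrix.cons_val, smul_eq_mul]
  ring

theorem pair_traceIns_waveTr (hR : ∀ a b c d, R a b c d = -R a b d c) (z : ℝ) :
    pair R (traceIns (waveTr z)) = 4 * z * (R 1 1 0 1 + R 2 1 1 2 + R 3 1 1 3) := by
  have h : ∀ b d, (∑ c, int2 c (raise2 (waveTr z) c b)) d = if b = 1 ∧ d = 0 then 4 * z else 0 := by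
    simp only [forall_four, Fin.sum_univ_four, raise2_eq_raise1, raise1_zero, raise1_one,
      raise1_two, raise1_three, waveTr, waveTensor_apply, nullForm_apply, Pi.neg_apply,
      Pi.zero_apply, Pi.smul_apply, wedge11, cof_eq, Matrix.cons_val, smul_eq_mul, int2,
      Pi.add_apply, Fin.reduceEq, and_self, and_false, false_and, reduceIte]
    norm_num
    ring
  rw [pair_apply hR]
  simp only [traceIns, wedge11, h]
  simp only [Fin.sum_univ_four, cof_eq, Matrix.cons_val, Fin.reduceEq, and_self, and_false,
    false_and, reduceIte]
  ring

theorem pair_crossIns_waveZ (hR : ∀ a b c d, R a b c d = -R a b d c) (z : ℝ) :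
    pair R (crossIns (waveZ 0 0 (2 * z) 0 (-z) z 0)) =
      -2 * z * R 1 1 2 3 - z * R 1 2 1 3 + z * R 1 3 1 2 + 3 * z * R 2 1 1 3
        - 3 * z * R 3 1 1 2 := by
  rw [pair_apply hR]
  simp only [Fin.sum_univ_four, crossIns, wedge11, raise2_eq_raise1, raise1_zero, raise1_one,
    raise1_two, raise1_three, int2, Pi.add_apply, waveZ, waveTensor_apply, nullForm_apply,
    Pi.neg_apply, Pi.zero_apply, cofL, metric_apply]
  ring

theorem raise2_add' (K L : Fin 4 → Fin 4 → Form2) : raise2 (K + L) = raise2 K + raise2 L := by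
  funext a b; simpa using raise2_lin K L 1 a b

theorem raise2_smul' (K : Fin 4 → Fin 4 → Form2) (r : ℝ) : raise2 (r • K) = r • raise2 K := by
  funext a b; simpa [raise2] using raise2_lin 0 K r a b

theorem curvOp_eq (p : Params) (R : Fin 4 → Fin 4 → Form2) : curvOp p R =
    p.w1 • raise2 (cw1 (antisym R)) + p.w2 • raise2 (cw2 (antisym R))
    + p.w3 • raise2 (cw3 (antisym R)) + p.w4 • raise2 (cw4 (antisym R))
    + p.w5 • raise2 (cw5 (antisym R)) + p.w6 • raise2 (cw6 (antisym R))
    + p.v1 • traceIns (cw5 (antisym R))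
    + (p.z1 • raise2 (cz1 (symm R)) + p.z2 • raise2 (cz2 (symm R))
    + p.z3 • raise2 (cz3 (symm R)) + p.z4 • raise2 (cz4 (symm R)) + p.z5 • raise2 (cz5 (symm R)))
    + p.v2 • crossIns (cz2 (symm R)) + p.v3 • traceIns (cz3 (symm R))
    + p.v4 • traceIns (cz4 (symm R)) + p.v5 • traceIns (cz5 (symm R)) := by
  simp only [← raise2_smul', ← raise2_add']
  rfl

theorem raise2_zero' : raise2 (0 : Fin 4 → Fin 4 → Form2) = 0 := by
  funext a b; simp [raise2]

theorem traceIns_zero : traceIns 0 = 0 := by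
  funext a b c d; simp [traceIns, raise2_zero', int2, wedge11]

variable (x y c n22 n23 n32 n33 m22 m23 m32 m33 : ℝ)

/-- One half of the polarization. The wave has no third, fifth or sixth antisymmetric part and no
third or fifth symmetric part, which removes w3, w5, w6, z3, z5, v1, v3 and v5. -/
theorem pair_curvOp_waveR (p : Params) (hR : ∀ a b c d, R a b c d = -R a b d c) :
    pair R (curvOp p (waveR x y c n22 n23 n32 n33 m22 m23 m32 m33)) =
      R 1 1 0 1 * (((1/2) * p.v4 + (-1/4) * p.z1 + (1/4) * p.z4) * n22
        + ((1/2) * p.v4 + (-1/4) * p.z1 + (1/4) * p.z4) * m22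
        + ((1/2) * p.v4 + (-1/4) * p.z1 + (1/4) * p.z4) * n33
        + ((1/2) * p.v4 + (-1/4) * p.z1 + (1/4) * p.z4) * m33)
      + R 1 1 1 2 * ((-p.z1) * x)
      + R 1 1 1 3 * ((-p.z1) * y)
      + R 1 1 2 3 * (((-1/2) * p.v2 + (1/2) * p.z1 + (1/2) * p.z2) * c
        + ((1/4) * p.v2 + (1/4) * p.z1 + (-1/4) * p.z2) * m23
        + ((1/4) * p.v2 + (1/4) * p.z1 + (-1/4) * p.z2) * n23
        + ((-1/4) * p.v2 + (-1/4) * p.z1 + (1/4) * p.z2) * m32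
        + ((-1/4) * p.v2 + (-1/4) * p.z1 + (1/4) * p.z2) * n32)
      + R 1 2 1 2 * (((1/4) * p.w1 + (1/4) * p.w4 + (3/8) * p.z1 + (1/8) * p.z4) * n22
        + ((-1/4) * p.w1 + (-1/4) * p.w4 + (3/8) * p.z1 + (1/8) * p.z4) * m22
        + ((-1/4) * p.w1 + (1/4) * p.w4 + (-1/8) * p.z1 + (1/8) * p.z4) * n33
        + ((1/4) * p.w1 + (-1/4) * p.w4 + (-1/8) * p.z1 + (1/8) * p.z4) * m33)
      + R 1 2 1 3 * (((1/8) * p.v2 + (1/4) * p.w1 + (1/4) * p.w2 + (3/8) * p.z1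
        + (1/8) * p.z2) * n23
        + ((1/8) * p.v2 + (-1/4) * p.w1 + (-1/4) * p.w2 + (3/8) * p.z1 + (1/8) * p.z2) * m23
        + ((-1/8) * p.v2 + (-1/4) * p.w1 + (1/4) * p.w2 + (1/8) * p.z1 + (-1/8) * p.z2) * m32
        + ((-1/8) * p.v2 + (1/4) * p.w1 + (-1/4) * p.w2 + (1/8) * p.z1 + (-1/8) * p.z2) * n32
        + ((-1/4) * p.v2 + (1/4) * p.z1 + (-1/4) * p.z2) * c)
      + R 1 3 1 2 * (((1/8) * p.v2 + (1/4) * p.w1 + (1/4) * p.w2 + (3/8) * p.z1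
        + (1/8) * p.z2) * n32
        + ((1/8) * p.v2 + (-1/4) * p.w1 + (-1/4) * p.w2 + (3/8) * p.z1 + (1/8) * p.z2) * m32
        + ((-1/8) * p.v2 + (-1/4) * p.w1 + (1/4) * p.w2 + (1/8) * p.z1 + (-1/8) * p.z2) * m23
        + ((-1/8) * p.v2 + (1/4) * p.w1 + (-1/4) * p.w2 + (1/8) * p.z1 + (-1/8) * p.z2) * n23
        + ((1/4) * p.v2 + (-1/4) * p.z1 + (1/4) * p.z2) * c)
      + R 1 3 1 3 * (((1/4) * p.w1 + (1/4) * p.w4 + (3/8) * p.z1 + (1/8) * p.z4) * n33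
        + ((-1/4) * p.w1 + (-1/4) * p.w4 + (3/8) * p.z1 + (1/8) * p.z4) * m33
        + ((-1/4) * p.w1 + (1/4) * p.w4 + (-1/8) * p.z1 + (1/8) * p.z4) * n22
        + ((1/4) * p.w1 + (-1/4) * p.w4 + (-1/8) * p.z1 + (1/8) * p.z4) * m22)
      + R 2 1 1 2 * (((1/2) * p.v4 + (1/4) * p.w1 + (1/4) * p.w4 + (3/8) * p.z1
        + (1/8) * p.z4) * m22
        + ((1/2) * p.v4 + (-1/4) * p.w1 + (-1/4) * p.w4 + (3/8) * p.z1 + (1/8) * p.z4) * n22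
        + ((1/2) * p.v4 + (1/4) * p.w1 + (-1/4) * p.w4 + (-1/8) * p.z1 + (1/8) * p.z4) * n33
        + ((1/2) * p.v4 + (-1/4) * p.w1 + (1/4) * p.w4 + (-1/8) * p.z1 + (1/8) * p.z4) * m33)
      + R 2 1 1 3 * (((-3/8) * p.v2 + (1/4) * p.w1 + (1/4) * p.w2 + (3/8) * p.z1
        + (1/8) * p.z2) * m23
        + ((-3/8) * p.v2 + (-1/4) * p.w1 + (-1/4) * p.w2 + (3/8) * p.z1 + (1/8) * p.z2) * n23
        + ((3/8) * p.v2 + (1/4) * p.w1 + (-1/4) * p.w2 + (1/8) * p.z1 + (-1/8) * p.z2) * m32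
        + ((3/8) * p.v2 + (-1/4) * p.w1 + (1/4) * p.w2 + (1/8) * p.z1 + (-1/8) * p.z2) * n32
        + ((3/4) * p.v2 + (1/4) * p.z1 + (-1/4) * p.z2) * c)
      + R 3 1 1 2 * (((-3/8) * p.v2 + (1/4) * p.w1 + (1/4) * p.w2 + (3/8) * p.z1
        + (1/8) * p.z2) * m32
        + ((-3/8) * p.v2 + (-1/4) * p.w1 + (-1/4) * p.w2 + (3/8) * p.z1 + (1/8) * p.z2) * n32
        + ((3/8) * p.v2 + (1/4) * p.w1 + (-1/4) * p.w2 + (1/8) * p.z1 + (-1/8) * p.z2) * m23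
        + ((3/8) * p.v2 + (-1/4) * p.w1 + (1/4) * p.w2 + (1/8) * p.z1 + (-1/8) * p.z2) * n23
        + ((-3/4) * p.v2 + (-1/4) * p.z1 + (1/4) * p.z2) * c)
      + R 3 1 1 3 * (((1/2) * p.v4 + (1/4) * p.w1 + (1/4) * p.w4 + (3/8) * p.z1
        + (1/8) * p.z4) * m33
        + ((1/2) * p.v4 + (-1/4) * p.w1 + (-1/4) * p.w4 + (3/8) * p.z1 + (1/8) * p.z4) * n33
        + ((1/2) * p.v4 + (1/4) * p.w1 + (-1/4) * p.w4 + (-1/8) * p.z1 + (1/8) * p.z4) * n22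
        + ((1/2) * p.v4 + (-1/4) * p.w1 + (1/4) * p.w4 + (-1/8) * p.z1 + (1/8) * p.z4) * m22) := by
  -- The second part in the one-parameter form `2z, -z, z` that `pair_crossIns_waveZ` accepts.
  have e1 : cz2 (waveZ x y c ((n22 + m22) / 2) ((n23 + m23) / 2) ((n32 + m32) / 2)
      ((n33 + m33) / 2)) = waveZ 0 0 (2 * (-((n23 + m23) / 2 - (n32 + m32) / 2 - c) / 4)) 0
        (-(-((n23 + m23) / 2 - (n32 + m32) / 2 - c) / 4))
        (-((n23 + m23) / 2 - (n32 + m32) / 2 - c) / 4) 0 := by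
    rw [cz2_waveZ]; congr 1 <;> ring
  -- Differences are written as sums with coefficient -1, so that additivity and homogeneity of
  -- `pair` apply.
  have e2 : cz1 (waveZ x y c ((n22 + m22) / 2) ((n23 + m23) / 2) ((n32 + m32) / 2)
      ((n33 + m33) / 2)) = waveZ x y c ((n22 + m22) / 2) ((n23 + m23) / 2) ((n32 + m32) / 2)
      ((n33 + m33) / 2) + (-1 : ℝ) • waveZ 0 0 (-((n23 + m23) / 2 - (n32 + m32) / 2 - c) / 2) 0
        (((n23 + m23) / 2 - (n32 + m32) / 2 - c) / 4)
        (-((n23 + m23) / 2 - (n32 + m32) / 2 - c) / 4) 0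
      + (-1 : ℝ) • waveTr (((n22 + m22) / 2 + (n33 + m33) / 2) / 4) := by
    rw [cz1_waveZ]; module
  rw [curvOp_eq, antisym_waveR, symm_waveR, cw1_waveW, cw2_waveW, cw3_waveW, cw4_waveW, cw5_waveW,
    cw6_waveW, e2, cz3_waveZ, cz4_waveZ, cz5_waveZ, e1]
  simp only [raise2_zero', traceIns_zero, smul_zero, add_zero, pair_add, pair_smul, raise2_add',
    raise2_smul', pair_raise2_waveW hR, pair_raise2_waveZ hR, pair_raise2_waveTr hR,
    pair_traceIns_waveTr hR, pair_crossIns_waveZ hR]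
  ring

/-! ### Symmetry of the irreducible parts in the frame indices -/

theorem antisym_swap (X : Fin 4 → Fin 4 → Form2) (a b : Fin 4) : antisym X a b = -antisym X b a := by
  simp only [antisym]
  module

theorem symm_swap (X : Fin 4 → Fin 4 → Form2) (a b : Fin 4) : symm X a b = symm X b a := by
  simp only [symm, add_comm]

theorem cw2_swap (W : Fin 4 → Fin 4 → Form2) (a b : Fin 4) : cw2 W a b = -cw2 W b a := by
  rw [cw2, cw2, antisym_swap, star2_neg]

theorem cw3_swap (W : Fin 4 → Fin 4 → Form2) (a b : Fin 4) : cw3 W a b = -cw3 W b a := by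
  have h : wXbs W • wedge11 (cofL a) (cofL b) = -(wXbs W • wedge11 (cofL b) (cofL a)) := by
    funext c d
    simp only [wedge11, Pi.smul_apply, Pi.neg_apply, smul_eq_mul]
    ring
  rw [cw3, cw3, h, star2_neg, smul_neg]

theorem cw4_swap (W : Fin 4 → Fin 4 → Form2) (a b : Fin 4) : cw4 W a b = -cw4 W b a := by
  rw [cw4, cw4, antisym_swap]

theorem cw5_swap (W : Fin 4 → Fin 4 → Form2) (a b : Fin 4) : cw5 W a b = -cw5 W b a := by
  simp only [cw5, antisym]
  module

theorem cw6_swap (W : Fin 4 → Fin 4 → Form2) (a b : Fin 4) : cw6 W a b = -cw6 W b a := by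
  funext c d
  simp only [cw6, wedge11, Pi.smul_apply, Pi.neg_apply, smul_eq_mul]
  ring

theorem eq_zero_of_swap {X : Fin 4 → Fin 4 → Form2} (h : ∀ a b, X a b = -X b a) (a : Fin 4) :
    X a a = 0 := by
  have h2 := h a a
  funext c d
  have h3 := congrFun (congrFun h2 c) d
  simp only [Pi.neg_apply, Pi.zero_apply] at h3 ⊢
  linarith

theorem cz3_symm (Z : Fin 4 → Fin 4 → Form2) (a b : Fin 4) : cz3 Z a b = cz3 Z b a := by
  have h : metric a b = metric b a := by revert a b; simp [forall_four, metric_apply]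
  simp only [cz3, symm, add_comm, h]

theorem cz5_symm (Z : Fin 4 → Fin 4 → Form2) (a b : Fin 4) : cz5 Z a b = cz5 Z b a := by
  have h : metric a b = metric b a := by revert a b; simp [forall_four, metric_apply]
  simp only [cz5, h]

-- The other half of the polarization. It needs its own computation because the terms with v2 and v4
-- are not symmetric under exchange of the two arguments. The wave now selects components of `curvOp
-- p R`, which the lemmas on lowest components express through those of `R`.
set_option maxRecDepth 8000 in
theorem pair_waveR_curvOp (p : Params) (hR : ∀ a b c d, R a b c d = -R a b d c) :
    pair (waveR x y c n22 n23 n32 n33 m22 m23 m32 m33) (curvOp p R) =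
      R 1 1 1 2 * ((-p.z1) * x)
      + R 1 1 1 3 * ((-p.z1) * y)
      + R 1 1 2 3 * (((-1/2) * p.v2 + (1/2) * p.z1 + (1/2) * p.z2) * c
        + ((-1/4) * p.v2 + (1/4) * p.z1 + (-1/4) * p.z2) * n23
        + ((1/4) * p.v2 + (-1/4) * p.z1 + (1/4) * p.z2) * n32
        + ((3/4) * p.v2 + (1/4) * p.z1 + (-1/4) * p.z2) * m23
        + ((-3/4) * p.v2 + (-1/4) * p.z1 + (1/4) * p.z2) * m32)
      + R 2 1 1 3 * (((1/4) * p.v2 + (1/4) * p.z1 + (-1/4) * p.z2) * c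
        + ((1/8) * p.v2 + (-1/4) * p.w1 + (-1/4) * p.w2 + (3/8) * p.z1 + (1/8) * p.z2) * n23
        + ((-1/8) * p.v2 + (-1/4) * p.w1 + (1/4) * p.w2 + (1/8) * p.z1 + (-1/8) * p.z2) * n32
        + ((-3/8) * p.v2 + (1/4) * p.w1 + (1/4) * p.w2 + (3/8) * p.z1 + (1/8) * p.z2) * m23
        + ((3/8) * p.v2 + (1/4) * p.w1 + (-1/4) * p.w2 + (1/8) * p.z1 + (-1/8) * p.z2) * m32)
      + R 1 2 1 3 * (((1/4) * p.v2 + (1/4) * p.z1 + (-1/4) * p.z2) * c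
        + ((1/8) * p.v2 + (1/4) * p.w1 + (1/4) * p.w2 + (3/8) * p.z1 + (1/8) * p.z2) * n23
        + ((-1/8) * p.v2 + (1/4) * p.w1 + (-1/4) * p.w2 + (1/8) * p.z1 + (-1/8) * p.z2) * n32
        + ((-3/8) * p.v2 + (-1/4) * p.w1 + (-1/4) * p.w2 + (3/8) * p.z1 + (1/8) * p.z2) * m23
        + ((3/8) * p.v2 + (-1/4) * p.w1 + (1/4) * p.w2 + (1/8) * p.z1 + (-1/8) * p.z2) * m32)
      + R 3 1 1 2 * (((-1/4) * p.v2 + (-1/4) * p.z1 + (1/4) * p.z2) * c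
        + ((-1/8) * p.v2 + (-1/4) * p.w1 + (1/4) * p.w2 + (1/8) * p.z1 + (-1/8) * p.z2) * n23
        + ((1/8) * p.v2 + (-1/4) * p.w1 + (-1/4) * p.w2 + (3/8) * p.z1 + (1/8) * p.z2) * n32
        + ((3/8) * p.v2 + (1/4) * p.w1 + (-1/4) * p.w2 + (1/8) * p.z1 + (-1/8) * p.z2) * m23
        + ((-3/8) * p.v2 + (1/4) * p.w1 + (1/4) * p.w2 + (3/8) * p.z1 + (1/8) * p.z2) * m32)
      + R 1 3 1 2 * (((-1/4) * p.v2 + (-1/4) * p.z1 + (1/4) * p.z2) * c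
        + ((-1/8) * p.v2 + (1/4) * p.w1 + (-1/4) * p.w2 + (1/8) * p.z1 + (-1/8) * p.z2) * n23
        + ((1/8) * p.v2 + (1/4) * p.w1 + (1/4) * p.w2 + (3/8) * p.z1 + (1/8) * p.z2) * n32
        + ((3/8) * p.v2 + (-1/4) * p.w1 + (1/4) * p.w2 + (1/8) * p.z1 + (-1/8) * p.z2) * m23
        + ((-3/8) * p.v2 + (-1/4) * p.w1 + (-1/4) * p.w2 + (3/8) * p.z1 + (1/8) * p.z2) * m32)
      + R 1 2 1 2 * (((1/4) * p.w1 + (1/4) * p.w4 + (3/8) * p.z1 + (1/8) * p.z4) * n22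
        + ((-1/4) * p.w1 + (1/4) * p.w4 + (-1/8) * p.z1 + (1/8) * p.z4) * n33
        + ((1/2) * p.v4 + (-1/4) * p.w1 + (-1/4) * p.w4 + (3/8) * p.z1 + (1/8) * p.z4) * m22
        + ((1/2) * p.v4 + (1/4) * p.w1 + (-1/4) * p.w4 + (-1/8) * p.z1 + (1/8) * p.z4) * m33)
      + R 2 1 1 2 * (((-1/4) * p.w1 + (-1/4) * p.w4 + (3/8) * p.z1 + (1/8) * p.z4) * n22
        + ((1/4) * p.w1 + (-1/4) * p.w4 + (-1/8) * p.z1 + (1/8) * p.z4) * n33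
        + ((1/2) * p.v4 + (1/4) * p.w1 + (1/4) * p.w4 + (3/8) * p.z1 + (1/8) * p.z4) * m22
        + ((1/2) * p.v4 + (-1/4) * p.w1 + (1/4) * p.w4 + (-1/8) * p.z1 + (1/8) * p.z4) * m33)
      + R 1 3 1 3 * (((-1/4) * p.w1 + (1/4) * p.w4 + (-1/8) * p.z1 + (1/8) * p.z4) * n22
        + ((1/4) * p.w1 + (1/4) * p.w4 + (3/8) * p.z1 + (1/8) * p.z4) * n33
        + ((1/2) * p.v4 + (1/4) * p.w1 + (-1/4) * p.w4 + (-1/8) * p.z1 + (1/8) * p.z4) * m22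
        + ((1/2) * p.v4 + (-1/4) * p.w1 + (-1/4) * p.w4 + (3/8) * p.z1 + (1/8) * p.z4) * m33)
      + R 3 1 1 3 * (((1/4) * p.w1 + (-1/4) * p.w4 + (-1/8) * p.z1 + (1/8) * p.z4) * n22
        + ((-1/4) * p.w1 + (-1/4) * p.w4 + (3/8) * p.z1 + (1/8) * p.z4) * n33
        + ((1/2) * p.v4 + (-1/4) * p.w1 + (1/4) * p.w4 + (-1/8) * p.z1 + (1/8) * p.z4) * m22
        + ((1/2) * p.v4 + (1/4) * p.w1 + (1/4) * p.w4 + (3/8) * p.z1 + (1/8) * p.z4) * m33)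
      + R 1 1 0 1 * (((-1/4) * p.z1 + (1/4) * p.z4) * n22
        + ((-1/4) * p.z1 + (1/4) * p.z4) * n33
        + (p.v4 + (-1/4) * p.z1 + (1/4) * p.z4) * m22
        + (p.v4 + (-1/4) * p.z1 + (1/4) * p.z4) * m33) := by
  have hW := antisym_alt hR
  have hW' := antisym_swap R
  have hZ := symm_alt hR
  have hZ' := symm_swap R
  have hK := curvOp_alt p hR
  -- Only the frame indices 00, 0A and A0 of `curvOp p R` meet the wave; these are upper indices,
  -- hence lower indices 11, 1A and A1.
  have h : pair (waveR x y c n22 n23 n32 n33 m22 m23 m32 m33) (curvOp p R) =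
      c * curvOp p R 0 0 2 3 - x * curvOp p R 0 0 1 2 - y * curvOp p R 0 0 1 3
      - n22 * curvOp p R 0 2 1 2 - n23 * curvOp p R 0 2 1 3
      - n32 * curvOp p R 0 3 1 2 - n33 * curvOp p R 0 3 1 3
      - m22 * curvOp p R 2 0 1 2 - m23 * curvOp p R 2 0 1 3
      - m32 * curvOp p R 3 0 1 2 - m33 * curvOp p R 3 0 1 3 := by
    rw [pair_apply (by
      simp only [forall_four, waveR, waveTensor_apply, nullForm_apply, Pi.zero_apply]
      norm_num)]
    simp only [Fin.sum_univ_four, waveR, waveTensor_apply, nullForm_apply, Pi.zero_apply]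
    rw [hK 0 0 2 1, hK 0 0 3 1, hK 0 0 3 2, hK 0 2 2 1, hK 0 2 3 1, hK 0 3 2 1, hK 0 3 3 1,
      hK 2 0 2 1, hK 2 0 3 1, hK 3 0 2 1, hK 3 0 3 1]
    ring
  have c1 := cw2_lowest hW hW'
  have c2 := cw3_lowest (antisym R)
  have c3 := cw4_lowest hW hW'
  have c4 := cw5_lowest (antisym R)
  have c5 := cw6_lowest (antisym R)
  have d1 := cz2_lowest hZ hZ'
  have d2 := cz3_lowest (symm R)
  have d3 := cz4_lowest hZ
  have d4 := cz5_lowest (symm R)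
  -- The contraction inside `traceIns` is needed only in its component 11. For the fifth
  -- antisymmetric and the third symmetric part it reduces to a 2-form evaluated twice on `e_1`, and
  -- for the fifth symmetric part to the diagonal of a trace 2-form.
  have t1 : -(cw5 (antisym R) 1 1 0 1 + cw5 (antisym R) 0 1 1 1 - cw5 (antisym R) 2 1 2 1
      - cw5 (antisym R) 3 1 3 1) = 0 := by
    have e : wXa (antisym R) 1 1 = 0 := by
      simp only [wXa, wedge11, Fin.sum_univ_four, Pi.add_apply]; ring
    simp only [cw5, antisym, Pi.smul_apply, Pi.sub_apply, wedge11, cofL, metric_apply, smul_eq_mul,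
      int2, e]
    ring
  have t2 : -(cz3 (symm R) 1 1 0 1 + cz3 (symm R) 0 1 1 1 - cz3 (symm R) 2 1 2 1
      - cz3 (symm R) 3 1 3 1) = 0 := by
    have e : zYa (symm R) 1 1 = 0 := by
      simp only [zYa, wedge11, Fin.sum_univ_four, Pi.add_apply]; ring
    simp only [cz3, symm, Pi.smul_apply, Pi.sub_apply, Pi.add_apply, wedge11, cofL, metric_apply,
      smul_eq_mul, int2, e]
    ring
  have t3 : -(cz5 (symm R) 1 1 0 1 + cz5 (symm R) 0 1 1 1 - cz5 (symm R) 2 1 2 1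
      - cz5 (symm R) 3 1 3 1) = 0 := by
    simp only [cz5, Pi.smul_apply, metric_apply, smul_eq_mul, trace_apply, Pi.add_apply,
      Pi.sub_apply, alt_self hZ]
    ring
  have y1 := eq_zero_of_swap hW' 1
  have y2 := eq_zero_of_swap (cw2_swap (antisym R)) 1
  have y3 := eq_zero_of_swap (cw3_swap (antisym R)) 1
  have y4 := eq_zero_of_swap (cw4_swap (antisym R)) 1
  have y5 := eq_zero_of_swap (cw5_swap (antisym R)) 1
  have y6 := eq_zero_of_swap (cw6_swap (antisym R)) 1
  have s2 := cz2_symm (symm R)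
  have s4 := cz4_symm (symm R)
  have l2 := cz2_alt (symm R)
  have l4 := cz4_alt (symm R)
  have r2 : cz2 (symm R) 1 2 2 1 = 0 ∧ cz2 (symm R) 1 2 3 1 = -cz2 (symm R) 1 2 1 3 ∧
      cz2 (symm R) 1 3 2 1 = -cz2 (symm R) 1 3 1 2 ∧ cz2 (symm R) 1 3 3 1 = 0 ∧
      cz2 (symm R) 1 1 3 2 = -cz2 (symm R) 1 1 2 3 := by
    rw [l2 1 2 2 1, l2 1 2 3 1, l2 1 3 2 1, l2 1 3 3 1, l2 1 1 3 2]
    simp only [d1, neg_zero, and_self]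
  -- For the fourth part the same contraction does not vanish and reproduces `Φ_{11}`; this is the
  -- source of the v4 terms.
  have t4 : -(cz4 (symm R) 1 1 0 1 + cz4 (symm R) 0 1 1 1 - cz4 (symm R) 2 1 2 1
      - cz4 (symm R) 3 1 3 1) = -(symm R 1 1 0 1 + symm R 1 2 1 2 + symm R 1 3 1 3) := by
    rw [alt_self l4, s4 2 1, s4 3 1, l4 1 2 2 1, l4 1 3 3 1]
    simp only [d3]
    ring
  have f1 := traceIns_apply (cw5 (antisym R))
  have f2 := traceIns_apply (cz3 (symm R))
  have f3 := traceIns_apply (cz5 (symm R))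
  have f4 := traceIns_apply (cz4 (symm R))
  rw [t1] at f1
  rw [t2] at f2
  rw [t3] at f3
  rw [t4] at f4
  rw [h]
  simp only [curvOp_eq, Pi.add_apply, Pi.smul_apply, smul_eq_mul, raise2_eq_raise1, raise1_zero,
    raise1_two, raise1_three, Pi.neg_apply, cw1, cz1, Pi.sub_apply, f1, f2, f3, f4,
    crossIns_apply, y1, y2, y3, y4, y5, y6, Pi.zero_apply, s2 2 1, s2 3 1,
    cw2_swap _ 2 1, cw3_swap _ 2 1, cw4_swap _ 2 1, cw5_swap _ 2 1, cw6_swap _ 2 1, cz3_symm _ 2 1,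
    cz5_symm _ 2 1, s4 2 1, cw2_swap _ 3 1, cw3_swap _ 3 1, cw4_swap _ 3 1, cw5_swap _ 3 1,
    cw6_swap _ 3 1, cz3_symm _ 3 1, cz5_symm _ 3 1, s4 3 1, alt_self l2, c1, c2, c3, c4, c5, d1, d2,
    d3, d4, r2, Pi.zero_apply]
  simp only [antisym, symm, Pi.smul_apply, Pi.sub_apply, Pi.add_apply, smul_eq_mul]
  ring

theorem curvPolar_waveR (p : Params) (hR : ∀ a b c d, R a b c d = -R a b d c) :
    curvPolar p (waveR x y c n22 n23 n32 n33 m22 m23 m32 m33) R =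
      R 1 1 1 2 * (((-2/1) * p.z1) * x)
      + R 1 1 1 3 * (((-2/1) * p.z1) * y)
      + R 1 1 2 3 * ((-p.v2 + p.z1 + p.z2) * c
        + ((1/2) * p.z1 + (-1/2) * p.z2) * n23
        + ((-1/2) * p.z1 + (1/2) * p.z2) * n32
        + (p.v2 + (1/2) * p.z1 + (-1/2) * p.z2) * m23
        + (-p.v2 + (-1/2) * p.z1 + (1/2) * p.z2) * m32)
      + R 2 1 1 3 * ((p.v2 + (1/2) * p.z1 + (-1/2) * p.z2) * c
        + ((-1/4) * p.v2 + (-1/2) * p.w1 + (-1/2) * p.w2 + (3/4) * p.z1 + (1/4) * p.z2) * n23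
        + ((1/4) * p.v2 + (-1/2) * p.w1 + (1/2) * p.w2 + (1/4) * p.z1 + (-1/4) * p.z2) * n32
        + ((-3/4) * p.v2 + (1/2) * p.w1 + (1/2) * p.w2 + (3/4) * p.z1 + (1/4) * p.z2) * m23
        + ((3/4) * p.v2 + (1/2) * p.w1 + (-1/2) * p.w2 + (1/4) * p.z1 + (-1/4) * p.z2) * m32)
      + R 1 2 1 3 * (((1/2) * p.z1 + (-1/2) * p.z2) * c
        + ((1/4) * p.v2 + (1/2) * p.w1 + (1/2) * p.w2 + (3/4) * p.z1 + (1/4) * p.z2) * n23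
        + ((-1/4) * p.v2 + (1/2) * p.w1 + (-1/2) * p.w2 + (1/4) * p.z1 + (-1/4) * p.z2) * n32
        + ((-1/4) * p.v2 + (-1/2) * p.w1 + (-1/2) * p.w2 + (3/4) * p.z1 + (1/4) * p.z2) * m23
        + ((1/4) * p.v2 + (-1/2) * p.w1 + (1/2) * p.w2 + (1/4) * p.z1 + (-1/4) * p.z2) * m32)
      + R 3 1 1 2 * ((-p.v2 + (-1/2) * p.z1 + (1/2) * p.z2) * c
        + ((1/4) * p.v2 + (-1/2) * p.w1 + (1/2) * p.w2 + (1/4) * p.z1 + (-1/4) * p.z2) * n23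
        + ((-1/4) * p.v2 + (-1/2) * p.w1 + (-1/2) * p.w2 + (3/4) * p.z1 + (1/4) * p.z2) * n32
        + ((3/4) * p.v2 + (1/2) * p.w1 + (-1/2) * p.w2 + (1/4) * p.z1 + (-1/4) * p.z2) * m23
        + ((-3/4) * p.v2 + (1/2) * p.w1 + (1/2) * p.w2 + (3/4) * p.z1 + (1/4) * p.z2) * m32)
      + R 1 3 1 2 * (((-1/2) * p.z1 + (1/2) * p.z2) * c
        + ((-1/4) * p.v2 + (1/2) * p.w1 + (-1/2) * p.w2 + (1/4) * p.z1 + (-1/4) * p.z2) * n23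
        + ((1/4) * p.v2 + (1/2) * p.w1 + (1/2) * p.w2 + (3/4) * p.z1 + (1/4) * p.z2) * n32
        + ((1/4) * p.v2 + (-1/2) * p.w1 + (1/2) * p.w2 + (1/4) * p.z1 + (-1/4) * p.z2) * m23
        + ((-1/4) * p.v2 + (-1/2) * p.w1 + (-1/2) * p.w2 + (3/4) * p.z1 + (1/4) * p.z2) * m32)
      + R 1 2 1 2 * (((1/2) * p.w1 + (1/2) * p.w4 + (3/4) * p.z1 + (1/4) * p.z4) * n22
        + ((-1/2) * p.w1 + (1/2) * p.w4 + (-1/4) * p.z1 + (1/4) * p.z4) * n33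
        + ((1/2) * p.v4 + (-1/2) * p.w1 + (-1/2) * p.w4 + (3/4) * p.z1 + (1/4) * p.z4) * m22
        + ((1/2) * p.v4 + (1/2) * p.w1 + (-1/2) * p.w4 + (-1/4) * p.z1 + (1/4) * p.z4) * m33)
      + R 2 1 1 2 * (((1/2) * p.v4 + (-1/2) * p.w1 + (-1/2) * p.w4 + (3/4) * p.z1
        + (1/4) * p.z4) * n22
        + ((1/2) * p.v4 + (1/2) * p.w1 + (-1/2) * p.w4 + (-1/4) * p.z1 + (1/4) * p.z4) * n33
        + (p.v4 + (1/2) * p.w1 + (1/2) * p.w4 + (3/4) * p.z1 + (1/4) * p.z4) * m22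
        + (p.v4 + (-1/2) * p.w1 + (1/2) * p.w4 + (-1/4) * p.z1 + (1/4) * p.z4) * m33)
      + R 1 3 1 3 * (((-1/2) * p.w1 + (1/2) * p.w4 + (-1/4) * p.z1 + (1/4) * p.z4) * n22
        + ((1/2) * p.w1 + (1/2) * p.w4 + (3/4) * p.z1 + (1/4) * p.z4) * n33
        + ((1/2) * p.v4 + (1/2) * p.w1 + (-1/2) * p.w4 + (-1/4) * p.z1 + (1/4) * p.z4) * m22
        + ((1/2) * p.v4 + (-1/2) * p.w1 + (-1/2) * p.w4 + (3/4) * p.z1 + (1/4) * p.z4) * m33)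
      + R 3 1 1 3 * (((1/2) * p.v4 + (1/2) * p.w1 + (-1/2) * p.w4 + (-1/4) * p.z1
        + (1/4) * p.z4) * n22
        + ((1/2) * p.v4 + (-1/2) * p.w1 + (-1/2) * p.w4 + (3/4) * p.z1 + (1/4) * p.z4) * n33
        + (p.v4 + (-1/2) * p.w1 + (1/2) * p.w4 + (-1/4) * p.z1 + (1/4) * p.z4) * m22
        + (p.v4 + (1/2) * p.w1 + (1/2) * p.w4 + (3/4) * p.z1 + (1/4) * p.z4) * m33)
      + R 1 1 0 1 * (((1/2) * p.v4 + (-1/2) * p.z1 + (1/2) * p.z4) * n22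
        + ((1/2) * p.v4 + (-1/2) * p.z1 + (1/2) * p.z4) * n33
        + ((3/2) * p.v4 + (-1/2) * p.z1 + (1/2) * p.z4) * m22
        + ((3/2) * p.v4 + (-1/2) * p.z1 + (1/2) * p.z4) * m33) := by
  have h : curvPolar p (waveR x y c n22 n23 n32 n33 m22 m23 m32 m33) R =
      pair R (curvOp p (waveR x y c n22 n23 n32 n33 m22 m23 m32 m33))
      + pair (waveR x y c n22 n23 n32 n33 m22 m23 m32 m33) (curvOp p R) := by
    simp only [curvPolar, pair, Finset.sum_add_distrib]
  rw [h, pair_curvOp_waveR _ _ _ _ _ _ _ _ _ _ _ p hR, pair_waveR_curvOp _ _ _ _ _ _ _ _ _ _ _ p hR]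
  ring

/-! ### Contractions with the torsion and nonmetricity of the wave -/

/-- The vector part `ϑ^0 ∧ T` has no component along `ϑ^{1A}`, and the axial part would be a 3-form
evaluated twice on `e_1`. Only the first part remains, with coefficient a1. -/
theorem torOp_lowest (p : Params) {T : Fin 4 → Form2} (hT : ∀ a b c, T a b c = -T a c b) :
    torOp p T 1 1 2 = p.a1 * T 0 1 2 ∧ torOp p T 1 1 3 = p.a1 * T 0 1 3 ∧
    torOp p T 1 2 1 = p.a1 * T 0 2 1 ∧ torOp p T 1 3 1 = p.a1 * T 0 3 1 := by
  simp only [torOp, raise1_one, raise1_zero, tor1, tor2, tor3, Pi.smul_apply, Pi.add_apply,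
    Pi.sub_apply, wedge11, cof_eq, int3, torAxial, Fin.sum_univ_four, wedge21, smul_eq_mul,
    cofL_eq, hT 0 2 1, hT 0 3 1, show T 2 1 1 = 0 by linarith [hT 2 1 1],
      show T 3 1 1 = 0 by linarith [hT 3 1 1]]
  simp

/-- A torsion with the only component `T^1 = ϑ^0 ∧ (x ϑ^2 + y ϑ^3)`. -/
def waveTor (x y : ℝ) : Fin 4 → Form2 := ![0, nullForm x y 0, 0, 0]

/-- A nonmetricity with `Q_{00} = x ϑ^2 + y ϑ^3` and `Q_{02} = r ϑ^0`, `Q_{03} = s ϑ^0`. -/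
def waveNm (x y r s : ℝ) : Fin 4 → Fin 4 → Form1 :=
  waveTensor ![0, 0, x, y] ![r, 0, 0, 0] ![s, 0, 0, 0] ![r, 0, 0, 0] ![s, 0, 0, 0]

theorem waveTor_apply (x y : ℝ) : waveTor x y 0 = 0 ∧ waveTor x y 1 = nullForm x y 0 ∧
    waveTor x y 2 = 0 ∧ waveTor x y 3 = 0 := ⟨rfl, rfl, rfl, rfl⟩

theorem waveNm_apply (x y r s : ℝ) :
    waveNm x y r s 0 0 = ![0, 0, x, y] ∧ waveNm x y r s 0 1 = 0 ∧
    waveNm x y r s 0 2 = ![r, 0, 0, 0] ∧ waveNm x y r s 0 3 = ![s, 0, 0, 0] ∧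
    waveNm x y r s 1 0 = 0 ∧ waveNm x y r s 1 1 = 0 ∧ waveNm x y r s 1 2 = 0 ∧
    waveNm x y r s 1 3 = 0 ∧
    waveNm x y r s 2 0 = ![r, 0, 0, 0] ∧ waveNm x y r s 2 1 = 0 ∧ waveNm x y r s 2 2 = 0 ∧
    waveNm x y r s 2 3 = 0 ∧
    waveNm x y r s 3 0 = ![s, 0, 0, 0] ∧ waveNm x y r s 3 1 = 0 ∧ waveNm x y r s 3 2 = 0 ∧
    waveNm x y r s 3 3 = 0 :=
  waveTensor_apply _ _ _ _ _

theorem vec4_apply (a b c d : ℝ) : (![a, b, c, d] : Form1) 0 = a ∧ (![a, b, c, d] : Form1) 1 = b ∧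
    (![a, b, c, d] : Form1) 2 = c ∧ (![a, b, c, d] : Form1) 3 = d := ⟨rfl, rfl, rfl, rfl⟩

variable (x y r s : ℝ)

theorem weylForm_waveNm : weylForm (waveNm x y r s) = 0 := by
  simp only [weylForm, trace_apply, waveNm_apply]
  simp

theorem nmTf_waveNm : nmTf (waveNm x y r s) = waveNm x y r s := by
  funext a b
  simp only [nmTf, weylForm_waveNm, smul_zero, sub_zero]

/-- Contracting a wave nonmetricity pairs an index 0 either with another 0 or with a transversal
index, and the metric gives zero in both cases. Hence the third and fourth parts vanish and b3 and
b4 drop out. -/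
theorem lamForm_waveNm : lamForm (waveNm x y r s) = 0 := by
  have h : ∀ a, (∑ b, ∑ c, metric b c * int1 c (nmTf (waveNm x y r s) a b)) = 0 := by
    simp only [forall_four, nmTf_waveNm, Fin.sum_univ_four, int1, metric_apply, waveNm_apply,
      Pi.zero_apply, vec4_apply]
    norm_num
  simp only [lamForm, h, zero_smul, Finset.sum_const_zero]

theorem nm4_waveNm : nm4 (waveNm x y r s) = 0 := by
  funext a b
  simp only [nm4, weylForm_waveNm, smul_zero, Pi.zero_apply]

theorem nm3_waveNm : nm3 (waveNm x y r s) = 0 := by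
  funext a b
  simp only [nm3, lamForm_waveNm, smul_zero, Pi.zero_apply, int1, zero_smul, symm, add_zero,
    sub_zero]

theorem lamBar_waveNm : lamBar (waveNm x y r s) 0 = nullForm (s - y) (x - r) 0 ∧
    lamBar (waveNm x y r s) 1 = 0 ∧ lamBar (waveNm x y r s) 2 = 0 ∧
    lamBar (waveNm x y r s) 3 = 0 := by
  refine ⟨?_, ?_, ?_, ?_⟩
  all_goals
    funext c d
    revert c d
    simp only [forall_four, lamBar, nmTf_waveNm, lamForm_waveNm]
    simp only [star2_apply, Pi.sub_apply, Pi.add_apply, Pi.smul_apply, Fin.sum_univ_four, wedge11,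
      waveNm_apply, cof_eq, cofL_eq, vec4_apply,
      Pi.zero_apply, smul_eq_mul, nullForm_apply]
    constructorm* _ ∧ _ <;> first | trivial | ring

/-- For each transversal direction A the data are `Q_{00}` along `ϑ^A` and `Q_{0A}` along `ϑ^0`.
Their totally symmetric combination `(x + 2r)/3` is the first part, and the mixed remainder,
proportional to `x - r`, is the second. -/
theorem nm2_waveNm : nm2 (waveNm x y r s) =
    waveNm (2 * (x - r) / 3) (2 * (y - s) / 3) ((r - x) / 3) ((s - y) / 3) := by
  funext a b c
  revert a b c
  simp only [forall_four, nm2, symm, Pi.smul_apply, star3_apply, wedge21, Pi.add_apply,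
    lamBar_waveNm, nullForm_apply, waveNm_apply, cofL_eq, vec4_apply, Pi.zero_apply, smul_eq_mul]
  constructorm* _ ∧ _ <;> first | trivial | ring

theorem nm1_waveNm : nm1 (waveNm x y r s) =
    waveNm ((x + 2 * r) / 3) ((y + 2 * s) / 3) ((x + 2 * r) / 3) ((y + 2 * s) / 3) := by
  funext a b c
  revert a b c
  simp only [forall_four, nm1, nm2_waveNm, nm3_waveNm, nm4_waveNm, Pi.sub_apply, waveNm_apply,
    vec4_apply, Pi.zero_apply]
  constructorm* _ ∧ _ <;> first | trivial | ring

theorem nm4_lowest (Q : Fin 4 → Fin 4 → Form1) : nm4 Q 1 1 = 0 ∧ nm4 Q 1 2 = 0 ∧ nm4 Q 1 3 = 0 ∧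
    nm4 Q 2 1 = 0 ∧ nm4 Q 3 1 = 0 := by
  simp only [nm4, metric_apply, zero_smul, and_self]

theorem nm3_lowest (Q : Fin 4 → Fin 4 → Form1) : nm3 Q 1 1 2 = 0 ∧ nm3 Q 1 1 3 = 0 ∧
    nm3 Q 1 2 1 = 0 ∧ nm3 Q 1 3 1 = 0 ∧ nm3 Q 2 1 1 = 0 ∧ nm3 Q 3 1 1 = 0 := by
  simp only [nm3, symm, Pi.smul_apply, Pi.sub_apply, Pi.add_apply, cofL, metric_apply, smul_eq_mul]
  norm_num

theorem lamBar_lowest (Q : Fin 4 → Fin 4 → Form1) :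
    lamBar Q 1 1 2 = Q 1 1 3 - Q 1 3 1 ∧ lamBar Q 1 1 3 = Q 1 2 1 - Q 1 1 2 ∧
    lamBar Q 1 2 1 = Q 1 3 1 - Q 1 1 3 ∧ lamBar Q 1 3 1 = Q 1 1 2 - Q 1 2 1 ∧
    lamBar Q 1 1 1 = 0 := by
  simp only [lamBar, star2_apply, Pi.sub_apply, Pi.add_apply, Pi.smul_apply, Fin.sum_univ_four,
    wedge11, cof_eq, cofL_eq, vec4_apply, smul_eq_mul, nmTf, metric_apply]
  constructorm* _ ∧ _ <;> first | trivial | ring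

/-- The same splitting into a totally symmetric part and a mixed remainder as for the wave, at the
opposite end of the boost weights. -/
theorem nm2_lowest (Q : Fin 4 → Fin 4 → Form1) :
    nm2 Q 1 1 2 = 2 * (Q 1 1 2 - Q 1 2 1) / 3 ∧ nm2 Q 1 1 3 = 2 * (Q 1 1 3 - Q 1 3 1) / 3 ∧
    nm2 Q 1 2 1 = (Q 1 2 1 - Q 1 1 2) / 3 ∧ nm2 Q 1 3 1 = (Q 1 3 1 - Q 1 1 3) / 3 ∧
    nm2 Q 2 1 1 = (Q 1 2 1 - Q 1 1 2) / 3 ∧ nm2 Q 3 1 1 = (Q 1 3 1 - Q 1 1 3) / 3 := by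
  simp only [nm2, symm, Pi.smul_apply, star3_apply, wedge21, Pi.add_apply, cofL_eq, vec4_apply,
    smul_eq_mul, lamBar_lowest]
  constructorm* _ ∧ _ <;> first | trivial | ring

theorem nmOp_waveNm (p : Params) : nmOp p (waveNm x y r s) = raise2 (waveNm
    (p.b1 * ((x + 2 * r) / 3) + p.b2 * (2 * (x - r) / 3))
    (p.b1 * ((y + 2 * s) / 3) + p.b2 * (2 * (y - s) / 3))
    (p.b1 * ((x + 2 * r) / 3) + p.b2 * ((r - x) / 3))
    (p.b1 * ((y + 2 * s) / 3) + p.b2 * ((s - y) / 3))) := by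
  have h : (fun c d => p.b1 • nm1 (waveNm x y r s) c d + p.b2 • nm2 (waveNm x y r s) c d
      + p.b3 • nm3 (waveNm x y r s) c d + p.b4 • nm4 (waveNm x y r s) c d) = waveNm
    (p.b1 * ((x + 2 * r) / 3) + p.b2 * (2 * (x - r) / 3))
    (p.b1 * ((y + 2 * s) / 3) + p.b2 * (2 * (y - s) / 3))
    (p.b1 * ((x + 2 * r) / 3) + p.b2 * ((r - x) / 3))
    (p.b1 * ((y + 2 * s) / 3) + p.b2 * ((s - y) / 3)) := by
    funext a b c
    revert a b c
    simp only [forall_four, nm1_waveNm, nm2_waveNm, nm3_waveNm, nm4_waveNm]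
    simp only [Pi.add_apply, Pi.smul_apply, waveNm_apply, vec4_apply, Pi.zero_apply, smul_eq_mul]
    constructorm* _ ∧ _ <;> first | trivial | ring
  rw [nmOp, h]

theorem nmShear_waveNm : nmShear (waveNm x y r s) = 0 := by
  funext c a b
  simp [nmShear, nm3_waveNm, wedge11]

theorem nmWeyl_waveNm : nmWeyl (waveNm x y r s) = 0 := by
  funext c a b
  simp [nmWeyl, nm4_waveNm, wedge11, raise2]

/-- Both factors of this bilinear term vanish at the wave, so its derivative does as well, and b5
disappears. -/
theorem nmCrossPolar_waveNm (Q : Fin 4 → Fin 4 → Form1) : nmCrossPolar (waveNm x y r s) Q = 0 := by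
  simp [nmCrossPolar, nmShear_waveNm, nmWeyl_waveNm, inner2, raise2]

theorem torPolar_waveTor (p : Params) {T : Fin 4 → Form2} (hT : ∀ a b c, T a b c = -T a c b) :
    torPolar p (waveTor x y) T = -(2 * p.a1 * (x * T 0 1 2 + y * T 0 1 3)) := by
  have h1 : torTrace (waveTor x y) = 0 := by
    funext a
    revert a
    simp only [forall_four, torTrace, int2, Fin.sum_univ_four, Pi.add_apply, waveTor_apply,
      nullForm_apply, Pi.zero_apply]
    norm_num
  have h2 : torAxial (waveTor x y) = 0 := by
    funext a b c
    revert a b c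
    simp only [forall_four, torAxial, wedge21, Fin.sum_univ_four, Pi.add_apply, waveTor_apply,
      nullForm_apply, Pi.zero_apply, cofL_eq, vec4_apply]
    norm_num
  -- The wave torsion has neither trace nor axial part, so it is purely of the first kind; a2 and a3
  -- drop out.
  have h3 : torOp p (waveTor x y) = raise1 (p.a1 • waveTor x y) := by
    have h : (fun b => p.a1 • tor1 (waveTor x y) b + p.a2 • tor2 (waveTor x y) b
        + p.a3 • tor3 (waveTor x y) b) = p.a1 • waveTor x y := by
      funext b c d
      simp [tor1, tor2, tor3, h1, h2, wedge11, int3, raise1]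
    rw [torOp, h]
  have h4 : ∀ a b c, waveTor x y a b c = -waveTor x y a c b := by
    simp only [forall_four, waveTor_apply, nullForm_apply, Pi.zero_apply]
    norm_num
  simp only [torPolar, h3, Fin.sum_univ_four, raise1_zero, raise1_one, raise1_two, raise1_three,
    inner2_apply (hT _), inner2_apply (h4 _), Pi.smul_apply, Pi.neg_apply, waveTor_apply,
    nullForm_apply, torOp_lowest p hT, Pi.zero_apply, hT 0 2 1, hT 0 3 1, smul_eq_mul]
  ring

theorem nmPolar_waveNm (p : Params) {Q : Fin 4 → Fin 4 → Form1} (hQ : ∀ a b, Q a b = Q b a) :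
    nmPolar p (waveNm x y r s) Q =
      -2 * (Q 1 1 2 * (p.b1 * ((x + 2 * r) / 3) + p.b2 * (2 * (x - r) / 3))
        + Q 1 1 3 * (p.b1 * ((y + 2 * s) / 3) + p.b2 * (2 * (y - s) / 3)))
      - 4 * (Q 1 2 1 * (p.b1 * ((x + 2 * r) / 3) + p.b2 * ((r - x) / 3))
        + Q 1 3 1 * (p.b1 * ((y + 2 * s) / 3) + p.b2 * ((s - y) / 3))) := by
  have h : nmOp p Q 0 0 2 = p.b1 * (Q 1 1 2 - 2 * (Q 1 1 2 - Q 1 2 1) / 3)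
        + p.b2 * (2 * (Q 1 1 2 - Q 1 2 1) / 3) ∧
      nmOp p Q 0 0 3 = p.b1 * (Q 1 1 3 - 2 * (Q 1 1 3 - Q 1 3 1) / 3)
        + p.b2 * (2 * (Q 1 1 3 - Q 1 3 1) / 3) ∧
      nmOp p Q 0 2 1 = -(p.b1 * (Q 1 2 1 - (Q 1 2 1 - Q 1 1 2) / 3)
        + p.b2 * ((Q 1 2 1 - Q 1 1 2) / 3)) ∧
      nmOp p Q 0 3 1 = -(p.b1 * (Q 1 3 1 - (Q 1 3 1 - Q 1 1 3) / 3)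
        + p.b2 * ((Q 1 3 1 - Q 1 1 3) / 3)) ∧
      nmOp p Q 2 0 1 = -(p.b1 * (Q 1 2 1 - (Q 1 2 1 - Q 1 1 2) / 3)
        + p.b2 * ((Q 1 2 1 - Q 1 1 2) / 3)) ∧
      nmOp p Q 3 0 1 = -(p.b1 * (Q 1 3 1 - (Q 1 3 1 - Q 1 1 3) / 3)
        + p.b2 * ((Q 1 3 1 - Q 1 1 3) / 3)) := by
    simp only [nmOp, raise2_eq_raise1, raise1_zero, raise1_two, raise1_three, nm1,
      Pi.neg_apply, Pi.add_apply, Pi.smul_apply, Pi.sub_apply, nm2_lowest, nm3_lowest, nm4_lowest,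
      smul_eq_mul, Pi.zero_apply, hQ 2 1, hQ 3 1]
    constructorm* _ ∧ _ <;> first | trivial | ring
  simp only [nmPolar, nmOp_waveNm, Fin.sum_univ_four, inner1_apply, raise2_eq_raise1, raise1_zero,
    raise1_one, raise1_two, raise1_three, Pi.neg_apply]
  simp only [waveNm_apply, vec4_apply, Pi.zero_apply, h, hQ 2 1, hQ 3 1]
  ring

theorem nmTorPolar_wave (p : Params) (f g : ℝ) {T : Fin 4 → Form2} {Q : Fin 4 → Fin 4 → Form1}
    (hT : ∀ a b c, T a b c = -T a c b) :
    nmTorPolar p (waveTor f g) T (waveNm x y r s) Q =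
      p.c1 * (f * (Q 1 1 2 - Q 1 2 1) + g * (Q 1 1 3 - Q 1 3 1)
        + (x - r) * T 0 1 2 + (y - s) * T 0 1 3) := by
  have h1 : nmTor p (waveNm x y r s) 0 = nullForm (-p.c1 * (x - r)) (-p.c1 * (y - s)) 0 ∧
      nmTor p (waveNm x y r s) 1 = 0 ∧ nmTor p (waveNm x y r s) 2 = 0 ∧
      nmTor p (waveNm x y r s) 3 = 0 := by
    refine ⟨?_, ?_, ?_, ?_⟩
    all_goals
      funext c d
      revert c d
      simp only [forall_four, nmTor, nm2_waveNm, nm3_waveNm, nm4_waveNm, Fin.sum_univ_four]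
      simp only [Pi.add_apply, Pi.smul_apply, wedge11, waveNm_apply, cof_eq, vec4_apply,
        Pi.zero_apply, smul_eq_mul, nullForm_apply]
      constructorm* _ ∧ _ <;> first | trivial | ring
  have h2 : ∀ c d, nmTor p Q 1 c d = -nmTor p Q 1 d c := by
    intro c d
    simp only [nmTor, Finset.sum_apply, ← Finset.sum_neg_distrib]
    exact Finset.sum_congr rfl fun a _ => wedge11_alt _ _ _ _
  have h3 : nmTor p Q 1 1 2 = p.c1 * (Q 1 2 1 - Q 1 1 2) ∧
      nmTor p Q 1 1 3 = p.c1 * (Q 1 3 1 - Q 1 1 3) := by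
    simp only [nmTor, Fin.sum_univ_four, wedge11, Pi.add_apply, Pi.smul_apply, cof_eq, vec4_apply,
      nm2_lowest, nm3_lowest, nm4_lowest, smul_eq_mul, Pi.zero_apply]
    constructorm* _ ∧ _ <;> first | trivial | ring
  have h0 : ∀ c d, (0 : Form2) c d = -(0 : Form2) d c := by simp
  have h4 : ∀ u v c d, nullForm u v 0 c d = -nullForm u v 0 d c := by
    intro u v
    simp only [forall_four, nullForm_apply]
    norm_num
  simp only [nmTorPolar, Fin.sum_univ_four, h1, waveTor_apply, inner2_apply h2, inner2_apply h0,
    inner2_apply (h4 _ _)]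
  simp only [inner2, raise2_eq_raise1, Fin.sum_univ_four, raise1_zero, raise1_one, raise1_two,
    raise1_three, nullForm_apply, Pi.zero_apply, h3, hT 0 2 1, hT 0 3 1]
  ring

theorem scal_apply {R : Fin 4 → Fin 4 → Form2} (hR : ∀ a b c d, R a b c d = -R a b d c) :
    scal R = R 1 0 0 1 - R 1 2 0 2 - R 1 3 0 3 - R 0 1 0 1 - R 0 2 1 2 - R 0 3 1 3 + R 2 1 0 2
      + R 2 0 1 2 + R 2 3 2 3 + R 3 1 0 3 + R 3 0 1 3 - R 3 2 2 3 := by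
  simp only [scal, inner2_apply (raise2_alt hR _ _)]
  simp only [Fin.sum_univ_four, raise2_eq_raise1, raise1_zero, raise1_one, raise1_two,
    raise1_three, Pi.neg_apply, wedge11, cofL_eq, vec4_apply]
  ring

/-! ### First variation of the field strengths -/

theorem hasDerivAt_inv_apply {A B : Matrix (Fin 4) (Fin 4) ℝ} (hA : IsUnit A.det) (i j : Fin 4) :
    HasDerivAt (fun t : ℝ => (A + t • B)⁻¹ i j) (-(A⁻¹ * B * A⁻¹) i j) 0 := by
  -- The derivative of inversion is taken in a normed algebra. The choice of norm is immaterial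
  -- because only matrix entries are differentiated.
  let := Matrix.linftyOpNormedRing (n := Fin 4) (α := ℝ)
  let := Matrix.linftyOpNormedAlgebra (n := Fin 4) (α := ℝ) (R := ℝ)
  obtain ⟨u, hu⟩ := (Matrix.isUnit_iff_isUnit_det A).2 hA
  have hinv : (↑u⁻¹ : Matrix (Fin 4) (Fin 4) ℝ) = A⁻¹ := by
    rw [← hu, Matrix.coe_units_inv]
  have h1 : HasDerivAt (fun t : ℝ => A + t • B) B 0 := by
    exact HasDerivAt.congr_deriv (((hasDerivAt_id (0 : ℝ)).smul_const B).const_add A) (one_smul _ _)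
  have h2 := (hasFDerivAt_ringInverse (𝕜 := ℝ) u)
  have h3 : HasDerivAt (fun t : ℝ => Ring.inverse (A + t • B)) (-(A⁻¹ * B * A⁻¹)) 0 := by
    have := HasFDerivAt.comp_hasDerivAt_of_eq (0 : ℝ) h2 h1 (by simp [hu])
    refine HasDerivAt.congr_deriv this ?_
    simp [hinv]
  have h4 := IsLinearMap.hasDerivAt_comp (f := fun M : Matrix (Fin 4) (Fin 4) ℝ => M i j)
    ⟨fun _ _ => rfl, fun _ _ => rfl⟩ h3
  refine HasDerivAt.congr_deriv ?_ (Matrix.neg_apply _ _ _)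
  refine h4.congr_of_eventuallyEq (Filter.Eventually.of_forall fun t => ?_)
  simp only [Matrix.nonsing_inv_eq_ringInverse]

theorem hasDerivAt_det {A B : Matrix (Fin 4) (Fin 4) ℝ} (hA : IsUnit A.det) :
    HasDerivAt (fun t : ℝ => (A + t • B).det) (A.det * (A⁻¹ * B).trace) 0 := by
  -- Factoring out A reduces to `det (1 + t A⁻¹B)`, a polynomial in t with linear coefficient the
  -- trace; the remainder carries `t²` and does not contribute at 0.
  have h : ∀ t : ℝ, (A + t • B).det = A.det * (1 + (A⁻¹ * B).trace * t + (Polynomial.eval t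
      (Matrix.det (1 + (Polynomial.X : Polynomial ℝ) • (A⁻¹ * B).map Polynomial.C)).divX.divX)
        * t ^ 2) := by
    intro t
    rw [← Matrix.det_one_add_smul, ← Matrix.det_mul]
    congr 1
    rw [mul_add, mul_one, Matrix.mul_smul, ← Matrix.mul_assoc, Matrix.mul_nonsing_inv _ hA,
      Matrix.one_mul]
  simp only [h]
  refine HasDerivAt.const_mul _ ?_
  have h1 := ((hasDerivAt_id (0 : ℝ)).const_mul (A⁻¹ * B).trace).const_add 1
  have h2 := (Polynomial.hasDerivAt (Matrix.det (1 + (Polynomial.X : Polynomial ℝ) •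
    (A⁻¹ * B).map Polynomial.C)).divX.divX (0 : ℝ)).mul ((hasDerivAt_id (0 : ℝ)).pow 2)
  refine HasDerivAt.congr_deriv (h1.add h2) ?_
  simp

/-- The frame components `η_a{}^b` of a variation of the coframe. -/
def frameVar (e η : CoframeField) (x : Pt) : Matrix (Fin 4) (Fin 4) ℝ :=
  frame e x * Matrix.of (η x)

section

variable {e η : CoframeField} {x : Pt}

theorem hasDerivAt_frame (he : IsUnit (Matrix.of (e x)).det) (a μ : Fin 4) :
    HasDerivAt (fun t : ℝ => frame (fun y => e y + t • η y) x a μ)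
      (-∑ d, frameVar e η x a d * frame e x d μ) 0 := by
  have := hasDerivAt_inv_apply (B := Matrix.of (η x)) he a μ
  exact HasDerivAt.congr_deriv this (congrArg Neg.neg (Matrix.mul_apply ..))

/-- Besides the variation of the coordinate components, the dual frame varies by minus `frameVar`
applied to the frame. For a 2-form this correction occurs once for each index. -/
theorem hasDerivAt_toFrame1 (he : IsUnit (Matrix.of (e x)).det) {φ : ℝ → Fin 4 → ℝ}
    {φ' : Fin 4 → ℝ} (hφ : ∀ μ, HasDerivAt (fun t => φ t μ) (φ' μ) 0) :
    HasDerivAt (fun t : ℝ => toFrame1 (fun y => e y + t • η y) x (φ t))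
      (fun a => toFrame1 e x φ' a - ∑ d, frameVar e η x a d * toFrame1 e x (φ 0) d) 0 := by
  refine hasDerivAt_pi.2 fun a => ?_
  have h := HasDerivAt.fun_sum (u := Finset.univ) fun μ _ =>
    (hasDerivAt_frame (η := η) he a μ).mul (hφ μ)
  refine HasDerivAt.congr_deriv h ?_
  have h0 : (fun y => e y + (0 : ℝ) • η y) = e := by funext y; simp
  simp only [h0, toFrame1, Finset.sum_add_distrib, neg_mul, Finset.sum_neg_distrib,
    Finset.mul_sum, Finset.sum_mul, mul_assoc]
  rw [Finset.sum_comm]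
  ring

theorem hasDerivAt_toFrame2 (he : IsUnit (Matrix.of (e x)).det) {φ : ℝ → Fin 4 → Fin 4 → ℝ}
    {φ' : Fin 4 → Fin 4 → ℝ} (hφ : ∀ μ ν, HasDerivAt (fun t => φ t μ ν) (φ' μ ν) 0) :
    HasDerivAt (fun t : ℝ => toFrame2 (fun y => e y + t • η y) x (φ t))
      (fun a b => toFrame2 e x φ' a b - ∑ d, frameVar e η x a d * toFrame2 e x (φ 0) d b
        - ∑ d, frameVar e η x b d * toFrame2 e x (φ 0) a d) 0 := by
  refine hasDerivAt_pi.2 fun a => hasDerivAt_pi.2 fun b => ?_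
  have h := HasDerivAt.fun_sum (u := Finset.univ) fun μ _ => HasDerivAt.fun_sum (u := Finset.univ)
    fun ν _ => ((hasDerivAt_frame (η := η) he a μ).mul (hasDerivAt_frame (η := η) he b ν)).mul
      (hφ μ ν)
  refine HasDerivAt.congr_deriv h ?_
  have h0 : (fun y => e y + (0 : ℝ) • η y) = e := by funext y; simp
  have e1 : ∑ d, frameVar e η x a d * toFrame2 e x (φ 0) d b = ∑ μ, ∑ ν,
      (∑ d, frameVar e η x a d * frame e x d μ) * frame e x b ν * φ 0 μ ν := by
    simp only [toFrame2, Finset.mul_sum, Finset.sum_mul]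
    rw [Finset.sum_comm]
    refine Finset.sum_congr rfl fun μ _ => ?_
    rw [Finset.sum_comm]
    exact Finset.sum_congr rfl fun ν _ => Finset.sum_congr rfl fun d _ => by ring
  have e2 : ∑ d, frameVar e η x b d * toFrame2 e x (φ 0) a d = ∑ μ, ∑ ν,
      frame e x a μ * (∑ d, frameVar e η x b d * frame e x d ν) * φ 0 μ ν := by
    simp only [toFrame2, Finset.mul_sum, Finset.sum_mul]
    rw [Finset.sum_comm]
    refine Finset.sum_congr rfl fun μ _ => ?_
    rw [Finset.sum_comm]
    exact Finset.sum_congr rfl fun ν _ => Finset.sum_congr rfl fun d _ => by ring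
  rw [e1, e2]
  simp only [Pi.mul_apply, h0, toFrame2, ← Finset.sum_sub_distrib]
  exact Finset.sum_congr rfl fun μ _ => Finset.sum_congr rfl fun ν _ => by ring

/-- Variation of the torsion. -/
def torsionVar (e : CoframeField) (Γ : ConnField) (η : CoframeField) (γ : ConnField) (x : Pt)
    (a : Fin 4) : Form2 := fun b c =>
  toFrame2 e x (fun μ ν => pderiv μ (fun y => η y ν a) x - pderiv ν (fun y => η y μ a) x
      + ∑ c, (γ x μ c a * e x ν c + Γ x μ c a * η x ν c
        - (γ x ν c a * e x μ c + Γ x ν c a * η x μ c))) b c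
    - ∑ d, frameVar e η x b d * torsion e Γ x a d c - ∑ d, frameVar e η x c d * torsion e Γ x a b d

/-- Variation of the nonmetricity. -/
def nonmetricityVar (e : CoframeField) (Γ : ConnField) (η : CoframeField) (γ : ConnField) (x : Pt)
    (a b : Fin 4) : Form1 := fun c =>
  toFrame1 e x (fun μ => ∑ c, (γ x μ a c * metric c b + γ x μ b c * metric a c)) c
    - ∑ d, frameVar e η x c d * nonmetricity e Γ x a b d

/-- Variation of the curvature `R_a{}^b`. -/
def curvatureMixedVar (e : CoframeField) (Γ : ConnField) (η : CoframeField) (γ : ConnField) (x : Pt)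
    (a b : Fin 4) : Form2 := fun i j =>
  toFrame2 e x (fun μ ν => pderiv μ (fun y => γ y ν a b) x - pderiv ν (fun y => γ y μ a b) x
      + ∑ c, (γ x μ c b * Γ x ν a c + Γ x μ c b * γ x ν a c
        - (γ x ν c b * Γ x μ a c + Γ x ν c b * γ x μ a c))) i j
    - ∑ d, frameVar e η x i d * curvatureMixed e Γ x a b d j
    - ∑ d, frameVar e η x j d * curvatureMixed e Γ x a b i d

/-- Variation of the curvature `R_{ab}`. -/
def curvatureVar (e : CoframeField) (Γ : ConnField) (η : CoframeField) (γ : ConnField) (x : Pt)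
    (a b : Fin 4) : Form2 :=
  raise1 (curvatureMixedVar e Γ η γ x a) b

theorem hasDerivAt_add_smul (r s : ℝ) : HasDerivAt (fun t : ℝ => r + t * s) s 0 := by
  simpa using ((hasDerivAt_id (0 : ℝ)).mul_const s).const_add r

theorem pderiv_add_smul {f g : Pt → ℝ} (hf : DifferentiableAt ℝ f x) (hg : DifferentiableAt ℝ g x)
    (μ : Fin 4) (t : ℝ) : pderiv μ (fun y => f y + t * g y) x = pderiv μ f x
      + t * pderiv μ g x := by
  simp only [pderiv]
  rw [fderiv_fun_add hf (hg.const_mul t), fderiv_const_mul hg]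
  simp

variable {Γ γ : ConnField}

theorem hasDerivAt_torsion (he : IsUnit (Matrix.of (e x)).det) (de : DifferentiableAt ℝ e x)
    (dη : DifferentiableAt ℝ η x) :
    HasDerivAt (fun t : ℝ => torsion (fun y => e y + t • η y) (fun y => Γ y + t • γ y) x)
      (torsionVar e Γ η γ x) 0 := by
  refine hasDerivAt_pi.2 fun a => ?_
  have h0 : (fun y => e y + (0 : ℝ) • η y) = e := by funext y; simp
  have h0' : (fun y => Γ y + (0 : ℝ) • γ y) = Γ := by funext y; simp
  have hd : ∀ ν, DifferentiableAt ℝ (fun y => e y ν a) x := fun ν =>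
    differentiableAt_pi.1 (differentiableAt_pi.1 de ν) a
  have hd' : ∀ ν, DifferentiableAt ℝ (fun y => η y ν a) x := fun ν =>
    differentiableAt_pi.1 (differentiableAt_pi.1 dη ν) a
  have h := hasDerivAt_toFrame2 (η := η) he (φ := fun t μ ν =>
      pderiv μ (fun y => (e y + t • η y) ν a) x - pderiv ν (fun y => (e y + t • η y) μ a) x
      + ∑ c, ((Γ x + t • γ x) μ c a * (e x + t • η x) ν c
        - (Γ x + t • γ x) ν c a * (e x + t • η x) μ c))
    (φ' := fun μ ν => pderiv μ (fun y => η y ν a) x - pderiv ν (fun y => η y μ a) x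
      + ∑ c, (γ x μ c a * e x ν c + Γ x μ c a * η x ν c
        - (γ x ν c a * e x μ c + Γ x ν c a * η x μ c))) (fun μ ν => ?_)
  · refine HasDerivAt.congr_deriv h ?_
    simp only [zero_smul, add_zero]
    rfl
  · simp only [Pi.add_apply, Pi.smul_apply, smul_eq_mul, pderiv_add_smul (hd _) (hd' _)]
    refine ((hasDerivAt_add_smul _ _).sub (hasDerivAt_add_smul _ _)).add ?_
    refine HasDerivAt.congr_deriv (HasDerivAt.fun_sum (u := Finset.univ) fun c _ =>
      ((hasDerivAt_add_smul (Γ x μ c a) (γ x μ c a)).mul (hasDerivAt_add_smul (e x ν c) (η x ν c))).sub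
      ((hasDerivAt_add_smul (Γ x ν c a) (γ x ν c a)).mul
        (hasDerivAt_add_smul (e x μ c) (η x μ c)))) ?_
    simp

theorem hasDerivAt_nonmetricity (he : IsUnit (Matrix.of (e x)).det) :
    HasDerivAt (fun t : ℝ => nonmetricity (fun y => e y + t • η y) (fun y => Γ y + t • γ y) x)
      (nonmetricityVar e Γ η γ x) 0 := by
  refine hasDerivAt_pi.2 fun a => hasDerivAt_pi.2 fun b => ?_
  have h := hasDerivAt_toFrame1 (η := η) he (φ := fun t μ => ∑ c, ((Γ x
    + t • γ x) μ a c * metric c b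
      + (Γ x + t • γ x) μ b c * metric a c))
    (φ' := fun μ => ∑ c, (γ x μ a c * metric c b + γ x μ b c * metric a c)) (fun μ => ?_)
  · refine HasDerivAt.congr_deriv h ?_
    simp only [zero_smul, add_zero]
    rfl
  · exact HasDerivAt.fun_sum (u := Finset.univ) fun c _ =>
      ((hasDerivAt_add_smul (Γ x μ a c) (γ x μ a c)).mul_const _).add
        ((hasDerivAt_add_smul (Γ x μ b c) (γ x μ b c)).mul_const _)

theorem hasDerivAt_curvature (he : IsUnit (Matrix.of (e x)).det) (dΓ : DifferentiableAt ℝ Γ x)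
    (dγ : DifferentiableAt ℝ γ x) :
    HasDerivAt (fun t : ℝ => curvature (fun y => e y + t • η y) (fun y => Γ y + t • γ y) x)
      (curvatureVar e Γ η γ x) 0 := by
  have hr : IsLinearMap ℝ (fun X : Fin 4 → Fin 4 → Form2 => fun a b => raise1 (X a) b) :=
    isLinearMap_of_lin fun X Y r => by funext a b; exact raise1_lin (X a) (Y a) r b
  refine IsLinearMap.hasDerivAt_comp hr (c := fun t : ℝ => curvatureMixed (fun y => e y + t • η y)
    (fun y => Γ y + t • γ y) x) (c' := curvatureMixedVar e Γ η γ x) ?_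
  refine hasDerivAt_pi.2 fun a => hasDerivAt_pi.2 fun b => ?_
  have hd : ∀ ν, DifferentiableAt ℝ (fun y => Γ y ν a b) x := fun ν =>
    differentiableAt_pi.1 (differentiableAt_pi.1 (differentiableAt_pi.1 dΓ ν) a) b
  have hd' : ∀ ν, DifferentiableAt ℝ (fun y => γ y ν a b) x := fun ν =>
    differentiableAt_pi.1 (differentiableAt_pi.1 (differentiableAt_pi.1 dγ ν) a) b
  have h := hasDerivAt_toFrame2 (η := η) he (φ := fun t μ ν =>
      pderiv μ (fun y => (Γ y + t • γ y) ν a b) x - pderiv ν (fun y => (Γ y + t • γ y) μ a b) x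
      + ∑ c, ((Γ x + t • γ x) μ c b * (Γ x + t • γ x) ν a c
        - (Γ x + t • γ x) ν c b * (Γ x + t • γ x) μ a c))
    (φ' := fun μ ν => pderiv μ (fun y => γ y ν a b) x - pderiv ν (fun y => γ y μ a b) x
      + ∑ c, (γ x μ c b * Γ x ν a c + Γ x μ c b * γ x ν a c
        - (γ x ν c b * Γ x μ a c + Γ x ν c b * γ x μ a c))) (fun μ ν => ?_)
  · refine HasDerivAt.congr_deriv h ?_
    simp only [zero_smul, add_zero]
    rfl
  · simp only [Pi.add_apply, Pi.smul_apply, smul_eq_mul, pderiv_add_smul (hd _) (hd' _)]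
    refine ((hasDerivAt_add_smul _ _).sub (hasDerivAt_add_smul _ _)).add ?_
    refine HasDerivAt.congr_deriv (HasDerivAt.fun_sum (u := Finset.univ) fun c _ =>
      ((hasDerivAt_add_smul (Γ x μ c b) (γ x μ c b)).mul
        (hasDerivAt_add_smul (Γ x ν a c) (γ x ν a c))).sub
      ((hasDerivAt_add_smul (Γ x ν c b) (γ x ν c b)).mul
        (hasDerivAt_add_smul (Γ x μ a c) (γ x μ a c)))) ?_
    simp

/-- The volume factor contributes the trace of the frame components of the coframe variation times
the Lagrangian; everything else is the chain rule through the three field strengths. -/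
theorem hasDerivAt_lagDensity (p : Params) (he : IsUnit (Matrix.of (e x)).det)
    (de : DifferentiableAt ℝ e x) (dΓ : DifferentiableAt ℝ Γ x) (dη : DifferentiableAt ℝ η x)
    (dγ : DifferentiableAt ℝ γ x) :
    HasDerivAt (fun t : ℝ => lagDensity p (fun y => e y + t • η y) (fun y => Γ y + t • γ y) x)
      ((Matrix.of (e x)).det * ((frameVar e η x).trace
          * (lagWeak p (torsion e Γ x) (nonmetricity e Γ x) (curvature e Γ x)
            + lagStrong p (curvature e Γ x))
        + (lagWeakDeriv p (torsion e Γ x) (torsionVar e Γ η γ x) (nonmetricity e Γ x)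
            (nonmetricityVar e Γ η γ x) (curvatureVar e Γ η γ x)
          + lagStrongDeriv p (curvature e Γ x) (curvatureVar e Γ η γ x)))) 0 := by
  have h0 : (fun y => e y + (0 : ℝ) • η y) = e := by funext y; simp
  have h0' : (fun y => Γ y + (0 : ℝ) • γ y) = Γ := by funext y; simp
  have hR := hasDerivAt_curvature (η := η) he dΓ dγ
  have h1 := hasDerivAt_lagWeak p (hasDerivAt_torsion (Γ := Γ) (γ := γ) he de dη)
    (hasDerivAt_nonmetricity (η := η) (Γ := Γ) (γ := γ) he) hR
  have h2 := hasDerivAt_lagStrong p hR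
  have h3 : HasDerivAt (fun t : ℝ => (Matrix.of (e x + t • η x)).det)
      ((Matrix.of (e x)).det * (frameVar e η x).trace) 0 :=
    hasDerivAt_det (A := Matrix.of (e x)) (B := Matrix.of (η x)) he
  refine HasDerivAt.congr_deriv (h3.mul (h1.add h2)) ?_
  simp only [zero_smul, add_zero]
  ring

end

/-! ### The field strengths of the wave -/

/-- The derivative `∂_u`. -/
def uderiv (F : Fun3) (r : ℝ × ℝ × ℝ) : ℝ := fderiv ℝ F r (1, 0, 0)

/-- The coordinate projection `uxy` as a linear map. -/
def uxyL : Pt →L[ℝ] ℝ × ℝ × ℝ :=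
  (ContinuousLinearMap.proj (R := ℝ) (φ := fun _ : Fin 4 => ℝ) 0).prod
    ((ContinuousLinearMap.proj (R := ℝ) (φ := fun _ : Fin 4 => ℝ) 2).prod
      (ContinuousLinearMap.proj (R := ℝ) (φ := fun _ : Fin 4 => ℝ) 3))

theorem contDiff_uxy : ContDiff ℝ ∞ uxy := uxyL.contDiff

section

variable {H : Fun3} {W V U : Fin 2 → Fun3} {x : Pt}

theorem pderiv_uxy {F : Fun3} (hF : Differentiable ℝ F) (x : Pt) :
    pderiv 0 (fun y => F (uxy y)) x = uderiv F (uxy x) ∧ pderiv 1 (fun y => F (uxy y)) x = 0 ∧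
    pderiv 2 (fun y => F (uxy y)) x = tderiv 0 F (uxy x) ∧
    pderiv 3 (fun y => F (uxy y)) x = tderiv 1 F (uxy x) := by
  have h : ∀ v, fderiv ℝ (fun y => F (uxy y)) x v = fderiv ℝ F (uxy x) (uxy v) := by
    intro v
    have := ((hF (uxy x)).hasFDerivAt.comp x uxyL.hasFDerivAt).fderiv
    have h2 : fderiv ℝ (fun y => F (uxy y)) x = (fderiv ℝ F (uxy x)).comp uxyL := this
    rw [h2]
    rfl
  have h0 : uxy (Pi.single 0 1) = (1, 0, 0) := by simp [uxy]
  have h1 : uxy (Pi.single 1 1) = 0 := by simp [uxy]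
  have h2 : uxy (Pi.single 2 1) = (0, 1, 0) := by simp [uxy]
  have h3 : uxy (Pi.single 3 1) = (0, 0, 1) := by simp [uxy]
  simp only [pderiv, h, h0, h1, h2, h3, uderiv, tderiv, map_zero]
  simp

theorem ppCoframe_apply (H : Fun3) (x : Pt) :
    ppCoframe H x 0 0 = 1 ∧ ppCoframe H x 0 1 = H (uxy x) / 2 ∧ ppCoframe H x 0 2 = 0 ∧
    ppCoframe H x 0 3 = 0 ∧ ppCoframe H x 1 0 = 0 ∧ ppCoframe H x 1 1 = 1 ∧
    ppCoframe H x 1 2 = 0 ∧ ppCoframe H x 1 3 = 0 ∧ ppCoframe H x 2 0 = 0 ∧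
    ppCoframe H x 2 1 = 0 ∧ ppCoframe H x 2 2 = 1 ∧ ppCoframe H x 2 3 = 0 ∧
    ppCoframe H x 3 0 = 0 ∧ ppCoframe H x 3 1 = 0 ∧ ppCoframe H x 3 2 = 0 ∧
    ppCoframe H x 3 3 = 1 :=
  ⟨rfl, rfl, rfl, rfl, rfl, rfl, rfl, rfl, rfl, rfl, rfl, rfl, rfl, rfl, rfl, rfl⟩

/-- The dual frame of the pp-wave coframe. -/
def ppFrame (h : ℝ) : Matrix (Fin 4) (Fin 4) ℝ :=
  !![1, -(h / 2), 0, 0; 0, 1, 0, 0; 0, 0, 1, 0; 0, 0, 0, 1]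

theorem ppFrame_apply (h : ℝ) :
    ppFrame h 0 0 = 1 ∧ ppFrame h 0 1 = -(h / 2) ∧ ppFrame h 0 2 = 0 ∧ ppFrame h 0 3 = 0 ∧
    ppFrame h 1 0 = 0 ∧ ppFrame h 1 1 = 1 ∧ ppFrame h 1 2 = 0 ∧ ppFrame h 1 3 = 0 ∧
    ppFrame h 2 0 = 0 ∧ ppFrame h 2 1 = 0 ∧ ppFrame h 2 2 = 1 ∧ ppFrame h 2 3 = 0 ∧
    ppFrame h 3 0 = 0 ∧ ppFrame h 3 1 = 0 ∧ ppFrame h 3 2 = 0 ∧ ppFrame h 3 3 = 1 :=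
  ⟨rfl, rfl, rfl, rfl, rfl, rfl, rfl, rfl, rfl, rfl, rfl, rfl, rfl, rfl, rfl, rfl⟩

theorem ppFrame_mul (H : Fun3) (x : Pt) : ppFrame (H (uxy x)) * Matrix.of (ppCoframe H x) = 1 := by
  ext i j
  revert i j
  simp only [forall_four, Matrix.mul_apply, Fin.sum_univ_four, Matrix.of_apply, ppFrame_apply,
    ppCoframe_apply]
  simp

theorem frame_ppCoframe (H : Fun3) (x : Pt) : frame (ppCoframe H) x = ppFrame (H (uxy x)) :=
  Matrix.inv_eq_left_inv (ppFrame_mul H x)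

theorem det_ppCoframe (H : Fun3) (x : Pt) : (Matrix.of (ppCoframe H x)).det = 1 := by
  have h := congrArg Matrix.det (ppFrame_mul H x)
  have h' : (ppFrame (H (uxy x))).det = 1 := by
    simp [ppFrame, Matrix.det_succ_row_zero, Fin.sum_univ_succ, Fin.succAbove]
  rwa [Matrix.det_mul, h', one_mul, Matrix.det_one] at h

/-- The functions `W` carry a sign opposite to that of `V` because the covector `W_a` is obtained by
lowering a transversal index, which costs a minus sign. -/
theorem ansatzConn_apply (H : Fun3) (W V U : Fin 2 → Fun3) (x : Pt) :
    ansatzConn H W V U x 0 0 = ![0, 0, -V 0 (uxy x), -V 1 (uxy x)] ∧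
    ansatzConn H W V U x 0 1 = 0 ∧ ansatzConn H W V U x 0 2 = ![0, W 0 (uxy x), 0, 0] ∧
    ansatzConn H W V U x 0 3 = ![0, W 1 (uxy x), 0, 0] ∧ ansatzConn H W V U x 1 = 0 ∧
    ansatzConn H W V U x 2 0 = ![0, U 0 (uxy x), 0, 0] ∧ ansatzConn H W V U x 2 1 = 0 ∧
    ansatzConn H W V U x 2 2 = 0 ∧ ansatzConn H W V U x 2 3 = 0 ∧
    ansatzConn H W V U x 3 0 = ![0, U 1 (uxy x), 0, 0] ∧ ansatzConn H W V U x 3 1 = 0 ∧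
    ansatzConn H W V U x 3 2 = 0 ∧ ansatzConn H W V U x 3 3 = 0 := by
  have k : kL 0 = 1 ∧ kL 1 = 0 ∧ kL 2 = 0 ∧ kL 3 = 0 := by simp [kL]
  have t : ∀ F, transv F 0 = 0 ∧ transv F 1 = 0 ∧ transv F 2 = F 0 ∧ transv F 3 = F 1 :=
    fun F => ⟨rfl, rfl, rfl, rfl⟩
  have k' : raise1 kL 0 = 0 ∧ raise1 kL 1 = 1 ∧ raise1 kL 2 = 0 ∧ raise1 kL 3 = 0 := by
    simp [raise1_zero, raise1_one, raise1_two, raise1_three, k]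
  have t' : ∀ F, raise1 (transv F) 0 = 0 ∧ raise1 (transv F) 1 = 0 ∧
      raise1 (transv F) 2 = -F 0 ∧ raise1 (transv F) 3 = -F 1 := by
    simp [raise1_zero, raise1_one, raise1_two, raise1_three, t]
  refine ⟨?_, ?_, ?_, ?_, ?_, ?_, ?_, ?_, ?_, ?_, ?_, ?_, ?_⟩
  -- The only conjunct about a whole matrix: the connection has no component along dv.
  case refine_5 =>
    funext a b
    revert a b
    simp only [forall_four, ansatzConn, Fin.sum_univ_four, ppCoframe_apply, k, t, k', t',
      Pi.zero_apply]
    norm_num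
  all_goals
    funext b
    revert b
    simp only [forall_four, ansatzConn, Fin.sum_univ_four, ppCoframe_apply, k, t, k', t',
      vec4_apply, Pi.zero_apply]
    norm_num

theorem pderiv_const (μ : Fin 4) (c : ℝ) (x : Pt) : pderiv μ (fun _ => c) x = 0 := by
  simp [pderiv]

theorem pderiv_ppCoframe (hH : Differentiable ℝ H) (x : Pt) (μ : Fin 4) :
    pderiv μ (fun y => ppCoframe H y 0 1) x = pderiv μ (fun y => H (uxy y)) x / 2 := by
  have hd : DifferentiableAt ℝ (fun y => H (uxy y)) x :=
    (hH (uxy x)).comp x uxyL.differentiableAt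
  have : (fun y => ppCoframe H y 0 1) = fun y => (1 / 2) * H (uxy y) := by
    funext y; rw [(ppCoframe_apply H y).2.1]; ring
  rw [this, pderiv, fderiv_const_mul hd]
  simp [pderiv]
  ring

theorem pderiv_fun_neg (μ : Fin 4) (f : Pt → ℝ) (x : Pt) :
    pderiv μ (fun y => -f y) x = -pderiv μ f x := by
  simp [pderiv]

/-- The term with H is `dϑ^1 = ½ dH ∧ du`, in which the u-derivative of H is annihilated. The
connection adds only multiples of `ϑ^{0A}` to `T^1`; the terms with `V` multiply `ϑ^0 = du` and die
against du. -/
theorem torsion_wave (hH : Differentiable ℝ H) :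
    torsion (ppCoframe H) (ansatzConn H W V U) x =
      waveTor (W 0 (uxy x) - U 0 (uxy x) - tderiv 0 H (uxy x) / 2)
        (W 1 (uxy x) - U 1 (uxy x) - tderiv 1 H (uxy x) / 2) := by
  funext a b c
  simp only [torsion, toFrame2, frame_ppCoframe]
  revert a b c
  simp only [forall_four, Fin.sum_univ_four, ppFrame_apply, ansatzConn_apply,
    pderiv_ppCoframe hH, pderiv_uxy hH, waveTor_apply, nullForm_apply, Pi.zero_apply]
  simp only [ppCoframe_apply, pderiv_const, vec4_apply]
  constructorm* _ ∧ _ <;> ring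

theorem nonmetricity_wave :
    nonmetricity (ppCoframe H) (ansatzConn H W V U) x =
      waveNm (2 * U 0 (uxy x)) (2 * U 1 (uxy x)) (V 0 (uxy x) + W 0 (uxy x))
        (V 1 (uxy x) + W 1 (uxy x)) := by
  funext a b c
  simp only [nonmetricity, toFrame1, frame_ppCoframe]
  revert a b c
  simp only [forall_four, Fin.sum_univ_four, ppFrame_apply, ansatzConn_apply, metric_apply,
    waveNm_apply, Pi.zero_apply, vec4_apply]
  constructorm* _ ∧ _ <;> ring

/-- The quadratic term of the curvature vanishes: k is null and orthogonal to the transversal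
vectors, and the one remaining contraction, of `W` with `V`, is multiplied by `k ∧ k = 0`. The
curvature is thus linear in the functions of the ansatz. -/
theorem curvature_wave (hW : ∀ A, Differentiable ℝ (W A)) (hV : ∀ A, Differentiable ℝ (V A))
    (hU : ∀ A, Differentiable ℝ (U A)) :
    curvature (ppCoframe H) (ansatzConn H W V U) x =
      waveR (uderiv (U 0) (uxy x)) (uderiv (U 1) (uxy x))
        (tderiv 0 (U 1) (uxy x) - tderiv 1 (U 0) (uxy x))
        (-tderiv 0 (V 0) (uxy x)) (-tderiv 1 (V 0) (uxy x)) (-tderiv 0 (V 1) (uxy x))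
        (-tderiv 1 (V 1) (uxy x))
        (-tderiv 0 (W 0) (uxy x)) (-tderiv 1 (W 0) (uxy x)) (-tderiv 0 (W 1) (uxy x))
        (-tderiv 1 (W 1) (uxy x)) := by
  have e : ∀ a b, ∀ c d, curvatureMixed (ppCoframe H) (ansatzConn H W V U) x a b c d =
      raise1 (waveR (uderiv (U 0) (uxy x)) (uderiv (U 1) (uxy x))
        (tderiv 0 (U 1) (uxy x) - tderiv 1 (U 0) (uxy x))
        (-tderiv 0 (V 0) (uxy x)) (-tderiv 1 (V 0) (uxy x)) (-tderiv 0 (V 1) (uxy x))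
        (-tderiv 1 (V 1) (uxy x))
        (-tderiv 0 (W 0) (uxy x)) (-tderiv 1 (W 0) (uxy x)) (-tderiv 0 (W 1) (uxy x))
        (-tderiv 1 (W 1) (uxy x)) a) b c d := by
    intro a b c d
    simp only [curvatureMixed, toFrame2, frame_ppCoframe]
    revert a b c d
    simp only [forall_four, Fin.sum_univ_four, ppFrame_apply, ansatzConn_apply, raise1_zero,
      raise1_one, raise1_two, raise1_three, waveR, waveTensor_apply, Pi.neg_apply, nullForm_apply,
      Pi.zero_apply, vec4_apply, pderiv_const, pderiv_fun_neg, pderiv_uxy (hW _),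
      pderiv_uxy (hV _), pderiv_uxy (hU _), mul_zero, zero_mul, add_zero, zero_add, mul_one,
      one_mul, sub_zero, zero_sub, neg_zero, and_self, sub_self, neg_neg]
    constructorm* _ ∧ _ <;> first | trivial | ring
  funext a b
  -- The metric matrix is its own inverse, so raising is an involution and the mixed components
  -- determine the lowered ones.
  have hr : ∀ Y : Fin 4 → Form2, raise1 (raise1 Y) = Y := by
    intro Y
    funext b
    revert b
    simp only [forall_four, raise1_zero, raise1_one, raise1_two, raise1_three, neg_neg, and_self]
  rw [curvature, show curvatureMixed (ppCoframe H) (ansatzConn H W V U) x a = raise1 _ from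
    funext fun b => funext fun c => funext fun d => e a b c d, hr]

end

/-! ### First variation of the action at the wave -/

section

variable {H : Fun3} {W V U : Fin 2 → Fun3} {x : Pt} {η : CoframeField} {γ : ConnField}

theorem toFrame2_alt {e : CoframeField} {φ : Fin 4 → Fin 4 → ℝ} (h : ∀ μ ν, φ μ ν = -φ ν μ)
    (a b : Fin 4) : toFrame2 e x φ a b = -toFrame2 e x φ b a := by
  simp only [toFrame2, ← Finset.sum_neg_distrib]
  rw [Finset.sum_comm]
  refine Finset.sum_congr rfl fun μ _ => Finset.sum_congr rfl fun ν _ => ?_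
  rw [h ν μ]
  ring

theorem torsion_alt (e : CoframeField) (Γ : ConnField) (x : Pt) (a b c : Fin 4) :
    torsion e Γ x a b c = -torsion e Γ x a c b := by
  refine toFrame2_alt (fun μ ν => ?_) b c
  simp only [Finset.sum_sub_distrib]
  ring

theorem torsionVar_alt (e η : CoframeField) (Γ γ : ConnField) (x : Pt) (a b c : Fin 4) :
    torsionVar e Γ η γ x a b c = -torsionVar e Γ η γ x a c b := by
  simp only [torsionVar, torsion_alt e Γ x a _ c, torsion_alt e Γ x a _ b]
  rw [toFrame2_alt (fun μ ν => by simp only [Finset.sum_sub_distrib]; ring) b c]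
  simp only [mul_neg, Finset.sum_neg_distrib, torsion_alt e Γ x a c]
  ring

theorem curvatureMixed_alt (e : CoframeField) (Γ : ConnField) (x : Pt) (a b c d : Fin 4) :
    curvatureMixed e Γ x a b c d = -curvatureMixed e Γ x a b d c := by
  refine toFrame2_alt (fun μ ν => ?_) c d
  simp only [Finset.sum_sub_distrib]
  ring

theorem curvatureMixedVar_alt (e η : CoframeField) (Γ γ : ConnField) (x : Pt) (a b c d : Fin 4) :
    curvatureMixedVar e Γ η γ x a b c d = -curvatureMixedVar e Γ η γ x a b d c := by
  simp only [curvatureMixedVar, curvatureMixed_alt e Γ x a b _ c, curvatureMixed_alt e Γ x a b _ d]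
  rw [toFrame2_alt (fun μ ν => by simp only [Finset.sum_sub_distrib]; ring) c d]
  simp only [mul_neg, Finset.sum_neg_distrib, curvatureMixed_alt e Γ x a b d]
  ring

theorem curvatureVar_alt (e η : CoframeField) (Γ γ : ConnField) (x : Pt) (a b c d : Fin 4) :
    curvatureVar e Γ η γ x a b c d = -curvatureVar e Γ η γ x a b d c := by
  simp only [curvatureVar, raise1, Finset.sum_apply, Pi.smul_apply, ← Finset.sum_neg_distrib,
    ← smul_neg, ← curvatureMixedVar_alt]

theorem nonmetricityVar_symm (e η : CoframeField) (Γ γ : ConnField) (x : Pt) (a b : Fin 4) :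
    nonmetricityVar e Γ η γ x a b = nonmetricityVar e Γ η γ x b a := by
  have h : ∀ a b, metric a b = metric b a := by simp [forall_four, metric_apply]
  funext c
  simp only [nonmetricityVar, nonmetricity]
  congr 2
  · funext μ
    refine Finset.sum_congr rfl fun d _ => ?_
    rw [h d b, h a d]
    ring
  · funext d
    congr 2
    funext μ
    refine Finset.sum_congr rfl fun d _ => ?_
    rw [h d b, h a d]
    ring

theorem frameVar_wave (H : Fun3) (η : CoframeField) (x : Pt) :
    (∀ b, frameVar (ppCoframe H) η x 0 b = η x 0 b - H (uxy x) / 2 * η x 1 b) ∧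
    (∀ b, frameVar (ppCoframe H) η x 1 b = η x 1 b) ∧
    (∀ b, frameVar (ppCoframe H) η x 2 b = η x 2 b) ∧
    (∀ b, frameVar (ppCoframe H) η x 3 b = η x 3 b) := by
  simp only [frameVar, frame_ppCoframe, Matrix.mul_apply, Fin.sum_univ_four, ppFrame_apply,
    Matrix.of_apply]
  refine ⟨fun b => ?_, fun b => ?_, fun b => ?_, fun b => ?_⟩ <;> ring

/-- At the components selected by the wave, all contributions of the background connection, of the
background field strengths and of H cancel or vanish. The same is true for the nonmetricity and for
the lowest curvature components below; this makes the field equations linear in the wave. -/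
theorem torsionVar_wave (hH : Differentiable ℝ H) :
    torsionVar (ppCoframe H) (ansatzConn H W V U) η γ x 0 1 2 =
      pderiv 1 (fun y => η y 2 0) x - pderiv 2 (fun y => η y 1 0) x + γ x 1 2 0 - γ x 2 1 0 ∧
    torsionVar (ppCoframe H) (ansatzConn H W V U) η γ x 0 1 3 =
      pderiv 1 (fun y => η y 3 0) x - pderiv 3 (fun y => η y 1 0) x + γ x 1 3 0 - γ x 3 1 0 := by
  simp only [torsionVar, toFrame2, frame_ppCoframe, torsion_wave hH, waveTor_apply,
    Fin.sum_univ_four,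
    ppFrame_apply, ansatzConn_apply, vec4_apply, Pi.zero_apply, ppCoframe_apply]
  constructorm* _ ∧ _ <;> ring

theorem nonmetricityVar_wave :
    nonmetricityVar (ppCoframe H) (ansatzConn H W V U) η γ x 1 1 2 = 2 * γ x 2 1 0 ∧
    nonmetricityVar (ppCoframe H) (ansatzConn H W V U) η γ x 1 1 3 = 2 * γ x 3 1 0 ∧
    nonmetricityVar (ppCoframe H) (ansatzConn H W V U) η γ x 1 2 1 = γ x 1 2 0 - γ x 1 1 2 ∧
    nonmetricityVar (ppCoframe H) (ansatzConn H W V U) η γ x 1 3 1 = γ x 1 3 0 - γ x 1 1 3 := by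
  simp only [nonmetricityVar, toFrame1, frame_ppCoframe, nonmetricity_wave, waveNm_apply,
    Fin.sum_univ_four, ppFrame_apply, metric_apply, Pi.zero_apply]
  constructorm* _ ∧ _ <;> ring

theorem curvatureMixed_eq (e : CoframeField) (Γ : ConnField) (x : Pt) (a : Fin 4) :
    curvatureMixed e Γ x a 0 = curvature e Γ x a 1 ∧
    curvatureMixed e Γ x a 1 = curvature e Γ x a 0 ∧
    curvatureMixed e Γ x a 2 = -curvature e Γ x a 2 ∧
    curvatureMixed e Γ x a 3 = -curvature e Γ x a 3 := by
  simp only [curvature, raise1_zero, raise1_one, raise1_two, raise1_three, neg_neg, and_self]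

/-- The exterior derivative of the variation of the connection, in coordinates. -/
def dConn (γ : ConnField) (x : Pt) (a b μ ν : Fin 4) : ℝ :=
  pderiv μ (fun y => γ y ν a b) x - pderiv ν (fun y => γ y μ a b) x

theorem curvatureVar_wave (hW : ∀ A, Differentiable ℝ (W A)) (hV : ∀ A, Differentiable ℝ (V A))
    (hU : ∀ A, Differentiable ℝ (U A)) {R' : Fin 4 → Fin 4 → Form2}
    (hR' : R' = curvatureVar (ppCoframe H) (ansatzConn H W V U) η γ x) :
    R' 1 1 1 2 = dConn γ x 1 0 1 2 ∧ R' 1 1 1 3 = dConn γ x 1 0 1 3 ∧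
    R' 1 1 2 3 = dConn γ x 1 0 2 3 ∧ R' 1 1 0 1 = dConn γ x 1 0 0 1 ∧
    R' 2 1 1 2 = dConn γ x 2 0 1 2 ∧ R' 2 1 1 3 = dConn γ x 2 0 1 3 ∧
    R' 3 1 1 2 = dConn γ x 3 0 1 2 ∧ R' 3 1 1 3 = dConn γ x 3 0 1 3 ∧
    R' 1 2 1 2 = -dConn γ x 1 2 1 2 ∧ R' 1 2 1 3 = -dConn γ x 1 2 1 3 ∧
    R' 1 3 1 2 = -dConn γ x 1 3 1 2 ∧ R' 1 3 1 3 = -dConn γ x 1 3 1 3 := by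
  subst hR'
  simp only [curvatureVar, raise1_one, raise1_two, raise1_three, Pi.neg_apply, curvatureMixedVar,
    curvatureMixed_eq, curvature_wave hW hV hU, waveR, waveTensor_apply, toFrame2, frame_ppCoframe,
    Fin.sum_univ_four, ppFrame_apply, ansatzConn_apply, vec4_apply, Pi.zero_apply, dConn]
  constructorm* _ ∧ _ <;> ring

/-- The curvature scalar is not a product with a wave factor, so all weights of the curvature
variation contribute. Here background amplitudes appear, linearly, multiplying undifferentiated
variations, while H multiplies derivatives through the dual frame. -/
theorem scal_curvatureVar_wave (hW : ∀ A, Differentiable ℝ (W A))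
    (hV : ∀ A, Differentiable ℝ (V A)) (hU : ∀ A, Differentiable ℝ (U A)) :
    scal (curvatureVar (ppCoframe H) (ansatzConn H W V U) η γ x) =
      (U 0 (uxy x) + W 0 (uxy x)) * γ x 1 1 2 + (U 1 (uxy x) + W 1 (uxy x)) * γ x 1 1 3
      - (V 0 (uxy x) + W 0 (uxy x)) * γ x 2 1 0 - (V 1 (uxy x) + W 1 (uxy x)) * γ x 3 1 0
      - (U 0 (uxy x) + V 0 (uxy x)) * γ x 1 2 0 - (U 1 (uxy x) + V 1 (uxy x)) * γ x 1 3 0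
      + (tderiv 0 (W 0) (uxy x) + tderiv 1 (W 1) (uxy x) - tderiv 0 (V 0) (uxy x)
        - tderiv 1 (V 1) (uxy x)) * η x 1 0
      + dConn γ x 1 1 0 1 + dConn γ x 1 2 0 2 + dConn γ x 1 3 0 3 - dConn γ x 0 0 0 1
      + dConn γ x 0 2 1 2 + dConn γ x 0 3 1 3 + dConn γ x 2 0 0 2 + dConn γ x 2 1 1 2
      + dConn γ x 3 0 0 3 + dConn γ x 3 1 1 3 - dConn γ x 2 3 2 3 + dConn γ x 3 2 2 3
      - H (uxy x) / 2 * (dConn γ x 1 2 1 2 + dConn γ x 1 3 1 3 + dConn γ x 2 0 1 2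
        + dConn γ x 3 0 1 3) := by
  rw [scal_apply (curvatureVar_alt _ _ _ _ _)]
  simp only [curvatureVar, raise1_zero, raise1_one, raise1_two, raise1_three, Pi.neg_apply,
    curvatureMixedVar, curvatureMixed_eq, curvature_wave hW hV hU, waveR, waveTensor_apply,
    toFrame2, frame_ppCoframe, Fin.sum_univ_four, ppFrame_apply, ansatzConn_apply, vec4_apply,
    Pi.zero_apply, nullForm_apply, frameVar_wave, dConn, mul_zero, zero_mul, add_zero, zero_add,
    mul_one, one_mul, sub_zero, zero_sub, neg_zero, sub_self]
  ring

end

/-! ### The field equations of the wave -/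

/-- The coefficient of `δT^0_{1A}` in the first variation. -/
def torCoeff (p : Params) (H : Fun3) (W V U : Fin 2 → Fun3) (A : Fin 2) : Fun3 := fun r =>
  p.a1 * tderiv A H r + (2 * p.c1 - 2 * p.a1) * W A r + (2 * p.a1 - 4 * p.c1) * U A r
    + 2 * p.c1 * V A r

/-- The coefficient of `δQ_{11A}` in the first variation. -/
def nmCoeff (p : Params) (H : Fun3) (W V U : Fin 2 → Fun3) (A : Fin 2) : Fun3 := fun r =>
  (-(4 / 3) * p.b1 - 8 / 3 * p.b2 + 2 * p.c1) * U A r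
    + (-(4 / 3) * p.b1 + 4 / 3 * p.b2 - 2 * p.c1) * W A r
    + (-(4 / 3) * p.b1 + 4 / 3 * p.b2) * V A r + p.c1 * tderiv A H r

/-- The coefficient of `δQ_{1A1}` in the first variation. -/
def nmCoeff' (p : Params) (H : Fun3) (W V U : Fin 2 → Fun3) (A : Fin 2) : Fun3 := fun r =>
  (-(8 / 3) * p.b1 + 8 / 3 * p.b2 - 2 * p.c1) * U A r
    + (-(8 / 3) * p.b1 - 4 / 3 * p.b2 + 2 * p.c1) * W A r
    + (-(8 / 3) * p.b1 - 4 / 3 * p.b2) * V A r - p.c1 * tderiv A H r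

/-- The coefficient of `δR_{11}` along `ϑ^{1A}` in the first variation. -/
def longCoeff (p : Params) (U : Fin 2 → Fun3) (A : Fin 2) : Fun3 := fun r =>
  -2 * p.z1 * uderiv (U A) r

/-- The coefficient of `δR_{11}` along `ϑ^{01}` in the first variation. -/
def divCoeff (p : Params) (W V : Fin 2 → Fun3) : Fun3 := fun r =>
  ((1/2) * p.v4 + (-1/2) * p.z1 + (1/2) * p.z4) * (-tderiv 0 (V 0) r) + ((1/2) * p.v4
    + (-1/2) * p.z1 + (1/2) * p.z4) * (-tderiv 1 (V 1) r) + ((3/2) * p.v4 + (-1/2) * p.z1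
    + (1/2) * p.z4) * (-tderiv 0 (W 0) r) + ((3/2) * p.v4 + (-1/2) * p.z1
    + (1/2) * p.z4) * (-tderiv 1 (W 1) r)

/-- The coefficient of `δR_{11}` along `ϑ^{23}` in the first variation. -/
def curlCoeff (p : Params) (W V U : Fin 2 → Fun3) : Fun3 := fun r =>
  (-p.v2 + p.z1 + p.z2) * (tderiv 0 (U 1) r - tderiv 1 (U 0) r) + ((1/2) * p.z1
    + (-1/2) * p.z2) * (-tderiv 1 (V 0) r) + ((-1/2) * p.z1
    + (1/2) * p.z2) * (-tderiv 0 (V 1) r) + (p.v2 + (1/2) * p.z1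
    + (-1/2) * p.z2) * (-tderiv 1 (W 0) r) + (-p.v2 + (-1/2) * p.z1
    + (1/2) * p.z2) * (-tderiv 0 (W 1) r)

/-- The coefficient of `δR_{A1}` along `ϑ^{1B}` in the first variation. -/
def rightCoeff (p : Params) (W V U : Fin 2 → Fun3) (A B : Fin 2) : Fun3 :=
  ![![fun r => ((1/2) * p.v4 + (-1/2) * p.w1 + (-1/2) * p.w4 + (3/4) * p.z1
      + (1/4) * p.z4) * (-tderiv 0 (V 0) r) + ((1/2) * p.v4 + (1/2) * p.w1 + (-1/2) * p.w4
      + (-1/4) * p.z1 + (1/4) * p.z4) * (-tderiv 1 (V 1) r) + (p.v4 + (1/2) * p.w1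
      + (1/2) * p.w4 + (3/4) * p.z1 + (1/4) * p.z4) * (-tderiv 0 (W 0) r) + (p.v4
      + (-1/2) * p.w1 + (1/2) * p.w4 + (-1/4) * p.z1 + (1/4) * p.z4) * (-tderiv 1 (W 1) r),
    fun r => (p.v2 + (1/2) * p.z1 + (-1/2) * p.z2) * (tderiv 0 (U 1) r - tderiv 1 (U 0) r)
      + ((-1/4) * p.v2 + (-1/2) * p.w1 + (-1/2) * p.w2 + (3/4) * p.z1
      + (1/4) * p.z2) * (-tderiv 1 (V 0) r) + ((1/4) * p.v2 + (-1/2) * p.w1 + (1/2) * p.w2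
      + (1/4) * p.z1 + (-1/4) * p.z2) * (-tderiv 0 (V 1) r) + ((-3/4) * p.v2 + (1/2) * p.w1
      + (1/2) * p.w2 + (3/4) * p.z1 + (1/4) * p.z2) * (-tderiv 1 (W 0) r) + ((3/4) * p.v2
      + (1/2) * p.w1 + (-1/2) * p.w2 + (1/4) * p.z1 + (-1/4) * p.z2) * (-tderiv 0 (W 1) r)],
    ![fun r => (-p.v2 + (-1/2) * p.z1 + (1/2) * p.z2) * (tderiv 0 (U 1) r - tderiv 1 (U 0) r)
      + ((1/4) * p.v2 + (-1/2) * p.w1 + (1/2) * p.w2 + (1/4) * p.z1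
      + (-1/4) * p.z2) * (-tderiv 1 (V 0) r) + ((-1/4) * p.v2 + (-1/2) * p.w1 + (-1/2) * p.w2
      + (3/4) * p.z1 + (1/4) * p.z2) * (-tderiv 0 (V 1) r) + ((3/4) * p.v2 + (1/2) * p.w1
      + (-1/2) * p.w2 + (1/4) * p.z1 + (-1/4) * p.z2) * (-tderiv 1 (W 0) r) + ((-3/4) * p.v2
      + (1/2) * p.w1 + (1/2) * p.w2 + (3/4) * p.z1 + (1/4) * p.z2) * (-tderiv 0 (W 1) r),
    fun r => ((1/2) * p.v4 + (1/2) * p.w1 + (-1/2) * p.w4 + (-1/4) * p.z1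
      + (1/4) * p.z4) * (-tderiv 0 (V 0) r) + ((1/2) * p.v4 + (-1/2) * p.w1 + (-1/2) * p.w4
      + (3/4) * p.z1 + (1/4) * p.z4) * (-tderiv 1 (V 1) r) + (p.v4 + (-1/2) * p.w1
      + (1/2) * p.w4 + (-1/4) * p.z1 + (1/4) * p.z4) * (-tderiv 0 (W 0) r) + (p.v4
      + (1/2) * p.w1 + (1/2) * p.w4 + (3/4) * p.z1 + (1/4) * p.z4) * (-tderiv 1 (W 1) r)]] A B

/-- The coefficient of `δR_{1A}` along `ϑ^{1B}` in the first variation. -/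
def leftCoeff (p : Params) (W V U : Fin 2 → Fun3) (A B : Fin 2) : Fun3 :=
  ![![fun r => ((1/2) * p.w1 + (1/2) * p.w4 + (3/4) * p.z1 + (1/4) * p.z4) * (-tderiv 0 (V 0) r)
      + ((-1/2) * p.w1 + (1/2) * p.w4 + (-1/4) * p.z1 + (1/4) * p.z4) * (-tderiv 1 (V 1) r)
      + ((1/2) * p.v4 + (-1/2) * p.w1 + (-1/2) * p.w4 + (3/4) * p.z1
      + (1/4) * p.z4) * (-tderiv 0 (W 0) r) + ((1/2) * p.v4 + (1/2) * p.w1 + (-1/2) * p.w4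
      + (-1/4) * p.z1 + (1/4) * p.z4) * (-tderiv 1 (W 1) r),
    fun r => ((1/2) * p.z1 + (-1/2) * p.z2) * (tderiv 0 (U 1) r - tderiv 1 (U 0) r) + ((1/4) * p.v2
      + (1/2) * p.w1 + (1/2) * p.w2 + (3/4) * p.z1 + (1/4) * p.z2) * (-tderiv 1 (V 0) r)
      + ((-1/4) * p.v2 + (1/2) * p.w1 + (-1/2) * p.w2 + (1/4) * p.z1
      + (-1/4) * p.z2) * (-tderiv 0 (V 1) r) + ((-1/4) * p.v2 + (-1/2) * p.w1 + (-1/2) * p.w2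
      + (3/4) * p.z1 + (1/4) * p.z2) * (-tderiv 1 (W 0) r) + ((1/4) * p.v2 + (-1/2) * p.w1
      + (1/2) * p.w2 + (1/4) * p.z1 + (-1/4) * p.z2) * (-tderiv 0 (W 1) r)],
    ![fun r => ((-1/2) * p.z1 + (1/2) * p.z2) * (tderiv 0 (U 1) r - tderiv 1 (U 0) r)
      + ((-1/4) * p.v2
      + (1/2) * p.w1 + (-1/2) * p.w2 + (1/4) * p.z1 + (-1/4) * p.z2) * (-tderiv 1 (V 0) r)
      + ((1/4) * p.v2 + (1/2) * p.w1 + (1/2) * p.w2 + (3/4) * p.z1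
      + (1/4) * p.z2) * (-tderiv 0 (V 1) r) + ((1/4) * p.v2 + (-1/2) * p.w1 + (1/2) * p.w2
      + (1/4) * p.z1 + (-1/4) * p.z2) * (-tderiv 1 (W 0) r) + ((-1/4) * p.v2 + (-1/2) * p.w1
      + (-1/2) * p.w2 + (3/4) * p.z1 + (1/4) * p.z2) * (-tderiv 0 (W 1) r),
    fun r => ((-1/2) * p.w1 + (1/2) * p.w4 + (-1/4) * p.z1 + (1/4) * p.z4) * (-tderiv 0 (V 0) r)
      + ((1/2) * p.w1 + (1/2) * p.w4 + (3/4) * p.z1 + (1/4) * p.z4) * (-tderiv 1 (V 1) r)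
      + ((1/2) * p.v4 + (1/2) * p.w1 + (-1/2) * p.w4 + (-1/4) * p.z1
      + (1/4) * p.z4) * (-tderiv 0 (W 0) r) + ((1/2) * p.v4 + (-1/2) * p.w1 + (-1/2) * p.w4
      + (3/4) * p.z1 + (1/4) * p.z4) * (-tderiv 1 (W 1) r)]] A B

/-- The constant `-1/(2κ)`. -/
def weakConst (p : Params) : ℝ := -(1 / (2 * p.κ))

/-- The constant `-1/(2ρ)`. -/
def strongConst (p : Params) : ℝ := -(1 / (2 * p.ρ))

/-- The field equation of `η_{10}`. -/
def eqCoframe (p : Params) (H : Fun3) (W V U : Fin 2 → Fun3) : Fun3 := fun r =>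
  weakConst p * (tderiv 0 (torCoeff p H W V U 0) r + tderiv 1 (torCoeff p H W V U 1) r
    + p.a0 * (tderiv 0 (V 0) r + tderiv 1 (V 1) r - tderiv 0 (W 0) r - tderiv 1 (W 1) r)
    - p.lam * H r)

/-- The field equation of `γ_{11}{}^0`. -/
def eqLong (p : Params) (W V U : Fin 2 → Fun3) : Fun3 := fun r =>
  strongConst p * (tderiv 0 (longCoeff p U 0) r + tderiv 1 (longCoeff p U 1) r
    - uderiv (divCoeff p W V) r)

/-- The field equation of `γ_{A1}{}^0`. -/
def eqCurl (p : Params) (H : Fun3) (W V U : Fin 2 → Fun3) (A : Fin 2) : Fun3 := fun r =>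
  weakConst p * (-torCoeff p H W V U A r + 2 * nmCoeff p H W V U A r + p.a0 * (V A r + W A r))
    + strongConst p * ∑ B, eps2 A B * tderiv B (curlCoeff p W V U) r

/-- The field equation of `γ_{1A}{}^0`. -/
def eqRight (p : Params) (H : Fun3) (W V U : Fin 2 → Fun3) (A : Fin 2) : Fun3 := fun r =>
  weakConst p * (torCoeff p H W V U A r + nmCoeff' p H W V U A r
      + p.a0 * (tderiv A H r / 2 + U A r + V A r))
    + strongConst p * ∑ B, tderiv B (rightCoeff p W V U A B) r

/-- The field equation of `γ_{11}{}^A`. -/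
def eqLeft (p : Params) (H : Fun3) (W V U : Fin 2 → Fun3) (A : Fin 2) : Fun3 := fun r =>
  weakConst p * (-nmCoeff' p H W V U A r + p.a0 * (tderiv A H r / 2 - U A r - W A r))
    - strongConst p * ∑ B, tderiv B (leftCoeff p W V U A B) r

/-- The part of the variational flux that comes from the curvature scalar. -/
def scalFlux (H : Fun3) (γ : ConnField) : Fin 4 → Pt → ℝ :=
  ![fun y => γ y 1 1 1 + γ y 2 1 2 + γ y 3 1 3 - γ y 1 0 0 + γ y 2 2 0 + γ y 3 3 0,
    fun y => γ y 0 0 0 - γ y 0 1 1 + γ y 2 0 2 + γ y 3 0 3 + γ y 2 2 1 + γ y 3 3 1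
      - H (uxy y) * ((1 / 2) * (γ y 2 1 2 + γ y 3 1 3 + γ y 2 2 0 + γ y 3 3 0)),
    fun y => γ y 3 3 2 - γ y 0 1 2 - γ y 1 0 2 - γ y 0 2 0 - γ y 1 2 1 - γ y 3 2 3
      + H (uxy y) * ((1 / 2) * (γ y 1 1 2 + γ y 1 2 0)),
    fun y => γ y 2 2 3 - γ y 0 1 3 - γ y 1 0 3 - γ y 0 3 0 - γ y 1 3 1 - γ y 2 3 2
      + H (uxy y) * ((1 / 2) * (γ y 1 1 3 + γ y 1 3 0))]

/-- The part of the variational flux that comes from the torsion. -/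
def torFlux (p : Params) (H : Fun3) (W V U : Fin 2 → Fun3) (η : CoframeField) : Fin 4 → Pt → ℝ :=
  ![fun _ => 0,
    fun y => torCoeff p H W V U 0 (uxy y) * η y 2 0 + torCoeff p H W V U 1 (uxy y) * η y 3 0,
    fun y => -(torCoeff p H W V U 0 (uxy y) * η y 1 0),
    fun y => -(torCoeff p H W V U 1 (uxy y) * η y 1 0)]

/-- The part of the variational flux that comes from the square of the curvature. -/
def curvFlux (p : Params) (W V U : Fin 2 → Fun3) (γ : ConnField) : Fin 4 → Pt → ℝ :=
  ![fun y => divCoeff p W V (uxy y) * γ y 1 1 0,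
    fun y => longCoeff p U 0 (uxy y) * γ y 2 1 0 + longCoeff p U 1 (uxy y) * γ y 3 1 0
      - divCoeff p W V (uxy y) * γ y 0 1 0
      + rightCoeff p W V U 0 0 (uxy y) * γ y 2 2 0 + rightCoeff p W V U 0 1 (uxy y) * γ y 3 2 0
      + rightCoeff p W V U 1 0 (uxy y) * γ y 2 3 0 + rightCoeff p W V U 1 1 (uxy y) * γ y 3 3 0
      - leftCoeff p W V U 0 0 (uxy y) * γ y 2 1 2 - leftCoeff p W V U 0 1 (uxy y) * γ y 3 1 2
      - leftCoeff p W V U 1 0 (uxy y) * γ y 2 1 3 - leftCoeff p W V U 1 1 (uxy y) * γ y 3 1 3,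
    fun y => curlCoeff p W V U (uxy y) * γ y 3 1 0 - longCoeff p U 0 (uxy y) * γ y 1 1 0
      - rightCoeff p W V U 0 0 (uxy y) * γ y 1 2 0 - rightCoeff p W V U 1 0 (uxy y) * γ y 1 3 0
      + leftCoeff p W V U 0 0 (uxy y) * γ y 1 1 2 + leftCoeff p W V U 1 0 (uxy y) * γ y 1 1 3,
    fun y => -(curlCoeff p W V U (uxy y) * γ y 2 1 0) - longCoeff p U 1 (uxy y) * γ y 1 1 0
      - rightCoeff p W V U 0 1 (uxy y) * γ y 1 2 0 - rightCoeff p W V U 1 1 (uxy y) * γ y 1 3 0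
      + leftCoeff p W V U 0 1 (uxy y) * γ y 1 1 2 + leftCoeff p W V U 1 1 (uxy y) * γ y 1 1 3]

/-- The variational flux. -/
def flux (p : Params) (H : Fun3) (W V U : Fin 2 → Fun3) (η : CoframeField) (γ : ConnField)
    (μ : Fin 4) : Pt → ℝ := fun y =>
  weakConst p * (torFlux p H W V U η μ y - p.a0 * scalFlux H γ μ y)
    + strongConst p * curvFlux p W V U γ μ y

/-- The Euler-Lagrange expression of the wave, contracted with the variation. -/
def eulerLagrange (p : Params) (H : Fun3) (W V U : Fin 2 → Fun3) (η : CoframeField)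
    (γ : ConnField) (x : Pt) : ℝ :=
  weakConst p * (2 * p.lam * (η x 0 0 + η x 1 1 + η x 2 2 + η x 3 3))
    + eqCoframe p H W V U (uxy x) * η x 1 0 + eqLong p W V U (uxy x) * γ x 1 1 0
    + (eqCurl p H W V U 0 (uxy x) * γ x 2 1 0 + eqCurl p H W V U 1 (uxy x) * γ x 3 1 0)
    + (eqRight p H W V U 0 (uxy x) * γ x 1 2 0 + eqRight p H W V U 1 (uxy x) * γ x 1 3 0)
    + (eqLeft p H W V U 0 (uxy x) * γ x 1 1 2 + eqLeft p H W V U 1 (uxy x) * γ x 1 1 3)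

section

variable {p : Params} {H : Fun3} {W V U : Fin 2 → Fun3} {η : CoframeField} {γ : ConnField} {x : Pt}

theorem rightCoeff_apply :
    rightCoeff p W V U 0 0 = (fun r => ((1/2) * p.v4 + (-1/2) * p.w1 + (-1/2) * p.w4 + (3/4) * p.z1
      + (1/4) * p.z4) * (-tderiv 0 (V 0) r) + ((1/2) * p.v4 + (1/2) * p.w1 + (-1/2) * p.w4
      + (-1/4) * p.z1 + (1/4) * p.z4) * (-tderiv 1 (V 1) r) + (p.v4 + (1/2) * p.w1
      + (1/2) * p.w4 + (3/4) * p.z1 + (1/4) * p.z4) * (-tderiv 0 (W 0) r) + (p.v4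
      + (-1/2) * p.w1 + (1/2) * p.w4 + (-1/4) * p.z1 + (1/4) * p.z4) * (-tderiv 1 (W 1) r)) ∧
    rightCoeff p W V U 0 1 = (fun r => (p.v2 + (1/2) * p.z1 + (-1/2) * p.z2) * (tderiv 0 (U 1) r
      - tderiv 1 (U 0) r)
      + ((-1/4) * p.v2 + (-1/2) * p.w1 + (-1/2) * p.w2 + (3/4) * p.z1
      + (1/4) * p.z2) * (-tderiv 1 (V 0) r) + ((1/4) * p.v2 + (-1/2) * p.w1 + (1/2) * p.w2
      + (1/4) * p.z1 + (-1/4) * p.z2) * (-tderiv 0 (V 1) r) + ((-3/4) * p.v2 + (1/2) * p.w1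
      + (1/2) * p.w2 + (3/4) * p.z1 + (1/4) * p.z2) * (-tderiv 1 (W 0) r) + ((3/4) * p.v2
      + (1/2) * p.w1 + (-1/2) * p.w2 + (1/4) * p.z1 + (-1/4) * p.z2) * (-tderiv 0 (W 1) r)) ∧
    rightCoeff p W V U 1 0 = (fun r => (-p.v2 + (-1/2) * p.z1 + (1/2) * p.z2) * (tderiv 0 (U 1) r
      - tderiv 1 (U 0) r)
      + ((1/4) * p.v2 + (-1/2) * p.w1 + (1/2) * p.w2 + (1/4) * p.z1
      + (-1/4) * p.z2) * (-tderiv 1 (V 0) r) + ((-1/4) * p.v2 + (-1/2) * p.w1 + (-1/2) * p.w2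
      + (3/4) * p.z1 + (1/4) * p.z2) * (-tderiv 0 (V 1) r) + ((3/4) * p.v2 + (1/2) * p.w1
      + (-1/2) * p.w2 + (1/4) * p.z1 + (-1/4) * p.z2) * (-tderiv 1 (W 0) r) + ((-3/4) * p.v2
      + (1/2) * p.w1 + (1/2) * p.w2 + (3/4) * p.z1 + (1/4) * p.z2) * (-tderiv 0 (W 1) r)) ∧
    rightCoeff p W V U 1 1 = (fun r => ((1/2) * p.v4 + (1/2) * p.w1 + (-1/2) * p.w4 + (-1/4) * p.z1
      + (1/4) * p.z4) * (-tderiv 0 (V 0) r) + ((1/2) * p.v4 + (-1/2) * p.w1 + (-1/2) * p.w4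
      + (3/4) * p.z1 + (1/4) * p.z4) * (-tderiv 1 (V 1) r) + (p.v4 + (-1/2) * p.w1
      + (1/2) * p.w4 + (-1/4) * p.z1 + (1/4) * p.z4) * (-tderiv 0 (W 0) r) + (p.v4
      + (1/2) * p.w1 + (1/2) * p.w4 + (3/4) * p.z1 + (1/4) * p.z4) * (-tderiv 1 (W 1) r)) :=
  ⟨rfl, rfl, rfl, rfl⟩

theorem leftCoeff_apply :
    leftCoeff p W V U 0 0 = (fun r => ((1/2) * p.w1 + (1/2) * p.w4 + (3/4) * p.z1 + (1/4) * p.z4)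
      * (-tderiv 0 (V 0) r)
      + ((-1/2) * p.w1 + (1/2) * p.w4 + (-1/4) * p.z1 + (1/4) * p.z4) * (-tderiv 1 (V 1) r)
      + ((1/2) * p.v4 + (-1/2) * p.w1 + (-1/2) * p.w4 + (3/4) * p.z1
      + (1/4) * p.z4) * (-tderiv 0 (W 0) r) + ((1/2) * p.v4 + (1/2) * p.w1 + (-1/2) * p.w4
      + (-1/4) * p.z1 + (1/4) * p.z4) * (-tderiv 1 (W 1) r)) ∧
    leftCoeff p W V U 0 1 = (fun r => ((1/2) * p.z1 + (-1/2) * p.z2) * (tderiv 0 (U 1) r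
      - tderiv 1 (U 0) r) + ((1/4) * p.v2
      + (1/2) * p.w1 + (1/2) * p.w2 + (3/4) * p.z1 + (1/4) * p.z2) * (-tderiv 1 (V 0) r)
      + ((-1/4) * p.v2 + (1/2) * p.w1 + (-1/2) * p.w2 + (1/4) * p.z1
      + (-1/4) * p.z2) * (-tderiv 0 (V 1) r) + ((-1/4) * p.v2 + (-1/2) * p.w1 + (-1/2) * p.w2
      + (3/4) * p.z1 + (1/4) * p.z2) * (-tderiv 1 (W 0) r) + ((1/4) * p.v2 + (-1/2) * p.w1
      + (1/2) * p.w2 + (1/4) * p.z1 + (-1/4) * p.z2) * (-tderiv 0 (W 1) r)) ∧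
    leftCoeff p W V U 1 0 = (fun r => ((-1/2) * p.z1 + (1/2) * p.z2) * (tderiv 0 (U 1) r
      - tderiv 1 (U 0) r) + ((-1/4) * p.v2
      + (1/2) * p.w1 + (-1/2) * p.w2 + (1/4) * p.z1 + (-1/4) * p.z2) * (-tderiv 1 (V 0) r)
      + ((1/4) * p.v2 + (1/2) * p.w1 + (1/2) * p.w2 + (3/4) * p.z1
      + (1/4) * p.z2) * (-tderiv 0 (V 1) r) + ((1/4) * p.v2 + (-1/2) * p.w1 + (1/2) * p.w2
      + (1/4) * p.z1 + (-1/4) * p.z2) * (-tderiv 1 (W 0) r) + ((-1/4) * p.v2 + (-1/2) * p.w1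
      + (-1/2) * p.w2 + (3/4) * p.z1 + (1/4) * p.z2) * (-tderiv 0 (W 1) r)) ∧
    leftCoeff p W V U 1 1 = (fun r => ((-1/2) * p.w1 + (1/2) * p.w4 + (-1/4) * p.z1 + (1/4) * p.z4)
      * (-tderiv 0 (V 0) r)
      + ((1/2) * p.w1 + (1/2) * p.w4 + (3/4) * p.z1 + (1/4) * p.z4) * (-tderiv 1 (V 1) r)
      + ((1/2) * p.v4 + (1/2) * p.w1 + (-1/2) * p.w4 + (-1/4) * p.z1
      + (1/4) * p.z4) * (-tderiv 0 (W 0) r) + ((1/2) * p.v4 + (-1/2) * p.w1 + (-1/2) * p.w4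
      + (3/4) * p.z1 + (1/4) * p.z4) * (-tderiv 1 (W 1) r)) :=
  ⟨rfl, rfl, rfl, rfl⟩

/-- The polarizations against a wave involve only components that vanish on every wave. Inserting
the wave in both slots therefore shows that each quadratic invariant vanishes. -/
theorem lag_wave (hH : Differentiable ℝ H) (hW : ∀ A, Differentiable ℝ (W A))
    (hV : ∀ A, Differentiable ℝ (V A)) (hU : ∀ A, Differentiable ℝ (U A)) :
    lagWeak p (torsion (ppCoframe H) (ansatzConn H W V U) x)
        (nonmetricity (ppCoframe H) (ansatzConn H W V U) x)
        (curvature (ppCoframe H) (ansatzConn H W V U) x)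
      + lagStrong p (curvature (ppCoframe H) (ansatzConn H W V U) x)
      = weakConst p * (2 * p.lam) := by
  have tT : ∀ a b c, waveTor (W 0 (uxy x) - U 0 (uxy x) - tderiv 0 H (uxy x) / 2)
      (W 1 (uxy x) - U 1 (uxy x) - tderiv 1 H (uxy x) / 2) a b c =
      -waveTor (W 0 (uxy x) - U 0 (uxy x) - tderiv 0 H (uxy x) / 2)
      (W 1 (uxy x) - U 1 (uxy x) - tderiv 1 H (uxy x) / 2) a c b := by
    rw [← torsion_wave (V := V) hH]; exact torsion_alt _ _ _
  have tR : ∀ a b c d, curvature (ppCoframe H) (ansatzConn H W V U) x a b c d =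
      -curvature (ppCoframe H) (ansatzConn H W V U) x a b d c := by
    intro a b c d
    simp only [curvature, raise1, Finset.sum_apply, Pi.smul_apply, ← Finset.sum_neg_distrib,
      ← smul_neg, ← curvatureMixed_alt]
  have tQ : ∀ a b, nonmetricity (ppCoframe H) (ansatzConn H W V U) x a b =
      nonmetricity (ppCoframe H) (ansatzConn H W V U) x b a := by
    rw [nonmetricity_wave]
    simp only [forall_four, waveNm_apply, and_self]
  have h1 := torPolar_waveTor (W 0 (uxy x) - U 0 (uxy x) - tderiv 0 H (uxy x) / 2)
    (W 1 (uxy x) - U 1 (uxy x) - tderiv 1 H (uxy x) / 2) p tT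
  have h2 := nmPolar_waveNm (2 * U 0 (uxy x)) (2 * U 1 (uxy x)) (V 0 (uxy x) + W 0 (uxy x))
    (V 1 (uxy x) + W 1 (uxy x)) p tQ
  have h3 := nmCrossPolar_waveNm (2 * U 0 (uxy x)) (2 * U 1 (uxy x)) (V 0 (uxy x) + W 0 (uxy x))
    (V 1 (uxy x) + W 1 (uxy x)) (nonmetricity (ppCoframe H) (ansatzConn H W V U) x)
  have h4 := nmTorPolar_wave (2 * U 0 (uxy x)) (2 * U 1 (uxy x)) (V 0 (uxy x) + W 0 (uxy x))
    (V 1 (uxy x) + W 1 (uxy x)) p (W 0 (uxy x) - U 0 (uxy x) - tderiv 0 H (uxy x) / 2)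
      (W 1 (uxy x) - U 1 (uxy x) - tderiv 1 H (uxy x) / 2)
      (Q := nonmetricity (ppCoframe H) (ansatzConn H W V U) x) tT
  have h5 := scal_apply tR
  have h6 := curvPolar_waveR (uderiv (U 0) (uxy x)) (uderiv (U 1) (uxy x))
        (tderiv 0 (U 1) (uxy x) - tderiv 1 (U 0) (uxy x))
        (-tderiv 0 (V 0) (uxy x)) (-tderiv 1 (V 0) (uxy x)) (-tderiv 0 (V 1) (uxy x))
        (-tderiv 1 (V 1) (uxy x))
        (-tderiv 0 (W 0) (uxy x)) (-tderiv 1 (W 0) (uxy x)) (-tderiv 0 (W 1) (uxy x))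
        (-tderiv 1 (W 1) (uxy x)) p tR
  rw [nonmetricity_wave] at h2 h3 h4
  rw [curvature_wave hW hV hU] at h5 h6
  simp only [waveTor_apply, waveNm_apply, waveR, waveTensor_apply, nullForm_apply, Pi.zero_apply,
    mul_zero, zero_mul, add_zero, sub_self, neg_zero] at h1 h2 h4 h5 h6
  simp only [torPolar, nmPolar, nmCrossPolar, nmTorPolar, curvPolar, Finset.sum_add_distrib]
    at h1 h2 h3 h4 h6
  rw [lagWeak_eq, lagStrong_eq, torsion_wave hH, nonmetricity_wave, curvature_wave hW hV hU,
    waveR, h5]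
  -- At equal arguments a polarization is the quadratic form added to itself.
  have e1 := add_self_eq_zero.1 h1
  have e2 := add_self_eq_zero.1 h2
  have e3 := add_self_eq_zero.1 h3
  have e4 := add_self_eq_zero.1 h4
  have e6 := add_self_eq_zero.1 h6
  rw [e1, e2, e3, e4, e6, weakConst]
  ring

theorem deriv_lagDensity_wave (hH : Differentiable ℝ H) (hW : ∀ A, Differentiable ℝ (W A))
    (hV : ∀ A, Differentiable ℝ (V A)) (hU : ∀ A, Differentiable ℝ (U A))
    (hη : DifferentiableAt ℝ η x) (hγ : DifferentiableAt ℝ γ x)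
    (he : DifferentiableAt ℝ (ppCoframe H) x) (hΓ : DifferentiableAt ℝ (ansatzConn H W V U) x) :
    deriv (fun t : ℝ => lagDensity p (fun y => ppCoframe H y + t • η y)
      (fun y => ansatzConn H W V U y + t • γ y) x) 0 =
    weakConst p * (2 * p.lam * (η x 0 0 - H (uxy x) / 2 * η x 1 0 + η x 1 1 + η x 2 2 + η x 3 3)
      - p.a0 * scal (curvatureVar (ppCoframe H) (ansatzConn H W V U) η γ x)
      + torCoeff p H W V U 0 (uxy x) * (pderiv 1 (fun y => η y 2 0) x
        - pderiv 2 (fun y => η y 1 0) x + γ x 1 2 0 - γ x 2 1 0)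
      + torCoeff p H W V U 1 (uxy x) * (pderiv 1 (fun y => η y 3 0) x
        - pderiv 3 (fun y => η y 1 0) x + γ x 1 3 0 - γ x 3 1 0)
      + nmCoeff p H W V U 0 (uxy x) * (2 * γ x 2 1 0)
      + nmCoeff p H W V U 1 (uxy x) * (2 * γ x 3 1 0)
      + nmCoeff' p H W V U 0 (uxy x) * (γ x 1 2 0 - γ x 1 1 2)
      + nmCoeff' p H W V U 1 (uxy x) * (γ x 1 3 0 - γ x 1 1 3))
    + strongConst p * (longCoeff p U 0 (uxy x) * dConn γ x 1 0 1 2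
      + longCoeff p U 1 (uxy x) * dConn γ x 1 0 1 3
      + divCoeff p W V (uxy x) * dConn γ x 1 0 0 1
      + curlCoeff p W V U (uxy x) * dConn γ x 1 0 2 3
      + rightCoeff p W V U 0 0 (uxy x) * dConn γ x 2 0 1 2
      + rightCoeff p W V U 0 1 (uxy x) * dConn γ x 2 0 1 3
      + rightCoeff p W V U 1 0 (uxy x) * dConn γ x 3 0 1 2
      + rightCoeff p W V U 1 1 (uxy x) * dConn γ x 3 0 1 3
      - leftCoeff p W V U 0 0 (uxy x) * dConn γ x 1 2 1 2
      - leftCoeff p W V U 0 1 (uxy x) * dConn γ x 1 2 1 3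
      - leftCoeff p W V U 1 0 (uxy x) * dConn γ x 1 3 1 2
      - leftCoeff p W V U 1 1 (uxy x) * dConn γ x 1 3 1 3) := by
  have hu : IsUnit (Matrix.of (ppCoframe H x)).det := by rw [det_ppCoframe]; exact isUnit_one
  rw [(hasDerivAt_lagDensity p hu he hΓ hη hγ).deriv, det_ppCoframe, lag_wave hH hW hV hU,
    lagWeakDeriv, lagStrongDeriv]
  have hT := torsionVar_wave (W := W) (V := V) (U := U) (η := η) (γ := γ) (x := x) hH
  have hQ := nonmetricityVar_wave (H := H) (W := W) (V := V) (U := U) (η := η) (γ := γ) (x := x)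
  have hR := curvatureVar_wave (H := H) (η := η) (γ := γ) (x := x) hW hV hU rfl
  have tT := torsionVar_alt (ppCoframe H) η (ansatzConn H W V U) γ x
  have tQ := nonmetricityVar_symm (ppCoframe H) η (ansatzConn H W V U) γ x
  have tR := curvatureVar_alt (ppCoframe H) η (ansatzConn H W V U) γ x
  rw [torsion_wave hH, nonmetricity_wave, curvature_wave hW hV hU, torPolar_waveTor _ _ p tT,
    nmPolar_waveNm _ _ _ _ p tQ, nmCrossPolar_waveNm, nmTorPolar_wave _ _ _ _ p _ _ tT,
    curvPolar_waveR _ _ _ _ _ _ _ _ _ _ _ p tR]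
  simp only [hT, hQ, hR, Matrix.trace, Matrix.diag_apply, Fin.sum_univ_four, frameVar_wave]
  simp only [torCoeff, nmCoeff, nmCoeff', longCoeff, divCoeff, curlCoeff, rightCoeff_apply,
    leftCoeff_apply, weakConst, strongConst]
  ring

end

/-! ### The first variation as Euler-Lagrange expression plus divergence -/

/-- `f` is differentiable at `x` with partial derivative `f'` in the direction `μ`. -/
def HasPderivAt (μ : Fin 4) (f : Pt → ℝ) (f' : ℝ) (x : Pt) : Prop :=
  DifferentiableAt ℝ f x ∧ pderiv μ f x = f'

section

variable {μ : Fin 4} {f g : Pt → ℝ} {f' g' : ℝ} {x : Pt}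

theorem HasPderivAt.add (hf : HasPderivAt μ f f' x) (hg : HasPderivAt μ g g' x) :
    HasPderivAt μ (fun y => f y + g y) (f' + g') x := by
  refine ⟨hf.1.add hg.1, ?_⟩
  rw [← hf.2, ← hg.2, pderiv, fderiv_fun_add hf.1 hg.1]
  rfl

theorem HasPderivAt.sub (hf : HasPderivAt μ f f' x) (hg : HasPderivAt μ g g' x) :
    HasPderivAt μ (fun y => f y - g y) (f' - g') x := by
  refine ⟨hf.1.sub hg.1, ?_⟩
  rw [← hf.2, ← hg.2, pderiv, fderiv_fun_sub hf.1 hg.1]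
  rfl

theorem HasPderivAt.neg (hf : HasPderivAt μ f f' x) :
    HasPderivAt μ (fun y => -f y) (-f') x := by
  refine ⟨hf.1.neg, ?_⟩
  rw [← hf.2, pderiv, fderiv_fun_neg]
  rfl

theorem HasPderivAt.mul (hf : HasPderivAt μ f f' x) (hg : HasPderivAt μ g g' x) :
    HasPderivAt μ (fun y => f y * g y) (f' * g x + f x * g') x := by
  refine ⟨hf.1.mul hg.1, ?_⟩
  rw [← hf.2, ← hg.2, pderiv, fderiv_fun_mul hf.1 hg.1]
  simp [pderiv]
  ring

theorem HasPderivAt.const_mul (c : ℝ) (hf : HasPderivAt μ f f' x) :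
    HasPderivAt μ (fun y => c * f y) (c * f') x := by
  refine ⟨hf.1.const_mul c, ?_⟩
  rw [← hf.2, pderiv, fderiv_const_mul hf.1]
  rfl

end

section

variable {p : Params} {H : Fun3} {W V U : Fin 2 → Fun3} {η : CoframeField} {γ : ConnField} {x : Pt}

/-! ### Smoothness of the coefficients of the first variation -/

theorem contDiff_tderiv {F : Fun3} (hF : ContDiff ℝ ∞ F) (A : Fin 2) : ContDiff ℝ ∞ (tderiv A F) :=
  (hF.fderiv_right (m := ∞) (by simp)).clm_apply contDiff_const

theorem contDiff_uderiv {F : Fun3} (hF : ContDiff ℝ ∞ F) : ContDiff ℝ ∞ (uderiv F) :=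
  (hF.fderiv_right (m := ∞) (by simp)).clm_apply contDiff_const

theorem contDiff_torCoeff (hH : ContDiff ℝ ∞ H) (hW : ∀ A, ContDiff ℝ ∞ (W A))
    (hV : ∀ A, ContDiff ℝ ∞ (V A)) (hU : ∀ A, ContDiff ℝ ∞ (U A)) (A : Fin 2) :
    ContDiff ℝ ∞ (torCoeff p H W V U A) := by
  unfold torCoeff
  repeat' first
    | exact contDiff_const
    | exact contDiff_tderiv hH A
    | exact hW A
    | exact hV A
    | exact hU A
    | apply ContDiff.add
    | apply ContDiff.sub
    | apply ContDiff.mul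

theorem contDiff_longCoeff (hU : ∀ A, ContDiff ℝ ∞ (U A)) (A : Fin 2) :
    ContDiff ℝ ∞ (longCoeff p U A) := by
  exact contDiff_const.mul (contDiff_uderiv (hU A))

theorem contDiff_divCoeff (hW : ∀ A, ContDiff ℝ ∞ (W A)) (hV : ∀ A, ContDiff ℝ ∞ (V A)) :
    ContDiff ℝ ∞ (divCoeff p W V) := by
  have h1 := fun A B => contDiff_tderiv (hW A) B
  have h2 := fun A B => contDiff_tderiv (hV A) B
  unfold divCoeff
  repeat' first
    | exact contDiff_const
    | exact h1 _ _
    | exact h2 _ _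
    | apply ContDiff.add
    | apply ContDiff.sub
    | apply ContDiff.mul
    | apply ContDiff.neg

theorem contDiff_curlCoeff (hW : ∀ A, ContDiff ℝ ∞ (W A)) (hV : ∀ A, ContDiff ℝ ∞ (V A))
    (hU : ∀ A, ContDiff ℝ ∞ (U A)) : ContDiff ℝ ∞ (curlCoeff p W V U) := by
  have h1 := fun A B => contDiff_tderiv (hW A) B
  have h2 := fun A B => contDiff_tderiv (hV A) B
  have h3 := fun A B => contDiff_tderiv (hU A) B
  unfold curlCoeff
  repeat' first
    | exact contDiff_const
    | exact h1 _ _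
    | exact h2 _ _
    | exact h3 _ _
    | apply ContDiff.add
    | apply ContDiff.sub
    | apply ContDiff.mul
    | apply ContDiff.neg

theorem contDiff_rightCoeff (hW : ∀ A, ContDiff ℝ ∞ (W A)) (hV : ∀ A, ContDiff ℝ ∞ (V A))
    (hU : ∀ A, ContDiff ℝ ∞ (U A)) (A B : Fin 2) : ContDiff ℝ ∞ (rightCoeff p W V U A B) := by
  have h1 := fun A B => contDiff_tderiv (hW A) B
  have h2 := fun A B => contDiff_tderiv (hV A) B
  have h3 := fun A B => contDiff_tderiv (hU A) B
  fin_cases A <;> fin_cases B <;>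
    simp only [Fin.zero_eta, Fin.mk_one, Fin.isValue, rightCoeff_apply]
  all_goals repeat' first
      | exact contDiff_const
      | exact h1 _ _
      | exact h2 _ _
      | exact h3 _ _
      | apply ContDiff.add
      | apply ContDiff.sub
      | apply ContDiff.mul
      | apply ContDiff.neg

theorem contDiff_leftCoeff (hW : ∀ A, ContDiff ℝ ∞ (W A)) (hV : ∀ A, ContDiff ℝ ∞ (V A))
    (hU : ∀ A, ContDiff ℝ ∞ (U A)) (A B : Fin 2) : ContDiff ℝ ∞ (leftCoeff p W V U A B) := by
  have h1 := fun A B => contDiff_tderiv (hW A) B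
  have h2 := fun A B => contDiff_tderiv (hV A) B
  have h3 := fun A B => contDiff_tderiv (hU A) B
  fin_cases A <;> fin_cases B <;>
    simp only [Fin.zero_eta, Fin.mk_one, Fin.isValue, leftCoeff_apply]
  all_goals repeat' first
      | exact contDiff_const
      | exact h1 _ _
      | exact h2 _ _
      | exact h3 _ _
      | apply ContDiff.add
      | apply ContDiff.sub
      | apply ContDiff.mul
      | apply ContDiff.neg

theorem hasPderivAt_uxy {F : Fun3} (hF : ContDiff ℝ ∞ F) (μ : Fin 4) (x : Pt) :
    HasPderivAt μ (fun y => F (uxy y)) (pderiv μ (fun y => F (uxy y)) x) x :=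
  ⟨((hF.differentiable (by simp)) (uxy x)).comp x uxyL.differentiableAt, rfl⟩

theorem hasPderivAt_coframe (hη : ContDiff ℝ ∞ η) (μ ν a : Fin 4) (x : Pt) :
    HasPderivAt μ (fun y => η y ν a) (pderiv μ (fun y => η y ν a) x) x :=
  ⟨differentiableAt_pi.1 (differentiableAt_pi.1 (hη.differentiable (by simp) x) ν) a, rfl⟩

theorem hasPderivAt_conn (hγ : ContDiff ℝ ∞ γ) (μ ν a b : Fin 4) (x : Pt) :
    HasPderivAt μ (fun y => γ y ν a b) (pderiv μ (fun y => γ y ν a b) x) x :=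
  ⟨differentiableAt_pi.1 (differentiableAt_pi.1 (differentiableAt_pi.1
    (hγ.differentiable (by simp) x) ν) a) b, rfl⟩

theorem contDiff_ppCoframe (hH : ContDiff ℝ ∞ H) : ContDiff ℝ ∞ (ppCoframe H) := by
  have h : ContDiff ℝ ∞ (fun y => H (uxy y)) := hH.comp contDiff_uxy
  refine contDiff_pi.2 fun μ => contDiff_pi.2 fun a => ?_
  revert μ a
  simp only [forall_four, ppCoframe_apply, contDiff_const, h.div_const, and_self]

theorem contDiff_ansatzConn (hW : ∀ A, ContDiff ℝ ∞ (W A))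
    (hV : ∀ A, ContDiff ℝ ∞ (V A)) (hU : ∀ A, ContDiff ℝ ∞ (U A)) :
    ContDiff ℝ ∞ (ansatzConn H W V U) := by
  have h1 : ∀ A, ContDiff ℝ ∞ (fun y => W A (uxy y)) := fun A => (hW A).comp contDiff_uxy
  have h2 : ∀ A, ContDiff ℝ ∞ (fun y => -V A (uxy y)) := fun A => ((hV A).comp contDiff_uxy).neg
  have h3 : ∀ A, ContDiff ℝ ∞ (fun y => U A (uxy y)) := fun A => (hU A).comp contDiff_uxy
  refine contDiff_pi.2 fun μ => contDiff_pi.2 fun a => contDiff_pi.2 fun b => ?_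
  revert μ a b
  simp only [forall_four, ansatzConn_apply, vec4_apply, Pi.zero_apply, contDiff_const, h1, h2, h3,
    and_self]

end

section

variable {p : Params} {H : Fun3} {W V U : Fin 2 → Fun3} {η : CoframeField} {γ : ConnField} {x : Pt}

-- Integration by parts in pointwise form. The flux collects each coefficient times the
-- undifferentiated variation, so the product rule returns the terms with differentiated variations
-- together with derivatives of the coefficients; the latter, with opposite sign, make up the
-- Euler-Lagrange expression.
set_option maxHeartbeats 1000000 in
theorem deriv_lagDensity_eq (hH : ContDiff ℝ ∞ H) (hW : ∀ A, ContDiff ℝ ∞ (W A))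
    (hV : ∀ A, ContDiff ℝ ∞ (V A)) (hU : ∀ A, ContDiff ℝ ∞ (U A)) (hη : ContDiff ℝ ∞ η)
    (hγ : ContDiff ℝ ∞ γ) (x : Pt) :
    deriv (fun t : ℝ => lagDensity p (fun y => ppCoframe H y + t • η y)
      (fun y => ansatzConn H W V U y + t • γ y) x) 0 =
    eulerLagrange p H W V U η γ x + ∑ μ, pderiv μ (flux p H W V U η γ μ) x := by
  have hg := fun μ ν a b => hasPderivAt_conn hγ μ ν a b x
  have he := fun μ ν a => hasPderivAt_coframe hη μ ν a x
  have hc : ∀ {F : Fun3}, ContDiff ℝ ∞ F → ∀ μ, HasPderivAt μ (fun y => F (uxy y))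
      (pderiv μ (fun y => F (uxy y)) x) x := fun hF μ => hasPderivAt_uxy hF μ x
  have h0 : ∀ μ, HasPderivAt μ (fun _ => (0 : ℝ)) 0 x := fun μ =>
    ⟨differentiableAt_const _, pderiv_const _ _ _⟩
  have htc := contDiff_torCoeff (p := p) hH hW hV hU
  have hdc := contDiff_divCoeff (p := p) hW hV
  have hlc := contDiff_longCoeff (p := p) hU
  have hcc := contDiff_curlCoeff (p := p) hW hV hU
  have hrc := contDiff_rightCoeff (p := p) hW hV hU
  have hfc := contDiff_leftCoeff (p := p) hW hV hU
  have d : ∀ {F : Fun3}, ContDiff ℝ ∞ F → Differentiable ℝ F := fun hF =>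
    hF.differentiable (by simp)
  -- The term mirrors the shape of the flux, and unification fills in its derivative, so that the
  -- final identity is purely algebraic.
  have f0 : HasPderivAt 0 (flux p H W V U η γ 0) _ x :=
    (((h0 0).sub (HasPderivAt.const_mul p.a0 ((((((hg 0 1 1 1).add (hg 0 2 1 2)).add (hg 0 3 1
      3)).sub (hg 0 1 0 0)).add (hg 0 2 2 0)).add (hg 0 3 3 0)))).const_mul (weakConst p)).add
      (HasPderivAt.const_mul (strongConst p) ((hc hdc 0).mul (hg 0 1 1 0)))
  have f1 : HasPderivAt 1 (flux p H W V U η γ 1) _ x :=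
    ((((((hc (htc 0) 1).mul (he 1 2 0)).add ((hc (htc 1) 1).mul (he 1 3 0)))).sub
      (HasPderivAt.const_mul p.a0 (((((((hg 1 0 0 0).sub (hg 1 0 1 1)).add (hg 1 2 0 2)).add (hg 1
      3 0 3)).add (hg 1 2 2 1)).add (hg 1 3 3 1)).sub ((hc hH 1).mul (HasPderivAt.const_mul (1 /
      2) ((((hg 1 2 1 2).add (hg 1 3 1 3)).add (hg 1 2 2 0)).add (hg 1 3 3 0))))))).const_mul
      (weakConst p)).add (HasPderivAt.const_mul (strongConst p) ((((((((((((hc (hlc 0) 1).mul (hg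
      1 2 1 0)).add ((hc (hlc 1) 1).mul (hg 1 3 1 0))).sub ((hc hdc 1).mul (hg 1 0 1 0))).add ((hc
      (hrc 0 0) 1).mul (hg 1 2 2 0))).add ((hc (hrc 0 1) 1).mul (hg 1 3 2 0))).add ((hc (hrc 1 0)
      1).mul (hg 1 2 3 0))).add ((hc (hrc 1 1) 1).mul (hg 1 3 3 0))).sub ((hc (hfc 0 0) 1).mul (hg
      1 2 1 2))).sub ((hc (hfc 0 1) 1).mul (hg 1 3 1 2))).sub ((hc (hfc 1 0) 1).mul (hg 1 2 1
      3))).sub ((hc (hfc 1 1) 1).mul (hg 1 3 1 3))))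
  have f2 : HasPderivAt 2 (flux p H W V U η γ 2) _ x :=
    (((((hc (htc 0) 2).mul (he 2 1 0)).neg).sub (HasPderivAt.const_mul p.a0 (((((((hg 2 3 3
      2).sub (hg 2 0 1 2)).sub (hg 2 1 0 2)).sub (hg 2 0 2 0)).sub (hg 2 1 2 1)).sub (hg 2 3 2
      3)).add ((hc hH 2).mul (HasPderivAt.const_mul (1 / 2) ((hg 2 1 1 2).add (hg 2 1 2
      0))))))).const_mul (weakConst p)).add (HasPderivAt.const_mul (strongConst p) (((((((hc hcc
      2).mul (hg 2 3 1 0)).sub ((hc (hlc 0) 2).mul (hg 2 1 1 0))).sub ((hc (hrc 0 0) 2).mul (hg 2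
      1 2 0))).sub ((hc (hrc 1 0) 2).mul (hg 2 1 3 0))).add ((hc (hfc 0 0) 2).mul (hg 2 1 1
      2))).add ((hc (hfc 1 0) 2).mul (hg 2 1 1 3))))
  have f3 : HasPderivAt 3 (flux p H W V U η γ 3) _ x :=
    (((((hc (htc 1) 3).mul (he 3 1 0)).neg).sub (HasPderivAt.const_mul p.a0 (((((((hg 3 2 2
      3).sub (hg 3 0 1 3)).sub (hg 3 1 0 3)).sub (hg 3 0 3 0)).sub (hg 3 1 3 1)).sub (hg 3 2 3
      2)).add ((hc hH 3).mul (HasPderivAt.const_mul (1 / 2) ((hg 3 1 1 3).add (hg 3 1 3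
      0))))))).const_mul (weakConst p)).add (HasPderivAt.const_mul (strongConst p) (((((((hc hcc
      3).mul (hg 3 2 1 0)).neg.sub ((hc (hlc 1) 3).mul (hg 3 1 1 0))).sub ((hc (hrc 0 1) 3).mul
      (hg 3 1 2 0))).sub ((hc (hrc 1 1) 3).mul (hg 3 1 3 0))).add ((hc (hfc 0 1) 3).mul (hg 3 1 1
      2))).add ((hc (hfc 1 1) 3).mul (hg 3 1 1 3))))
  rw [Fin.sum_univ_four, f0.2, f1.2, f2.2, f3.2, deriv_lagDensity_wave (d hH) (fun A => d (hW A))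
    (fun A => d (hV A)) (fun A => d (hU A)) (hη.differentiable (by simp) x)
    (hγ.differentiable (by simp) x) ((contDiff_ppCoframe hH).differentiable (by simp) x)
    ((contDiff_ansatzConn hW hV hU).differentiable (by simp) x),
    scal_curvatureVar_wave (fun A => d (hW A)) (fun A => d (hV A)) (fun A => d (hU A))]
  simp only [pderiv_uxy (d hH), pderiv_uxy (d (htc _)), pderiv_uxy (d hdc), pderiv_uxy (d (hlc _)),
    pderiv_uxy (d hcc), pderiv_uxy (d (hrc _ _)), pderiv_uxy (d (hfc _ _)), dConn, eulerLagrange,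
    eqCoframe, eqLong, eqCurl, eqRight, eqLeft, Fin.sum_univ_two, eps2, Matrix.of_apply,
    Matrix.cons_val]
  ring

theorem contDiff_flux (hH : ContDiff ℝ ∞ H) (hW : ∀ A, ContDiff ℝ ∞ (W A))
    (hV : ∀ A, ContDiff ℝ ∞ (V A)) (hU : ∀ A, ContDiff ℝ ∞ (U A)) (hη : ContDiff ℝ ∞ η)
    (hγ : ContDiff ℝ ∞ γ) (μ : Fin 4) : ContDiff ℝ ∞ (flux p H W V U η γ μ) := by
  have hg : ∀ ν a b, ContDiff ℝ ∞ (fun y => γ y ν a b) := fun ν a b =>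
    contDiff_pi.1 (contDiff_pi.1 (contDiff_pi.1 hγ ν) a) b
  have he : ∀ ν a, ContDiff ℝ ∞ (fun y => η y ν a) := fun ν a =>
    contDiff_pi.1 (contDiff_pi.1 hη ν) a
  have hc : ∀ {F : Fun3}, ContDiff ℝ ∞ F → ContDiff ℝ ∞ (fun y => F (uxy y)) :=
    fun hF => hF.comp contDiff_uxy
  have htc := fun A => hc (contDiff_torCoeff (p := p) hH hW hV hU A)
  have hdc := hc (contDiff_divCoeff (p := p) hW hV)
  have hlc := fun A => hc (contDiff_longCoeff (p := p) hU A)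
  have hcc := hc (contDiff_curlCoeff (p := p) hW hV hU)
  have hrc := fun A B => hc (contDiff_rightCoeff (p := p) hW hV hU A B)
  have hfc := fun A B => hc (contDiff_leftCoeff (p := p) hW hV hU A B)
  have hH' := hc hH
  have h1 : ∀ μ, ContDiff ℝ ∞ (torFlux p H W V U η μ) := by
    simp only [forall_four]
    refine ⟨contDiff_const, ((htc 0).mul (he 2 0)).add ((htc 1).mul (he 3 0)),
      ((htc 0).mul (he 1 0)).neg, ((htc 1).mul (he 1 0)).neg⟩
  have h2 : ∀ μ, ContDiff ℝ ∞ (scalFlux H γ μ) := by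
    simp only [forall_four, scalFlux, Matrix.cons_val]
    refine ⟨?_, ?_, ?_, ?_⟩
    all_goals repeat' first
      | exact contDiff_const
      | exact hH'
      | exact hg _ _ _
      | apply ContDiff.sub
      | apply ContDiff.add
      | apply ContDiff.mul
  have h3 : ∀ μ, ContDiff ℝ ∞ (curvFlux p W V U γ μ) := by
    simp only [forall_four, curvFlux, Matrix.cons_val]
    refine ⟨?_, ?_, ?_, ?_⟩
    all_goals repeat' first
      | exact hdc
      | exact hcc
      | exact hlc _
      | exact hrc _ _
      | exact hfc _ _
      | exact hg _ _ _
      | apply ContDiff.sub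
      | apply ContDiff.add
      | apply ContDiff.mul
      | apply ContDiff.neg
  exact (contDiff_const.mul ((h1 μ).sub (contDiff_const.mul (h2 μ)))).add (contDiff_const.mul (h3 μ))

/-- Every term of the flux carries a component of one of the variations as a factor. -/
theorem hasCompactSupport_flux (hη : HasCompactSupport η) (hγ : HasCompactSupport γ) (μ : Fin 4) :
    HasCompactSupport (flux p H W V U η γ μ) := by
  refine HasCompactSupport.intro (K := tsupport η ∪ tsupport γ)
    (hη.isCompact.union hγ.isCompact) fun y hy => ?_
  have h1 : η y = 0 := image_eq_zero_of_notMem_tsupport fun h => hy (Or.inl h)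
  have h2 : γ y = 0 := image_eq_zero_of_notMem_tsupport fun h => hy (Or.inr h)
  revert μ
  simp [forall_four, flux, torFlux, scalFlux, curvFlux, h1, h2]

open MeasureTheory in
theorem integral_pderiv_eq_zero {f : Pt → ℝ} (hf : ContDiff ℝ ∞ f) (hs : HasCompactSupport f)
    (μ : Fin 4) : ∫ x, pderiv μ f x = 0 := by
  have hc : Continuous (fun x => fderiv ℝ f x (Pi.single μ 1)) :=
    (hf.continuous_fderiv (by simp)).clm_apply continuous_const
  have hi : Integrable (fun x => fderiv ℝ f x (Pi.single μ 1)) :=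
    hc.integrable_of_hasCompactSupport (hs.fderiv_apply ℝ _)
  have hi' : Integrable f := hf.continuous.integrable_of_hasCompactSupport hs
  -- Integration by parts against the constant function 1, whose derivative is zero.
  have := integral_mul_fderiv_eq_neg_fderiv_mul_of_integrable (𝕜 := ℝ) (μ := volume)
    (f := fun _ : Pt => (1 : ℝ)) (g := f) (v := Pi.single μ 1) (by simp) (by simpa using hi)
    (by simpa using hi') (fun x _ => differentiableAt_const _)
    (fun x _ => hf.differentiable (by simp) x)
  simpa [pderiv] using this

/-! ### Smoothness of the field equations and the integrated first variation -/

theorem contDiff_eqCoframe (hH : ContDiff ℝ ∞ H) (hW : ∀ A, ContDiff ℝ ∞ (W A))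
    (hV : ∀ A, ContDiff ℝ ∞ (V A)) (hU : ∀ A, ContDiff ℝ ∞ (U A)) :
    ContDiff ℝ ∞ (eqCoframe p H W V U) := by
  unfold eqCoframe
  repeat' first
    | exact contDiff_const
    | exact hH
    | exact contDiff_tderiv (contDiff_torCoeff hH hW hV hU _) _
    | exact contDiff_tderiv (hW _) _
    | exact contDiff_tderiv (hV _) _
    | apply ContDiff.sub
    | apply ContDiff.add
    | apply ContDiff.mul

theorem contDiff_eqLong (hW : ∀ A, ContDiff ℝ ∞ (W A)) (hV : ∀ A, ContDiff ℝ ∞ (V A))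
    (hU : ∀ A, ContDiff ℝ ∞ (U A)) : ContDiff ℝ ∞ (eqLong p W V U) :=
  contDiff_const.mul (((contDiff_tderiv (contDiff_longCoeff hU 0) 0).add
    (contDiff_tderiv (contDiff_longCoeff hU 1) 1)).sub (contDiff_uderiv (contDiff_divCoeff hW hV)))

theorem contDiff_eqCurl (hH : ContDiff ℝ ∞ H) (hW : ∀ A, ContDiff ℝ ∞ (W A))
    (hV : ∀ A, ContDiff ℝ ∞ (V A)) (hU : ∀ A, ContDiff ℝ ∞ (U A)) (A : Fin 2) :
    ContDiff ℝ ∞ (eqCurl p H W V U A) := by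
  unfold eqCurl nmCoeff
  simp only [Fin.sum_univ_two]
  repeat' first
    | exact contDiff_const
    | exact contDiff_torCoeff hH hW hV hU _
    | exact contDiff_tderiv (contDiff_curlCoeff hW hV hU) _
    | exact contDiff_tderiv hH _
    | exact hW _
    | exact hV _
    | exact hU _
    | apply ContDiff.sub
    | apply ContDiff.add
    | apply ContDiff.mul
    | apply ContDiff.neg

theorem contDiff_eqRight (hH : ContDiff ℝ ∞ H) (hW : ∀ A, ContDiff ℝ ∞ (W A))
    (hV : ∀ A, ContDiff ℝ ∞ (V A)) (hU : ∀ A, ContDiff ℝ ∞ (U A)) (A : Fin 2) :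
    ContDiff ℝ ∞ (eqRight p H W V U A) := by
  unfold eqRight nmCoeff'
  simp only [Fin.sum_univ_two, div_eq_mul_inv]
  repeat' first
    | exact contDiff_const
    | exact contDiff_torCoeff hH hW hV hU _
    | exact contDiff_tderiv (contDiff_rightCoeff hW hV hU _ _) _
    | exact contDiff_tderiv hH _
    | exact hW _
    | exact hV _
    | exact hU _
    | apply ContDiff.sub
    | apply ContDiff.add
    | apply ContDiff.mul

theorem contDiff_eqLeft (hH : ContDiff ℝ ∞ H) (hW : ∀ A, ContDiff ℝ ∞ (W A))
    (hV : ∀ A, ContDiff ℝ ∞ (V A)) (hU : ∀ A, ContDiff ℝ ∞ (U A)) (A : Fin 2) :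
    ContDiff ℝ ∞ (eqLeft p H W V U A) := by
  unfold eqLeft nmCoeff'
  simp only [Fin.sum_univ_two, div_eq_mul_inv]
  repeat' first
    | exact contDiff_const
    | exact contDiff_tderiv (contDiff_leftCoeff hW hV hU _ _) _
    | exact contDiff_tderiv hH _
    | exact hW _
    | exact hV _
    | exact hU _
    | apply ContDiff.sub
    | apply ContDiff.add
    | apply ContDiff.mul
    | apply ContDiff.neg

theorem continuous_eulerLagrange (hH : ContDiff ℝ ∞ H) (hW : ∀ A, ContDiff ℝ ∞ (W A))
    (hV : ∀ A, ContDiff ℝ ∞ (V A)) (hU : ∀ A, ContDiff ℝ ∞ (U A)) (hη : Continuous η)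
    (hγ : Continuous γ) : Continuous (eulerLagrange p H W V U η γ) := by
  have hg : ∀ ν a b, Continuous (fun y => γ y ν a b) := fun ν a b =>
    (continuous_apply b).comp ((continuous_apply a).comp ((continuous_apply ν).comp hγ))
  have he : ∀ ν a, Continuous (fun y => η y ν a) := fun ν a =>
    (continuous_apply a).comp ((continuous_apply ν).comp hη)
  have hc : ∀ {F : Fun3}, ContDiff ℝ ∞ F → Continuous (fun y => F (uxy y)) :=
    fun hF => hF.continuous.comp contDiff_uxy.continuous
  unfold eulerLagrange
  repeat' first
    | exact continuous_const
    | exact he _ _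
    | exact hg _ _ _
    | exact hc (contDiff_eqCoframe hH hW hV hU)
    | exact hc (contDiff_eqLong hW hV hU)
    | exact hc (contDiff_eqCurl hH hW hV hU _)
    | exact hc (contDiff_eqRight hH hW hV hU _)
    | exact hc (contDiff_eqLeft hH hW hV hU _)
    | apply Continuous.add
    | apply Continuous.mul

theorem hasCompactSupport_eulerLagrange (hη : HasCompactSupport η) (hγ : HasCompactSupport γ) :
    HasCompactSupport (eulerLagrange p H W V U η γ) := by
  refine HasCompactSupport.intro (K := tsupport η ∪ tsupport γ)
    (hη.isCompact.union hγ.isCompact) fun y hy => ?_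
  have h1 : η y = 0 := image_eq_zero_of_notMem_tsupport fun h => hy (Or.inl h)
  have h2 : γ y = 0 := image_eq_zero_of_notMem_tsupport fun h => hy (Or.inr h)
  simp [eulerLagrange, h1, h2]

-- The two sides differ by the integral of a divergence with compact support.
open MeasureTheory in
theorem integral_deriv_lagDensity (hH : ContDiff ℝ ∞ H) (hW : ∀ A, ContDiff ℝ ∞ (W A))
    (hV : ∀ A, ContDiff ℝ ∞ (V A)) (hU : ∀ A, ContDiff ℝ ∞ (U A)) (hη : ContDiff ℝ ∞ η)
    (hγ : ContDiff ℝ ∞ γ) (sη : HasCompactSupport η) (sγ : HasCompactSupport γ) :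
    ∫ x, deriv (fun t : ℝ => lagDensity p (fun y => ppCoframe H y + t • η y)
      (fun y => ansatzConn H W V U y + t • γ y) x) 0 = ∫ x, eulerLagrange p H W V U η γ x := by
  have hi : Integrable (eulerLagrange p H W V U η γ) :=
    (continuous_eulerLagrange hH hW hV hU hη.continuous
      hγ.continuous).integrable_of_hasCompactSupport (hasCompactSupport_eulerLagrange sη sγ)
  simp only [deriv_lagDensity_eq hH hW hV hU hη hγ]
  have h : ∀ μ, Integrable (fun x => pderiv μ (flux p H W V U η γ μ) x) := by
    intro μ
    have hf := contDiff_flux (p := p) hH hW hV hU hη hγ μ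
    have hc : Continuous (fun x => fderiv ℝ (flux p H W V U η γ μ) x (Pi.single μ 1)) :=
      (hf.continuous_fderiv (by simp)).clm_apply continuous_const
    exact hc.integrable_of_hasCompactSupport ((hasCompactSupport_flux sη sγ μ).fderiv_apply ℝ _)
  rw [integral_add hi (integrable_finsetSum _ fun μ _ => h μ),
    integral_finsetSum _ fun μ _ => h μ]
  simp only [integral_pderiv_eq_zero (contDiff_flux hH hW hV hU hη hγ _)
    (hasCompactSupport_flux sη sγ _), Finset.sum_const_zero, add_zero]

open MeasureTheory in
/-- The fundamental lemma of the calculus of variations, for continuous functions on `ℝ⁴`. -/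
theorem eq_zero_of_forall_integral_mul {f : Pt → ℝ} (hf : Continuous f)
    (h : ∀ g : Pt → ℝ, ContDiff ℝ ∞ g → HasCompactSupport g → ∫ x, f x * g x = 0) : f = 0 := by
  have h1 := ae_eq_zero_of_integral_contDiff_smul_eq_zero (μ := volume) hf.locallyIntegrable
    fun g hg hs => by simpa only [smul_eq_mul, mul_comm] using h g hg hs
  exact (Continuous.ae_eq_iff_eq volume hf continuous_const).1 h1

/-! ### Test variations with a single nonzero component -/

theorem contDiff_single_coframe {g : Pt → ℝ} (hg : ContDiff ℝ ∞ g) (μ a : Fin 4) :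
    ContDiff ℝ ∞ (fun y => Pi.single μ (Pi.single a (g y)) : CoframeField) := by
  refine contDiff_pi.2 fun ν => contDiff_pi.2 fun b => ?_
  by_cases h1 : ν = μ
  · subst h1
    by_cases h2 : b = a
    · subst h2
      simpa using hg
    · simpa [Pi.single_eq_of_ne h2] using contDiff_const
  · simpa [Pi.single_eq_of_ne h1] using contDiff_const

theorem contDiff_single_conn {g : Pt → ℝ} (hg : ContDiff ℝ ∞ g) (μ a b : Fin 4) :
    ContDiff ℝ ∞ (fun y => Pi.single μ (Pi.single a (Pi.single b (g y))) : ConnField) := by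
  refine contDiff_pi.2 fun ν => ?_
  by_cases h1 : ν = μ
  · subst h1
    simpa using contDiff_single_coframe hg a b
  · simpa [Pi.single_eq_of_ne h1] using contDiff_const

theorem hasCompactSupport_single_coframe {g : Pt → ℝ} (hg : HasCompactSupport g) (μ a : Fin 4) :
    HasCompactSupport (fun y => Pi.single μ (Pi.single a (g y)) : CoframeField) :=
  hg.comp_left (g := fun r => (Pi.single μ (Pi.single a r) : Fin 4 → Fin 4 → ℝ)) (by simp)

theorem hasCompactSupport_single_conn {g : Pt → ℝ} (hg : HasCompactSupport g) (μ a b : Fin 4) :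
    HasCompactSupport (fun y => Pi.single μ (Pi.single a (Pi.single b (g y))) : ConnField) :=
  hg.comp_left (g := fun r => (Pi.single μ (Pi.single a (Pi.single b r)) :
    Fin 4 → Fin 4 → Fin 4 → ℝ)) (by simp)

theorem weakConst_ne_zero (hκ : p.κ ≠ 0) : weakConst p ≠ 0 := by
  simp [weakConst, hκ]

theorem strongConst_ne_zero (hρ : p.ρ ≠ 0) : strongConst p ≠ 0 := by
  simp [strongConst, hρ]

/-- The wave is a solution if and only if the field equations hold pointwise. -/
theorem isSolution_iff (hκ : p.κ ≠ 0) (hH : ContDiff ℝ ∞ H) (hW : ∀ A, ContDiff ℝ ∞ (W A))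
    (hV : ∀ A, ContDiff ℝ ∞ (V A)) (hU : ∀ A, ContDiff ℝ ∞ (U A)) :
    IsSolution p (ppCoframe H) (ansatzConn H W V U) ↔ p.lam = 0 ∧ eqCoframe p H W V U = 0 ∧
      eqLong p W V U = 0 ∧ (∀ A, eqCurl p H W V U A = 0) ∧ (∀ A, eqRight p H W V U A = 0) ∧
      ∀ A, eqLeft p H W V U A = 0 := by
  constructor
  · intro hs
    have key : ∀ η γ, ContDiff ℝ ∞ η → HasCompactSupport η → ContDiff ℝ ∞ γ →
        HasCompactSupport γ → ∫ x, eulerLagrange p H W V U η γ x = 0 := by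
      intro η γ hη sη hγ sγ
      rw [← integral_deriv_lagDensity hH hW hV hU hη hγ sη sγ]
      exact hs η γ hη sη hγ sγ
    -- The Euler-Lagrange expression is algebraic in the variation, so its coefficient at one
    -- component can be read off from constant fields and then tested against an arbitrary bump
    -- function.
    have cof : ∀ μ a, ∀ f : Pt → ℝ, Continuous f → (∀ x r, eulerLagrange p H W V U
        (fun _ => Pi.single μ (Pi.single a r)) 0 x = f x * r) → f = 0 := by
      intro μ a f hf h
      refine eq_zero_of_forall_integral_mul hf fun g hg sg => ?_
      have := key _ 0 (contDiff_single_coframe hg μ a) (hasCompactSupport_single_coframe sg μ a)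
        contDiff_const HasCompactSupport.zero
      rw [← this]
      congr 1
      funext x
      rw [← h x (g x)]
      rfl
    have con : ∀ μ a b, ∀ f : Pt → ℝ, Continuous f → (∀ x r, eulerLagrange p H W V U
        0 (fun _ => Pi.single μ (Pi.single a (Pi.single b r))) x = f x * r) → f = 0 := by
      intro μ a b f hf h
      refine eq_zero_of_forall_integral_mul hf fun g hg sg => ?_
      have := key 0 _ contDiff_const HasCompactSupport.zero (contDiff_single_conn hg μ a b)
        (hasCompactSupport_single_conn sg μ a b)
      rw [← this]
      congr 1
      funext x
      rw [← h x (g x)]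
      rfl
    -- The coordinates `(u, x, y)` take all values; `v = 0` serves as a section.
    have sur : ∀ F : Fun3, (fun y => F (uxy y)) = 0 → F = 0 := by
      intro F hF
      funext ⟨u, a, b⟩
      exact congrFun hF ![u, 0, a, b]
    have hc : ∀ {F : Fun3}, ContDiff ℝ ∞ F → Continuous (fun y => F (uxy y)) :=
      fun hF => hF.continuous.comp contDiff_uxy.continuous
    refine ⟨?_, ?_, ?_, ?_, ?_, ?_⟩
    -- The component `η_{00}` has the constant coefficient proportional to `lam`, so it isolates the
    -- cosmological constant.
    · have := congrFun (cof 0 0 (fun _ => weakConst p * (2 * p.lam)) continuous_const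
        (fun x r => by simp [eulerLagrange]; ring)) 0
      have h2 := weakConst_ne_zero hκ
      simpa [h2] using this
    · refine sur _ (cof 1 0 _ (hc (contDiff_eqCoframe hH hW hV hU)) fun x r => ?_)
      simp [eulerLagrange]
    · refine sur _ (con 1 1 0 _ (hc (contDiff_eqLong hW hV hU)) fun x r => ?_)
      simp [eulerLagrange]
    · intro A
      -- Here `![2, 3]` translates the transversal index `A : Fin 2` into the coordinate index.
      refine sur _ (con (![2, 3] A) 1 0 _ (hc (contDiff_eqCurl hH hW hV hU A)) fun x r => ?_)
      fin_cases A <;> simp [eulerLagrange]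
    · intro A
      refine sur _ (con 1 (![2, 3] A) 0 _ (hc (contDiff_eqRight hH hW hV hU A)) fun x r => ?_)
      fin_cases A <;> simp [eulerLagrange]
    · intro A
      refine sur _ (con 1 1 (![2, 3] A) _ (hc (contDiff_eqLeft hH hW hV hU A)) fun x r => ?_)
      fin_cases A <;> simp [eulerLagrange]
  · rintro ⟨h1, h2, h3, h4, h5, h6⟩ η γ hη sη hγ sγ
    rw [integral_deriv_lagDensity hH hW hV hU hη hγ sη sγ]
    simp [eulerLagrange, h1, h2, h3, h4, h5, h6]

end

/-! ### Decaying functions and the transversal Fourier transform -/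

open MeasureTheory

section

variable {F G : Fun3}

/-- Decay passes to any smooth function whose derivatives are controlled by derivatives of `F` of
order raised by a fixed m: 0 for multiples, 1 for directional derivatives. This works because the
required rate is the same at every order. -/
theorem TransverseDecay.of_le {c : ℝ} {m : ℕ} (hF : TransverseDecay F) (hG : ContDiff ℝ ∞ G)
    (h : ∀ n r, ‖iteratedFDeriv ℝ n G r‖ ≤ c * ‖iteratedFDeriv ℝ (n + m) F r‖) :
    TransverseDecay G := by
  refine ⟨hG, fun n K => ?_⟩
  obtain ⟨C, hC⟩ := hF.2 (n + m) K
  refine ⟨|c| * C, fun u s hu => ?_⟩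
  have h0 : (0 : ℝ) ≤ (1 + ‖s‖) ^ 3 := by positivity
  calc (1 + ‖s‖) ^ 3 * ‖iteratedFDeriv ℝ n G (u, s)‖
      ≤ (1 + ‖s‖) ^ 3 * (|c| * ‖iteratedFDeriv ℝ (n + m) F (u, s)‖) :=
        mul_le_mul_of_nonneg_left ((h n (u, s)).trans
          (mul_le_mul_of_nonneg_right (le_abs_self c) (norm_nonneg _))) h0
    _ = |c| * ((1 + ‖s‖) ^ 3 * ‖iteratedFDeriv ℝ (n + m) F (u, s)‖) := by ring
    _ ≤ |c| * C := mul_le_mul_of_nonneg_left (hC u s hu) (abs_nonneg c)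

theorem TransverseDecay.const_mul (hF : TransverseDecay F) (c : ℝ) :
    TransverseDecay (fun r => c * F r) := by
  refine hF.of_le (c := |c|) (m := 0) (contDiff_const.mul hF.1) fun n r => ?_
  have hc : ContDiffAt ℝ n F r := (hF.1.of_le (by exact_mod_cast le_top)).contDiffAt
  have h : iteratedFDeriv ℝ n (fun r => c * F r) r = c • iteratedFDeriv ℝ n F r :=
    iteratedFDeriv_const_smul_apply (a := c) hc
  rw [h, norm_smul, Real.norm_eq_abs, add_zero]

theorem TransverseDecay.add (hF : TransverseDecay F) (hG : TransverseDecay G) :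
    TransverseDecay (fun r => F r + G r) := by
  refine ⟨hF.1.add hG.1, fun n K => ?_⟩
  obtain ⟨C, hC⟩ := hF.2 n K
  obtain ⟨D, hD⟩ := hG.2 n K
  refine ⟨C + D, fun u s hu => ?_⟩
  have h : iteratedFDeriv ℝ n (fun r => F r + G r) (u, s)
      = iteratedFDeriv ℝ n F (u, s) + iteratedFDeriv ℝ n G (u, s) :=
    iteratedFDeriv_add_apply (hF.1.of_le (by exact_mod_cast le_top)).contDiffAt
      (hG.1.of_le (by exact_mod_cast le_top)).contDiffAt
  rw [h]
  have h0 : (0 : ℝ) ≤ (1 + ‖s‖) ^ 3 := by positivity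
  have := mul_le_mul_of_nonneg_left
    (norm_add_le (iteratedFDeriv ℝ n F (u, s)) (iteratedFDeriv ℝ n G (u, s))) h0
  rw [mul_add] at this
  exact this.trans (add_le_add (hC u s hu) (hD u s hu))

theorem TransverseDecay.fderiv_apply (hF : TransverseDecay F) (v : ℝ × ℝ × ℝ) :
    TransverseDecay (fun r => fderiv ℝ F r v) := by
  have hd : ContDiff ℝ ∞ (fderiv ℝ F) := hF.1.fderiv_right (m := ∞) (by simp)
  refine hF.of_le (c := ‖ContinuousLinearMap.apply ℝ ℝ v‖) (m := 1)
    (hd.clm_apply contDiff_const) fun n r => ?_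
  rw [← norm_iteratedFDeriv_fderiv]
  exact (ContinuousLinearMap.apply ℝ ℝ v).norm_iteratedFDeriv_comp_left (N := ∞) hd.contDiffAt
    (by exact_mod_cast le_top)

/-- The exponent 3 exceeds the dimension 2 of the transversal plane. -/
theorem integrable_japanese : Integrable (fun s : ℝ × ℝ => (1 + ‖s‖) ^ (-3 : ℝ)) :=
  integrable_one_add_norm (by simp; norm_num)

theorem TransverseDecay.bound (hF : TransverseDecay F) (K : ℝ) :
    ∃ C : ℝ, ∀ (u : ℝ) (s : ℝ × ℝ), |u| ≤ K → |F (u, s)| ≤ C * (1 + ‖s‖) ^ (-3 : ℝ) := by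
  obtain ⟨C, hC⟩ := hF.2 0 K
  refine ⟨C, fun u s hu => ?_⟩
  have h := hC u s hu
  have h0 : (0 : ℝ) < 1 + ‖s‖ := by positivity
  rw [norm_iteratedFDeriv_zero, Real.norm_eq_abs] at h
  rw [Real.rpow_neg h0.le, ← div_eq_mul_inv, le_div_iff₀ (by positivity)]
  have e : (1 + ‖s‖) ^ (3 : ℝ) = (1 + ‖s‖) ^ 3 := by exact_mod_cast Real.rpow_natCast _ 3
  rw [e, mul_comm]
  exact h

theorem TransverseDecay.continuous_slice (hF : TransverseDecay F) (u : ℝ) :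
    Continuous (fun s => F (u, s)) :=
  hF.1.continuous.comp (Continuous.prodMk_right u)

theorem TransverseDecay.integrable (hF : TransverseDecay F) (u : ℝ) :
    Integrable (fun s => F (u, s)) := by
  obtain ⟨C, hC⟩ := hF.bound |u|
  exact (integrable_japanese.const_mul C).mono' (hF.continuous_slice u).aestronglyMeasurable
    (Filter.Eventually.of_forall fun s => hC u s le_rfl)

/-- The plane wave `exp(-i q_A x^A)`. -/
def planeWave (q s : ℝ × ℝ) : ℂ :=
  Complex.exp (-Complex.I * (((q.1 * s.1 + q.2 * s.2 : ℝ)) : ℂ))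

theorem norm_planeWave (q s : ℝ × ℝ) : ‖planeWave q s‖ = 1 := by
  rw [planeWave, Complex.norm_exp]
  simp

theorem continuous_planeWave : Continuous fun z : (ℝ × ℝ) × ℝ × ℝ => planeWave z.1 z.2 := by
  unfold planeWave
  fun_prop

theorem continuous_planeWave_right (q : ℝ × ℝ) : Continuous (planeWave q) :=
  continuous_planeWave.comp (Continuous.prodMk_right q)

theorem hat_eq (F : Fun3) (u : ℝ) (q : ℝ × ℝ) :
    hat F u q = (1 / (2 * Real.pi) ^ 2 : ℂ) * ∫ s : ℝ × ℝ, (F (u, s) : ℂ) * planeWave q s := rfl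

theorem TransverseDecay.integrable_mul (hF : TransverseDecay F) (u : ℝ) (q : ℝ × ℝ) :
    Integrable (fun s => (F (u, s) : ℂ) * planeWave q s) := by
  refine (hF.integrable u).ofReal.mul_bdd (c := 1)
    (continuous_planeWave_right q).aestronglyMeasurable ?_
  exact Filter.Eventually.of_forall fun s => (norm_planeWave q s).le

theorem hat_const_mul (F : Fun3) (c : ℝ) (u : ℝ) (q : ℝ × ℝ) :
    hat (fun r => c * F r) u q = c * hat F u q := by
  simp only [hat_eq, Complex.ofReal_mul, mul_assoc]
  rw [integral_const_mul]
  ring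

theorem TransverseDecay.hat_add (hF : TransverseDecay F) (hG : TransverseDecay G) (u : ℝ)
    (q : ℝ × ℝ) : hat (fun r => F r + G r) u q = hat F u q + hat G u q := by
  simp only [hat_eq, Complex.ofReal_add, add_mul]
  rw [integral_add (hF.integrable_mul u q) (hG.integrable_mul u q)]
  ring

theorem hasFDerivAt_planeWave (q s : ℝ × ℝ) :
    HasFDerivAt (planeWave q) ((-Complex.I * planeWave q s) •
      Complex.ofRealCLM.comp (q.1 • ContinuousLinearMap.fst ℝ ℝ ℝ
        + q.2 • ContinuousLinearMap.snd ℝ ℝ ℝ)) s := by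
  have h : HasFDerivAt (fun s : ℝ × ℝ => -Complex.I * (((q.1 * s.1 + q.2 * s.2 : ℝ)) : ℂ))
      ((-Complex.I) • Complex.ofRealCLM.comp (q.1 • ContinuousLinearMap.fst ℝ ℝ ℝ
        + q.2 • ContinuousLinearMap.snd ℝ ℝ ℝ)) s :=
    (Complex.ofRealCLM.comp (q.1 • ContinuousLinearMap.fst ℝ ℝ ℝ
        + q.2 • ContinuousLinearMap.snd ℝ ℝ ℝ)).hasFDerivAt.const_mul (-Complex.I)
  refine h.cexp.congr_fderiv ?_
  rw [smul_smul, mul_comm, planeWave]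

/-- Integration by parts against the plane wave. Integrability of `F`, of its derivative and of
their products with a bounded exponential replaces compact support. -/
theorem TransverseDecay.hat_fderiv_snd (hF : TransverseDecay F) (v : ℝ × ℝ) (u : ℝ) (q : ℝ × ℝ) :
    hat (fun r => fderiv ℝ F r (0, v)) u q
      = Complex.I * ((q.1 * v.1 + q.2 * v.2 : ℝ) : ℂ) * hat F u q := by
  have hd : ∀ s, HasFDerivAt (fun s => (F (u, s) : ℂ))
      (Complex.ofRealCLM.comp ((fderiv ℝ F (u, s)).comp (ContinuousLinearMap.inr ℝ ℝ (ℝ × ℝ)))) s :=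
    fun s => Complex.ofRealCLM.hasFDerivAt.comp s
      (((hF.1.differentiable (by simp)) (u, s)).hasFDerivAt.comp s (hasFDerivAt_prodMk_right u s))
  have e1 : ∀ s, fderiv ℝ (fun s => (F (u, s) : ℂ)) s v = (fderiv ℝ F (u, s) (0, v) : ℂ) :=
    fun s => by rw [(hd s).fderiv]; rfl
  have e2 : ∀ s, fderiv ℝ (planeWave q) s v
      = (-Complex.I * ((q.1 * v.1 + q.2 * v.2 : ℝ) : ℂ)) * planeWave q s := fun s => by
    rw [(hasFDerivAt_planeWave q s).fderiv]
    simp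
    ring
  have key := integral_mul_fderiv_eq_neg_fderiv_mul_of_integrable (μ := volume)
    (f := fun s => (F (u, s) : ℂ)) (g := planeWave q) (v := v)
    (by simpa only [e1] using (hF.fderiv_apply (0, v)).integrable_mul u q)
    (by
      simp only [e2]
      refine ((hF.integrable_mul u q).const_mul
        (-Complex.I * ((q.1 * v.1 + q.2 * v.2 : ℝ) : ℂ))).congr ?_
      exact Filter.Eventually.of_forall fun s => by ring)
    (hF.integrable_mul u q)
    (fun s _ => (hd s).differentiableAt)
    (fun s _ => (hasFDerivAt_planeWave q s).differentiableAt)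
  simp only [e1, e2] at key
  rw [hat_eq, hat_eq, ← neg_eq_iff_eq_neg.mpr key]
  have e3 : ∀ s, (F (u, s) : ℂ) * (-Complex.I * ((q.1 * v.1 + q.2 * v.2 : ℝ) : ℂ) * planeWave q s)
      = -Complex.I * ((q.1 * v.1 + q.2 * v.2 : ℝ) : ℂ) * ((F (u, s) : ℂ) * planeWave q s) :=
    fun s => by ring
  simp only [e3]
  rw [integral_const_mul]
  ring

/-- Differentiation under the integral sign; the local uniformity in u of the decay provides the
dominating function. -/
theorem TransverseDecay.hasDerivAt_hat (hF : TransverseDecay F) (u : ℝ) (q : ℝ × ℝ) :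
    HasDerivAt (fun t => hat F t q) (hat (uderiv F) u q) u := by
  have hF' : TransverseDecay (uderiv F) := hF.fderiv_apply (1, 0, 0)
  -- The unit ball around u lies in `|t| ≤ |u| + 1`.
  obtain ⟨C, hC⟩ := hF'.bound (|u| + 1)
  refine HasDerivAt.const_mul (1 / (2 * Real.pi) ^ 2 : ℂ)
    (hasDerivAt_integral_of_dominated_loc_of_deriv_le (μ := volume)
      (F := fun t s => (F (t, s) : ℂ) * planeWave q s)
      (F' := fun t s => (uderiv F (t, s) : ℂ) * planeWave q s)
      (bound := fun s => C * (1 + ‖s‖) ^ (-3 : ℝ)) (Metric.ball_mem_nhds u one_pos)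
      (Filter.Eventually.of_forall fun t => (hF.integrable_mul t q).aestronglyMeasurable)
      (hF.integrable_mul u q) (hF'.integrable_mul u q).aestronglyMeasurable
      (Filter.Eventually.of_forall fun s t ht => ?_) (integrable_japanese.const_mul C)
      (Filter.Eventually.of_forall fun s t _ => ?_)).2
  · rw [norm_mul, norm_planeWave, mul_one, Complex.norm_real, Real.norm_eq_abs]
    refine hC t s ?_
    rw [Metric.mem_ball, Real.dist_eq] at ht
    have := abs_sub_abs_le_abs_sub t u
    linarith
  · have h1 : HasFDerivAt (fun t => F (t, s))
        ((fderiv ℝ F (t, s)).comp (ContinuousLinearMap.inl ℝ ℝ (ℝ × ℝ))) t :=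
      ((hF.1.differentiable (by simp)) (t, s)).hasFDerivAt.comp t (hasFDerivAt_prodMk_left t s)
    have h2 : HasDerivAt (fun t => F (t, s)) (uderiv F (t, s)) t := h1.hasDerivAt
    exact h2.ofReal_comp.mul_const _

/-- Dominated convergence with the integrable bound `|F|`. Continuity in q is what later extends the
algebraic equations to q = 0. -/
theorem TransverseDecay.continuous_hat (hF : TransverseDecay F) (u : ℝ) :
    Continuous (hat F u) := by
  refine continuous_const.mul (continuous_of_dominated (bound := fun s => |F (u, s)|)
    (fun q => (hF.integrable_mul u q).aestronglyMeasurable) (fun q => ?_) (hF.integrable u).abs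
    (Filter.Eventually.of_forall fun s => ?_))
  · refine Filter.Eventually.of_forall fun s => le_of_eq ?_
    change ‖(F (u, s) : ℂ) * planeWave q s‖ = _
    rw [norm_mul, norm_planeWave, mul_one, Complex.norm_real, Real.norm_eq_abs]
  · exact continuous_const.mul (continuous_planeWave.comp (Continuous.prodMk_left s))

-- Fourier inversion for a continuous integrable function. The transform is zero, hence integrable,
-- and inverting it returns the function.
open FourierTransform in
theorem TransverseDecay.eq_zero_of_hat (hF : TransverseDecay F) (h : ∀ u q, hat F u q = 0) :
    F = 0 := by
  have hpi : (1 / (2 * Real.pi) ^ 2 : ℂ) ≠ 0 := by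
    have : (Real.pi : ℂ) ≠ 0 := Complex.ofReal_ne_zero.2 Real.pi_ne_zero
    simp [this]
  funext r
  obtain ⟨u, s⟩ := r
  -- Inversion is stated on inner product spaces, whereas the product `ℝ × ℝ` carries the sup norm.
  -- The slice is moved to `ℂ` by the measure-preserving identification.
  have hmp := Complex.volume_preserving_equiv_real_prod
  have hme := Complex.measurableEquivRealProd.measurableEmbedding
  let g : ℂ → ℂ := fun z => (F (u, Complex.measurableEquivRealProd z) : ℂ)
  have hg : Continuous g := Complex.continuous_ofReal.comp
    ((hF.continuous_slice u).comp Complex.equivRealProdCLM.continuous)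
  have hgi : Integrable g := (hmp.integrable_comp_emb hme).2 (hF.integrable u).ofReal
  have hgF : 𝓕 g = 0 := by
    funext w
    rw [Real.fourier_eq']
    -- The unitary convention has `2π` in the exponent, so the frequency `w` corresponds to `q =
    -- 2πw`.
    have e : ∀ z : ℂ, Complex.exp (↑(-2 * Real.pi * inner ℝ z w) * Complex.I) • g z
        = (fun s : ℝ × ℝ => (F (u, s) : ℂ) * planeWave (2 * Real.pi * w.re, 2 * Real.pi * w.im) s)
            (Complex.measurableEquivRealProd z) := by
      intro z
      simp only [g, planeWave, smul_eq_mul, Complex.inner, Complex.measurableEquivRealProd_apply]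
      rw [mul_comm]
      congr 2
      push_cast
      simp
      ring
    rw [integral_congr_ae (Filter.Eventually.of_forall e), hmp.integral_comp hme
      (fun s : ℝ × ℝ => (F (u, s) : ℂ) * planeWave (2 * Real.pi * w.re, 2 * Real.pi * w.im) s)]
    have := h u (2 * Real.pi * w.re, 2 * Real.pi * w.im)
    rw [hat_eq] at this
    exact (mul_eq_zero.1 this).resolve_left hpi
  have hinv := hg.fourierInv_fourier_eq hgi (by rw [hgF]; exact integrable_zero _ _ _)
  have h0 : g = 0 := by
    rw [← hinv, hgF]
    funext w
    simp [Real.fourierInv_eq']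
  have := congrFun h0 (Complex.measurableEquivRealProd.symm s)
  simpa [g] using this

end

/-- `F` decays and has Fourier transform `φ`. -/
def HasHat (F : Fun3) (φ : ℝ → ℝ × ℝ → ℂ) : Prop :=
  TransverseDecay F ∧ ∀ u q, hat F u q = φ u q

section

variable {F G : Fun3} {φ ψ : ℝ → ℝ × ℝ → ℂ}

theorem TransverseDecay.hasHat (hF : TransverseDecay F) : HasHat F (hat F) := ⟨hF, fun _ _ => rfl⟩

theorem HasHat.add (hF : HasHat F φ) (hG : HasHat G ψ) :
    HasHat (fun r => F r + G r) (fun u q => φ u q + ψ u q) :=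
  ⟨hF.1.add hG.1, fun u q => by rw [hF.1.hat_add hG.1, hF.2, hG.2]⟩

theorem HasHat.const_mul (hF : HasHat F φ) (c : ℝ) :
    HasHat (fun r => c * F r) (fun u q => c * φ u q) :=
  ⟨hF.1.const_mul c, fun u q => by rw [hat_const_mul, hF.2]⟩

theorem HasHat.neg (hF : HasHat F φ) : HasHat (fun r => -F r) (fun u q => -φ u q) := by
  simpa using hF.const_mul (-1)

theorem HasHat.sub (hF : HasHat F φ) (hG : HasHat G ψ) :
    HasHat (fun r => F r - G r) (fun u q => φ u q - ψ u q) := by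
  simpa only [sub_eq_add_neg] using hF.add hG.neg

theorem HasHat.tderiv_zero (hF : HasHat F φ) :
    HasHat (tderiv 0 F) (fun u q => Complex.I * q.1 * φ u q) :=
  ⟨hF.1.fderiv_apply _, fun u q => by
    have := hF.1.hat_fderiv_snd (1, 0) u q
    simp only [mul_one, mul_zero, add_zero, hF.2] at this
    exact this⟩

theorem HasHat.tderiv_one (hF : HasHat F φ) :
    HasHat (tderiv 1 F) (fun u q => Complex.I * q.2 * φ u q) :=
  ⟨hF.1.fderiv_apply _, fun u q => by
    have := hF.1.hat_fderiv_snd (0, 1) u q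
    simp only [mul_one, mul_zero, zero_add, hF.2] at this
    exact this⟩

/-- The transform of the u-derivative is the u-derivative of the transform, and derivatives are
unique; any candidate obtained by the differentiation rules is therefore the right one. -/
theorem HasHat.uderiv (hF : HasHat F φ) {φ' : ℝ → ℝ × ℝ → ℂ}
    (h : ∀ u q, HasDerivAt (fun t => φ t q) (φ' u q) u) : HasHat (uderiv F) φ' :=
  ⟨hF.1.fderiv_apply _, fun u q => by
    have h1 := hF.1.hasDerivAt_hat u q
    simp only [hF.2] at h1
    exact h1.unique (h u q)⟩

theorem HasHat.eq_zero_iff (hF : HasHat F φ) : F = 0 ↔ ∀ u q, φ u q = 0 := by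
  refine ⟨fun h u q => ?_, fun h => hF.1.eq_zero_of_hat fun u q => by rw [hF.2, h]⟩
  rw [← hF.2, h, hat_eq]
  simp

end

/-! ### The field equations in Fourier space -/

section

variable {F G : Fun3} {φ ψ χ : ℝ → ℝ × ℝ → ℂ}

theorem HasHat.congr (h : HasHat F φ) (e : ∀ u q, φ u q = ψ u q) : HasHat F ψ :=
  ⟨h.1, fun u q => (h.2 u q).trans (e u q)⟩

theorem HasHat.div_two (hF : HasHat F φ) :
    HasHat (fun r => F r / 2) (fun u q => φ u q / 2) := by
  have h := hF.const_mul (1 / 2)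
  have e : (fun r => F r / 2) = fun r => 1 / 2 * F r := funext fun r => by ring
  rw [e]
  exact h.congr fun u q => by push_cast; ring

/-- The factor i/2 is kept in front, so that a further derivative yields a symbol with real
coefficients through `i² = -1`. -/
theorem HasHat.potVec_zero {P Q : Fun3} (hP : HasHat P φ) (hQ : HasHat Q ψ) :
    HasHat (potVec P Q 0) (fun u q => Complex.I / 2 * (q.1 * φ u q + q.2 * ψ u q)) := by
  have e : potVec P Q 0 = fun r => (1 / 2) * (tderiv 0 P r + tderiv 1 Q r) :=
    funext fun r => by simp [potVec, eps2, Fin.sum_univ_two]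
  rw [e]
  exact ((hP.tderiv_zero.add hQ.tderiv_one).const_mul (1 / 2)).congr fun u q => by
    push_cast; ring

theorem HasHat.potVec_one {P Q : Fun3} (hP : HasHat P φ) (hQ : HasHat Q ψ) :
    HasHat (potVec P Q 1) (fun u q => Complex.I / 2 * (q.2 * φ u q - q.1 * ψ u q)) := by
  have e : potVec P Q 1 = fun r => (1 / 2) * (tderiv 1 P r - tderiv 0 Q r) :=
    funext fun r => by simp [potVec, eps2, Fin.sum_univ_two]; ring
  rw [e]
  exact ((hP.tderiv_one.sub hQ.tderiv_zero).const_mul (1 / 2)).congr fun u q => by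
    push_cast; ring

theorem HasHat.tderiv_zero_half (hF : HasHat F (fun u q => Complex.I / 2 * χ u q)) :
    HasHat (tderiv 0 F) (fun u q => -(1 / 2) * q.1 * χ u q) :=
  hF.tderiv_zero.congr fun u q => by linear_combination (q.1 * χ u q / 2) * Complex.I_sq

theorem HasHat.tderiv_one_half (hF : HasHat F (fun u q => Complex.I / 2 * χ u q)) :
    HasHat (tderiv 1 F) (fun u q => -(1 / 2) * q.2 * χ u q) :=
  hF.tderiv_one.congr fun u q => by linear_combination (q.2 * χ u q / 2) * Complex.I_sq

end

/-- The product of `M` and the vector of the even Fourier amplitudes. -/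
def evenRow (p : Params) (H PW PV PU : Fun3) (i : Fin 4) (u : ℝ) (q : ℝ × ℝ) : ℂ :=
  Matrix.mulVec ((evenMatrix p q).map Complex.ofReal) (fun j => hat (evenVars H PW PV PU j) u q) i

/-- The product of `M̄` and the vector of the odd Fourier amplitudes. -/
def oddRow (p : Params) (QW QV QU : Fun3) (i : Fin 3) (u : ℝ) (q : ℝ × ℝ) : ℂ :=
  Matrix.mulVec ((oddMatrix p q).map Complex.ofReal) (fun j => hat (oddVars QW QV QU j) u q) i

section

variable {p : Params} {H PW PV PU QW QV QU : Fun3}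

theorem hasHat_evenVars (hH : TransverseDecay H) (hPW : TransverseDecay PW)
    (hPV : TransverseDecay PV) (hPU : TransverseDecay PU) :
    HasHat (evenVars H PW PV PU 0) (fun u q => hat PW u q - hat PV u q) ∧
    HasHat (evenVars H PW PV PU 1) (fun u q => hat H u q - hat PW u q + hat PU u q) ∧
    HasHat (evenVars H PW PV PU 2) (fun u q => hat PW u q + hat PV u q + hat PU u q) ∧
    HasHat (evenVars H PW PV PU 3)
      (fun u q => hat PW u q + hat PV u q - ((2 : ℝ) : ℂ) * hat PU u q) :=
  ⟨hPW.hasHat.sub hPV.hasHat, (hH.hasHat.sub hPW.hasHat).add hPU.hasHat,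
    (hPW.hasHat.add hPV.hasHat).add hPU.hasHat,
    (hPW.hasHat.add hPV.hasHat).sub (hPU.hasHat.const_mul 2)⟩

theorem hasHat_oddVars (hQW : TransverseDecay QW) (hQV : TransverseDecay QV)
    (hQU : TransverseDecay QU) :
    HasHat (oddVars QW QV QU 0) (fun u q => -hat QW u q + hat QU u q) ∧
    HasHat (oddVars QW QV QU 1) (fun u q => hat QW u q + hat QV u q + hat QU u q) ∧
    HasHat (oddVars QW QV QU 2)
      (fun u q => hat QW u q + hat QV u q - ((2 : ℝ) : ℂ) * hat QU u q) :=
  ⟨hQW.hasHat.neg.add hQU.hasHat, (hQW.hasHat.add hQV.hasHat).add hQU.hasHat,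
    (hQW.hasHat.add hQV.hasHat).sub (hQU.hasHat.const_mul 2)⟩

theorem evenRow_apply (hH : TransverseDecay H) (hPW : TransverseDecay PW)
    (hPV : TransverseDecay PV) (hPU : TransverseDecay PU) (u : ℝ) (q : ℝ × ℝ) :
    evenRow p H PW PV PU 0 u q = -(p.a0 / 2) * (hat PW u q - hat PV u q)
      + p.a1 * (hat H u q - hat PW u q + hat PU u q)
      + p.c1 * (hat PW u q + hat PV u q - 2 * hat PU u q) ∧
    evenRow p H PW PV PU 1 u q = (2 * p.c1 - p.a1) * (hat H u q - hat PW u q + hat PU u q)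
      + 1 / 3 * (p.a0 - 4 * p.b1) * (hat PW u q + hat PV u q + hat PU u q)
      + (p.a0 / 6 - p.c1 + 4 / 3 * p.b2) * (hat PW u q + hat PV u q - 2 * hat PU u q) ∧
    evenRow p H PW PV PU 2 u q = 2 * (p.w1 + p.w4) * qSq p q * (hat PW u q - hat PV u q)
      + (p.a0 + p.a1) * (hat H u q - hat PW u q + hat PU u q)
      + 2 / 3 * p.v4 * qSq p q * (hat PW u q + hat PV u q + hat PU u q)
      + (p.a0 / 2 + p.c1 + 1 / 3 * p.v4 * qSq p q)
        * (hat PW u q + hat PV u q - 2 * hat PU u q) ∧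
    evenRow p H PW PV PU 3 u q = p.v4 * qSq p q * (hat PW u q - hat PV u q)
      + (p.a0 - 4 * p.b1 + 2 / 3 * varpi0 p * qSq p q)
        * (hat PW u q + hat PV u q + hat PU u q)
      + 1 / 3 * qSq p q * varpi0 p * (hat PW u q + hat PV u q - 2 * hat PU u q) := by
  obtain ⟨h0, h1, h2, h3⟩ := hasHat_evenVars hH hPW hPV hPU
  simp only [evenRow, Matrix.mulVec, dotProduct, Fin.sum_univ_four, Matrix.map_apply,
    h0.2, h1.2, h2.2, h3.2]
  simp [evenMatrix]

theorem oddRow_apply (hQW : TransverseDecay QW) (hQV : TransverseDecay QV)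
    (hQU : TransverseDecay QU) (u : ℝ) (q : ℝ × ℝ) :
    oddRow p QW QV QU 0 u q = (p.a0 - 4 * p.b1 + 4 * p.z1 * qSq p q)
      * (hat QW u q + hat QV u q + hat QU u q) ∧
    oddRow p QW QV QU 1 u q = (p.a0 + 2 * p.c1 - 2 * varpi2 p * qSq p q)
        * (-hat QW u q + hat QU u q)
      + (2 * (p.a0 + 2 * p.b2) / 3 - (varpi2 p + varpi3 p) * qSq p q)
        * (hat QW u q + hat QV u q - 2 * hat QU u q) ∧
    oddRow p QW QV QU 2 u q = (p.a0 + p.a1 - varpi1 p * qSq p q) * (-hat QW u q + hat QU u q)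
      + (p.a0 / 2 + p.c1 - varpi2 p * qSq p q)
        * (hat QW u q + hat QV u q - 2 * hat QU u q) := by
  obtain ⟨h0, h1, h2⟩ := hasHat_oddVars hQW hQV hQU
  simp only [oddRow, Matrix.mulVec, dotProduct, Fin.sum_univ_three, Matrix.map_apply,
    h0.2, h1.2, h2.2]
  simp [oddMatrix]

/-- This trades the strong coupling for the weak one: the factor `κ/(4ρ)` combines with `q₁² + q₂²`
into `qSq`, and the remaining 4 is absorbed in the entries of the matrices. -/
theorem strongConst_eq (hκ : p.κ ≠ 0) :
    (strongConst p : ℂ) = 4 * weakConst p * (p.κ / (4 * p.ρ)) := by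
  have h : strongConst p = 4 * weakConst p * (p.κ / (4 * p.ρ)) := by
    simp only [strongConst, weakConst]
    by_cases hρ : p.ρ = 0
    · simp [hρ]
    · field_simp
  rw [h]
  push_cast
  ring

/-- The coefficient consists of curls, which annihilate gradients, so only copotentials remain. The
divergence coefficient below contains, conversely, only potentials. -/
theorem hasHat_curlCoeff (hPW : TransverseDecay PW)
    (hPV : TransverseDecay PV) (hPU : TransverseDecay PU) (hQW : TransverseDecay QW)
    (hQV : TransverseDecay QV) (hQU : TransverseDecay QU) :
    HasHat (curlCoeff p (potVec PW QW) (potVec PV QV) (potVec PU QU)) (fun u q => 1 / 2 * (q.1 ^ 2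
      + q.2 ^ 2)
      * ((-p.v2 + p.z1 + p.z2) * hat QU u q + 1 / 2 * (p.z1 - p.z2) * hat QV u q
        + (p.v2 + 1 / 2 * (p.z1 - p.z2)) * hat QW u q)) := by
  have hW0 := hPW.hasHat.potVec_zero hQW.hasHat
  have hW1 := hPW.hasHat.potVec_one hQW.hasHat
  have hV0 := hPV.hasHat.potVec_zero hQV.hasHat
  have hV1 := hPV.hasHat.potVec_one hQV.hasHat
  have hU0 := hPU.hasHat.potVec_zero hQU.hasHat
  have hU1 := hPU.hasHat.potVec_one hQU.hasHat
  -- The symbol is left open. The structural rules determine it from the shape of the function, and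
  -- the second goal compares it with the stated one.
  apply HasHat.congr
  · unfold curlCoeff
    repeat' first
      | exact hU1.tderiv_zero_half | exact hU0.tderiv_one_half | exact hV0.tderiv_one_half
      | exact hV1.tderiv_zero_half | exact hW0.tderiv_one_half | exact hW1.tderiv_zero_half
      | apply HasHat.neg | apply HasHat.sub | apply HasHat.add | apply HasHat.const_mul
  · intro u q
    push_cast
    ring

theorem hasHat_divCoeff (hPW : TransverseDecay PW)
    (hPV : TransverseDecay PV) (hQW : TransverseDecay QW) (hQV : TransverseDecay QV) :
    HasHat (divCoeff p (potVec PW QW) (potVec PV QV)) (fun u q => 1 / 4 * (q.1 ^ 2 + q.2 ^ 2)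
      * ((p.v4 - p.z1 + p.z4) * hat PV u q + (3 * p.v4 - p.z1 + p.z4) * hat PW u q)) := by
  have hW0 := hPW.hasHat.potVec_zero hQW.hasHat
  have hW1 := hPW.hasHat.potVec_one hQW.hasHat
  have hV0 := hPV.hasHat.potVec_zero hQV.hasHat
  have hV1 := hPV.hasHat.potVec_one hQV.hasHat
  apply HasHat.congr
  · unfold divCoeff
    repeat' first
      | exact hV0.tderiv_zero_half | exact hV1.tderiv_one_half
      | exact hW0.tderiv_zero_half | exact hW1.tderiv_one_half
      | apply HasHat.neg | apply HasHat.sub | apply HasHat.add | apply HasHat.const_mul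
  · intro u q
    push_cast
    ring

/-- With rows counted from zero, let E and O denote the even and odd rows. The part along q is twice
E1. Writing L = O1 - ⅔ O0 and R = 2 O2 - L for the orthogonal parts of `eqLeft` and `eqRight`, the
orthogonal part here is 2 O0 - R + L. -/
theorem hasHat_eqCurl (hκ : p.κ ≠ 0) (hH : TransverseDecay H) (hPW : TransverseDecay PW)
    (hPV : TransverseDecay PV) (hPU : TransverseDecay PU) (hQW : TransverseDecay QW)
    (hQV : TransverseDecay QV) (hQU : TransverseDecay QU) :
    HasHat (eqCurl p H (potVec PW QW) (potVec PV QV) (potVec PU QU) 0)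
      (fun u q => Complex.I / 2 * (q.1 * (weakConst p * (2 * evenRow p H PW PV PU 1 u q))
        + q.2 * (weakConst p * (2 * oddRow p QW QV QU 0 u q - (2 * oddRow p QW QV QU 2 u q
          - (oddRow p QW QV QU 1 u q - 2 / 3 * oddRow p QW QV QU 0 u q))
          + (oddRow p QW QV QU 1 u q - 2 / 3 * oddRow p QW QV QU 0 u q))))) ∧
    HasHat (eqCurl p H (potVec PW QW) (potVec PV QV) (potVec PU QU) 1)
      (fun u q => Complex.I / 2 * (q.2 * (weakConst p * (2 * evenRow p H PW PV PU 1 u q))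
        - q.1 * (weakConst p * (2 * oddRow p QW QV QU 0 u q - (2 * oddRow p QW QV QU 2 u q
          - (oddRow p QW QV QU 1 u q - 2 / 3 * oddRow p QW QV QU 0 u q))
          + (oddRow p QW QV QU 1 u q - 2 / 3 * oddRow p QW QV QU 0 u q))))) := by
  have hW0 := hPW.hasHat.potVec_zero hQW.hasHat
  have hW1 := hPW.hasHat.potVec_one hQW.hasHat
  have hV0 := hPV.hasHat.potVec_zero hQV.hasHat
  have hV1 := hPV.hasHat.potVec_one hQV.hasHat
  have hU0 := hPU.hasHat.potVec_zero hQU.hasHat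
  have hU1 := hPU.hasHat.potVec_one hQU.hasHat
  have hc := hasHat_curlCoeff (p := p) hPW hPV hPU hQW hQV hQU
  unfold eqCurl torCoeff nmCoeff
  simp only [Fin.sum_univ_two, eps2, Matrix.of_apply, Matrix.cons_val', Matrix.cons_val_zero,
    Matrix.cons_val_one, Matrix.cons_val_fin_one]
  constructor
  · apply HasHat.congr
    · repeat' first
        | exact hW0 | exact hW1 | exact hV0 | exact hV1 | exact hU0 | exact hU1
        | exact hH.hasHat.tderiv_zero | exact hH.hasHat.tderiv_one
        | exact hc.tderiv_zero | exact hc.tderiv_one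
        | apply HasHat.neg | apply HasHat.sub | apply HasHat.add
        | apply HasHat.const_mul
    · intro u q
      obtain ⟨-, e1, e2, e3⟩ := evenRow_apply (p := p) hH hPW hPV hPU u q
      obtain ⟨o0, o1, o2⟩ := oddRow_apply (p := p) hQW hQV hQU u q
      simp only [e1, o0, o1, o2, strongConst_eq hκ, qSq, varpi1, varpi2,
        varpi3]
      push_cast
      ring
  · apply HasHat.congr
    · repeat' first
        | exact hW0 | exact hW1 | exact hV0 | exact hV1 | exact hU0 | exact hU1
        | exact hH.hasHat.tderiv_zero | exact hH.hasHat.tderiv_one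
        | exact hc.tderiv_zero | exact hc.tderiv_one
        | apply HasHat.neg | apply HasHat.sub | apply HasHat.add
        | apply HasHat.const_mul
    · intro u q
      obtain ⟨-, e1, e2, e3⟩ := evenRow_apply (p := p) hH hPW hPV hPU u q
      obtain ⟨o0, o1, o2⟩ := oddRow_apply (p := p) hQW hQV hQU u q
      simp only [e1, o0, o1, o2, strongConst_eq hκ, qSq, varpi1, varpi2,
        varpi3]
      push_cast
      ring

/-- The part along q is E2 + E3 - E1. In `hasHat_eqLeft` it is E2 - E3 + E1, so half their sum is E2
and half their difference is E3 - E1. -/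
theorem hasHat_eqRight (hκ : p.κ ≠ 0) (hH : TransverseDecay H) (hPW : TransverseDecay PW)
    (hPV : TransverseDecay PV) (hPU : TransverseDecay PU) (hQW : TransverseDecay QW)
    (hQV : TransverseDecay QV) (hQU : TransverseDecay QU) :
    HasHat (eqRight p H (potVec PW QW) (potVec PV QV) (potVec PU QU) 0)
      (fun u q => Complex.I / 2 * (q.1 * (weakConst p * (evenRow p H PW PV PU 2 u q
        + evenRow p H PW PV PU 3 u q - evenRow p H PW PV PU 1 u q))
        + q.2 * (weakConst p * (2 * oddRow p QW QV QU 2 u q - (oddRow p QW QV QU 1 u q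
          - 2 / 3 * oddRow p QW QV QU 0 u q))))) ∧
    HasHat (eqRight p H (potVec PW QW) (potVec PV QV) (potVec PU QU) 1)
      (fun u q => Complex.I / 2 * (q.2 * (weakConst p * (evenRow p H PW PV PU 2 u q
        + evenRow p H PW PV PU 3 u q - evenRow p H PW PV PU 1 u q))
        - q.1 * (weakConst p * (2 * oddRow p QW QV QU 2 u q - (oddRow p QW QV QU 1 u q
          - 2 / 3 * oddRow p QW QV QU 0 u q))))) := by
  have hW0 := hPW.hasHat.potVec_zero hQW.hasHat
  have hW1 := hPW.hasHat.potVec_one hQW.hasHat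
  have hV0 := hPV.hasHat.potVec_zero hQV.hasHat
  have hV1 := hPV.hasHat.potVec_one hQV.hasHat
  have hU0 := hPU.hasHat.potVec_zero hQU.hasHat
  have hU1 := hPU.hasHat.potVec_one hQU.hasHat
  unfold eqRight torCoeff nmCoeff'
  simp only [Fin.sum_univ_two, rightCoeff_apply]
  constructor
  · apply HasHat.congr
    · repeat' first
        | exact hW0 | exact hW1 | exact hV0 | exact hV1 | exact hU0 | exact hU1
        | exact hH.hasHat.tderiv_zero | exact hH.hasHat.tderiv_one
        | exact hW0.tderiv_zero_half
        | exact hW0.tderiv_one_half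
        | exact hW1.tderiv_zero_half
        | exact hW1.tderiv_one_half
        | exact hV0.tderiv_zero_half
        | exact hV0.tderiv_one_half
        | exact hV1.tderiv_zero_half
        | exact hV1.tderiv_one_half
        | exact hU0.tderiv_zero_half
        | exact hU0.tderiv_one_half
        | exact hU1.tderiv_zero_half
        | exact hU1.tderiv_one_half
        | apply HasHat.tderiv_zero | apply HasHat.tderiv_one | apply HasHat.div_two
        | apply HasHat.neg | apply HasHat.sub | apply HasHat.add
        | apply HasHat.const_mul
    · intro u q
      obtain ⟨-, e1, e2, e3⟩ := evenRow_apply (p := p) hH hPW hPV hPU u q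
      obtain ⟨o0, o1, o2⟩ := oddRow_apply (p := p) hQW hQV hQU u q
      simp only [e1, e2, e3, o0, o1, o2, strongConst_eq hκ, qSq, varpi0, varpi1, varpi2,
        varpi3]
      push_cast
      ring
  · apply HasHat.congr
    · repeat' first
        | exact hW0 | exact hW1 | exact hV0 | exact hV1 | exact hU0 | exact hU1
        | exact hH.hasHat.tderiv_zero | exact hH.hasHat.tderiv_one
        | exact hW0.tderiv_zero_half
        | exact hW0.tderiv_one_half
        | exact hW1.tderiv_zero_half
        | exact hW1.tderiv_one_half
        | exact hV0.tderiv_zero_half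
        | exact hV0.tderiv_one_half
        | exact hV1.tderiv_zero_half
        | exact hV1.tderiv_one_half
        | exact hU0.tderiv_zero_half
        | exact hU0.tderiv_one_half
        | exact hU1.tderiv_zero_half
        | exact hU1.tderiv_one_half
        | apply HasHat.tderiv_zero | apply HasHat.tderiv_one | apply HasHat.div_two
        | apply HasHat.neg | apply HasHat.sub | apply HasHat.add
        | apply HasHat.const_mul
    · intro u q
      obtain ⟨-, e1, e2, e3⟩ := evenRow_apply (p := p) hH hPW hPV hPU u q
      obtain ⟨o0, o1, o2⟩ := oddRow_apply (p := p) hQW hQV hQU u q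
      simp only [e1, e2, e3, o0, o1, o2, strongConst_eq hκ, qSq, varpi0, varpi1, varpi2,
        varpi3]
      push_cast
      ring

theorem hasHat_eqLeft (hκ : p.κ ≠ 0) (hH : TransverseDecay H) (hPW : TransverseDecay PW)
    (hPV : TransverseDecay PV) (hPU : TransverseDecay PU) (hQW : TransverseDecay QW)
    (hQV : TransverseDecay QV) (hQU : TransverseDecay QU) :
    HasHat (eqLeft p H (potVec PW QW) (potVec PV QV) (potVec PU QU) 0)
      (fun u q => Complex.I / 2 * (q.1 * (weakConst p * (evenRow p H PW PV PU 2 u q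
        - evenRow p H PW PV PU 3 u q + evenRow p H PW PV PU 1 u q))
        + q.2 * (weakConst p * (oddRow p QW QV QU 1 u q - 2 / 3 * oddRow p QW QV QU 0 u q)))) ∧
    HasHat (eqLeft p H (potVec PW QW) (potVec PV QV) (potVec PU QU) 1)
      (fun u q => Complex.I / 2 * (q.2 * (weakConst p * (evenRow p H PW PV PU 2 u q
        - evenRow p H PW PV PU 3 u q + evenRow p H PW PV PU 1 u q))
        - q.1 * (weakConst p * (oddRow p QW QV QU 1 u q - 2 / 3 * oddRow p QW QV QU 0 u q)))) := by
  have hW0 := hPW.hasHat.potVec_zero hQW.hasHat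
  have hW1 := hPW.hasHat.potVec_one hQW.hasHat
  have hV0 := hPV.hasHat.potVec_zero hQV.hasHat
  have hV1 := hPV.hasHat.potVec_one hQV.hasHat
  have hU0 := hPU.hasHat.potVec_zero hQU.hasHat
  have hU1 := hPU.hasHat.potVec_one hQU.hasHat
  unfold eqLeft nmCoeff'
  simp only [Fin.sum_univ_two, leftCoeff_apply]
  constructor
  · apply HasHat.congr
    · repeat' first
        | exact hW0 | exact hW1 | exact hV0 | exact hV1 | exact hU0 | exact hU1
        | exact hH.hasHat.tderiv_zero | exact hH.hasHat.tderiv_one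
        | exact hW0.tderiv_zero_half
        | exact hW0.tderiv_one_half
        | exact hW1.tderiv_zero_half
        | exact hW1.tderiv_one_half
        | exact hV0.tderiv_zero_half
        | exact hV0.tderiv_one_half
        | exact hV1.tderiv_zero_half
        | exact hV1.tderiv_one_half
        | exact hU0.tderiv_zero_half
        | exact hU0.tderiv_one_half
        | exact hU1.tderiv_zero_half
        | exact hU1.tderiv_one_half
        | apply HasHat.tderiv_zero | apply HasHat.tderiv_one | apply HasHat.div_two
        | apply HasHat.neg | apply HasHat.sub | apply HasHat.add
        | apply HasHat.const_mul
    · intro u q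
      obtain ⟨-, e1, e2, e3⟩ := evenRow_apply (p := p) hH hPW hPV hPU u q
      obtain ⟨o0, o1, o2⟩ := oddRow_apply (p := p) hQW hQV hQU u q
      simp only [e1, e2, e3, o0, o1, strongConst_eq hκ, qSq, varpi0, varpi2,
        varpi3]
      push_cast
      ring
  · apply HasHat.congr
    · repeat' first
        | exact hW0 | exact hW1 | exact hV0 | exact hV1 | exact hU0 | exact hU1
        | exact hH.hasHat.tderiv_zero | exact hH.hasHat.tderiv_one
        | exact hW0.tderiv_zero_half
        | exact hW0.tderiv_one_half
        | exact hW1.tderiv_zero_half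
        | exact hW1.tderiv_one_half
        | exact hV0.tderiv_zero_half
        | exact hV0.tderiv_one_half
        | exact hV1.tderiv_zero_half
        | exact hV1.tderiv_one_half
        | exact hU0.tderiv_zero_half
        | exact hU0.tderiv_one_half
        | exact hU1.tderiv_zero_half
        | exact hU1.tderiv_one_half
        | apply HasHat.tderiv_zero | apply HasHat.tderiv_one | apply HasHat.div_two
        | apply HasHat.neg | apply HasHat.sub | apply HasHat.add
        | apply HasHat.const_mul
    · intro u q
      obtain ⟨-, e1, e2, e3⟩ := evenRow_apply (p := p) hH hPW hPV hPU u q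
      obtain ⟨o0, o1, o2⟩ := oddRow_apply (p := p) hQW hQV hQU u q
      simp only [e1, e2, e3, o0, o1, strongConst_eq hκ, qSq, varpi0, varpi2,
        varpi3]
      push_cast
      ring

/-- The equation is a divergence plus a multiple `lam * H`; only after `lam = 0` is its symbol q²
times a row of the even system. -/
theorem hasHat_eqCoframe (hl : p.lam = 0)
    (hH : TransverseDecay H) (hPW : TransverseDecay PW)
    (hPV : TransverseDecay PV) (hPU : TransverseDecay PU) (hQW : TransverseDecay QW)
    (hQV : TransverseDecay QV) (hQU : TransverseDecay QU) :
    HasHat (eqCoframe p H (potVec PW QW) (potVec PV QV) (potVec PU QU))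
      (fun u q => -(weakConst p * (q.1 ^ 2 + q.2 ^ 2)) * evenRow p H PW PV PU 0 u q) := by
  have hW0 := hPW.hasHat.potVec_zero hQW.hasHat
  have hW1 := hPW.hasHat.potVec_one hQW.hasHat
  have hV0 := hPV.hasHat.potVec_zero hQV.hasHat
  have hV1 := hPV.hasHat.potVec_one hQV.hasHat
  have hU0 := hPU.hasHat.potVec_zero hQU.hasHat
  have hU1 := hPU.hasHat.potVec_one hQU.hasHat
  unfold eqCoframe torCoeff
  apply HasHat.congr
  · repeat' first
      | exact hH.hasHat
      | exact hH.hasHat.tderiv_zero | exact hH.hasHat.tderiv_one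
      | exact hW0 | exact hW1 | exact hV0 | exact hV1 | exact hU0 | exact hU1
      | apply HasHat.tderiv_zero | apply HasHat.tderiv_one
      | apply HasHat.neg | apply HasHat.sub | apply HasHat.add | apply HasHat.const_mul
  · intro u q
    obtain ⟨e0, -⟩ := evenRow_apply (p := p) hH hPW hPV hPU u q
    simp only [e0, hl]
    push_cast
    ring_nf
    simp only [Complex.I_sq]
    ring

/-- The left side of the dynamical equation. -/
def dynRow (p : Params) (H PW PV PU : Fun3) (u : ℝ) (q : ℝ × ℝ) : ℂ :=
  (p.v4 : ℂ) * deriv (fun s => hat (evenVars H PW PV PU 0) s q) u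
    + ((2 / 3 * (varpi0 p - 6 * p.z1) : ℝ) : ℂ) *
      deriv (fun s => hat (evenVars H PW PV PU 2) s q) u
    + ((1 / 3 * varpi0 p : ℝ) : ℂ) * deriv (fun s => hat (evenVars H PW PV PU 3) s q) u

/-- The divergence of `U` contains only its potential, and so do the coefficients differentiated in
u; hence the copotentials disappear and a common factor q² remains. -/
theorem hasHat_eqLong (hH : TransverseDecay H) (hPW : TransverseDecay PW)
    (hPV : TransverseDecay PV) (hPU : TransverseDecay PU) (hQW : TransverseDecay QW)
    (hQV : TransverseDecay QV) (hQU : TransverseDecay QU) :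
    HasHat (eqLong p (potVec PW QW) (potVec PV QV) (potVec PU QU))
      (fun u q => -(strongConst p / 4 * (q.1 ^ 2 + q.2 ^ 2)) * dynRow p H PW PV PU u q) := by
  have hd := hasHat_divCoeff (p := p) hPW hPV hQW hQV
  have dW := fun u q => hPW.hasDerivAt_hat u q
  have dV := fun u q => hPV.hasDerivAt_hat u q
  have dU := fun u q => hPU.hasDerivAt_hat u q
  have dU' := fun u q => hQU.hasDerivAt_hat u q
  have hU0 := (hPU.hasHat.potVec_zero hQU.hasHat).uderiv fun u q =>
    (((dU u q).const_mul (q.1 : ℂ)).add ((dU' u q).const_mul (q.2 : ℂ))).const_mul (Complex.I / 2)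
  have hU1 := (hPU.hasHat.potVec_one hQU.hasHat).uderiv fun u q =>
    (((dU u q).const_mul (q.2 : ℂ)).sub ((dU' u q).const_mul (q.1 : ℂ))).const_mul (Complex.I / 2)
  have hd' := hd.uderiv fun u q =>
    (((dV u q).const_mul (p.v4 - p.z1 + p.z4 : ℂ)).add
      ((dW u q).const_mul (3 * p.v4 - p.z1 + p.z4 : ℂ))).const_mul
        (1 / 4 * (q.1 ^ 2 + q.2 ^ 2) : ℂ)
  unfold eqLong longCoeff
  apply HasHat.congr
  · repeat' first
      | exact hd' | exact hU0 | exact hU1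
      | apply HasHat.tderiv_zero | apply HasHat.tderiv_one
      | apply HasHat.neg | apply HasHat.sub | apply HasHat.add | apply HasHat.const_mul
  · intro u q
    obtain ⟨h0, -, h2, h3⟩ := hasHat_evenVars hH hPW hPV hPU
    simp only [dynRow, h0.2, h2.2, h3.2]
    rw [((dW u q).fun_sub (dV u q)).deriv, (((dW u q).fun_add (dV u q)).fun_add (dU u q)).deriv,
      (((dW u q).fun_add (dV u q)).fun_sub ((dU u q).const_mul _)).deriv]
    simp only [varpi0]
    push_cast
    linear_combination (-strongConst p * p.z1 * (q.1 ^ 2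
      + q.2 ^ 2) * hat (uderiv PU) u q) * Complex.I_sq

end

/-! ### From vanishing Fourier symbols to the algebraic system -/

section

variable {p : Params} {H PW PV PU QW QV QU : Fun3}

theorem contDiff_potVec {P Q : Fun3} (hP : ContDiff ℝ ∞ P) (hQ : ContDiff ℝ ∞ Q) (A : Fin 2) :
    ContDiff ℝ ∞ (potVec P Q A) :=
  contDiff_const.mul ((contDiff_tderiv hP A).add
    (ContDiff.sum fun B _ => contDiff_const.mul (contDiff_tderiv hQ B)))

/-- The punctured plane is dense. -/
theorem forall_eq_zero_of_ne {f : ℝ × ℝ → ℂ} (hf : Continuous f) (h : ∀ q, q ≠ 0 → f q = 0) (q) :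
    f q = 0 :=
  congrFun (hf.ext_on (dense_compl_singleton (0 : ℝ × ℝ)) continuous_const fun q hq => h q hq) q

theorem sq_add_sq_ne_zero {q : ℝ × ℝ} (hq : q ≠ 0) : ((q.1 : ℂ) ^ 2 + (q.2 : ℂ) ^ 2) ≠ 0 := by
  have h : q.1 ^ 2 + q.2 ^ 2 ≠ 0 := fun h0 => hq <| by
    have h1 : q.1 = 0 := by nlinarith [sq_nonneg q.1, sq_nonneg q.2]
    have h2 : q.2 = 0 := by nlinarith [sq_nonneg q.1, sq_nonneg q.2]
    exact Prod.ext h1 h2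
  exact_mod_cast h

/-- A transversal vector vanishes if and only if the longitudinal and the transversal part of its
Fourier transform do. -/
theorem eq_zero_iff_of_hasHat {E : Fin 2 → Fun3} {f g : ℝ → ℝ × ℝ → ℂ}
    (h : HasHat (E 0) (fun u q => Complex.I / 2 * (q.1 * f u q + q.2 * g u q)) ∧
      HasHat (E 1) (fun u q => Complex.I / 2 * (q.2 * f u q - q.1 * g u q)))
    (hf : ∀ u, Continuous (f u)) (hg : ∀ u, Continuous (g u)) :
    (∀ A, E A = 0) ↔ ∀ u q, f u q = 0 ∧ g u q = 0 := by
  have hI : Complex.I / 2 ≠ 0 := by simp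
  rw [Fin.forall_fin_two, h.1.eq_zero_iff, h.2.eq_zero_iff]
  refine ⟨fun ⟨h0, h1⟩ u q => ?_, fun h => ⟨fun u q => ?_, fun u q => ?_⟩⟩
  · have e : ∀ q, q ≠ 0 → f u q = 0 ∧ g u q = 0 := fun q hq => by
      have hs := sq_add_sq_ne_zero hq
      have a := (mul_eq_zero.1 (h0 u q)).resolve_left hI
      have b := (mul_eq_zero.1 (h1 u q)).resolve_left hI
      -- Taking the inner product with q and with its rotation by a right angle isolates `f` and
      -- `g`, each multiplied by `q₁² + q₂²`.
      exact ⟨(mul_eq_zero.1 (by linear_combination (q.1 : ℂ) * a + q.2 * b :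
          ((q.1 : ℂ) ^ 2 + (q.2 : ℂ) ^ 2) * f u q = 0)).resolve_left hs,
        (mul_eq_zero.1 (by linear_combination (q.2 : ℂ) * a - q.1 * b :
          ((q.1 : ℂ) ^ 2 + (q.2 : ℂ) ^ 2) * g u q = 0)).resolve_left hs⟩
    exact ⟨forall_eq_zero_of_ne (hf u) (fun q hq => (e q hq).1) q,
      forall_eq_zero_of_ne (hg u) (fun q hq => (e q hq).2) q⟩
  · simp [(h u q).1, (h u q).2]
  · simp [(h u q).1, (h u q).2]

theorem continuous_evenRow (hH : TransverseDecay H) (hPW : TransverseDecay PW)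
    (hPV : TransverseDecay PV) (hPU : TransverseDecay PU) (i : Fin 4) (u : ℝ) :
    Continuous (evenRow p H PW PV PU i u) := by
  have c : ∀ j, Continuous (hat (evenVars H PW PV PU j) u) := by
    obtain ⟨h0, h1, h2, h3⟩ := hasHat_evenVars hH hPW hPV hPU
    exact Fin.forall_fin_succ.2 ⟨h0.1.continuous_hat u, Fin.forall_fin_succ.2
      ⟨h1.1.continuous_hat u, Fin.forall_fin_two.2 ⟨h2.1.continuous_hat u, h3.1.continuous_hat u⟩⟩⟩
  have m : Continuous (evenMatrix p) := by
    unfold evenMatrix qSq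
    refine continuous_matrix fun i j => ?_
    fin_cases i <;> fin_cases j <;> simp <;> fun_prop
  exact (continuous_pi_iff.1 (((m.matrix_map Complex.continuous_ofReal)).matrix_mulVec
    (continuous_pi c))) i

theorem continuous_oddRow (hQW : TransverseDecay QW) (hQV : TransverseDecay QV)
    (hQU : TransverseDecay QU) (i : Fin 3) (u : ℝ) :
    Continuous (oddRow p QW QV QU i u) := by
  have c : ∀ j, Continuous (hat (oddVars QW QV QU j) u) := by
    obtain ⟨h0, h1, h2⟩ := hasHat_oddVars hQW hQV hQU
    exact Fin.forall_fin_succ.2 ⟨h0.1.continuous_hat u, Fin.forall_fin_two.2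
      ⟨h1.1.continuous_hat u, h2.1.continuous_hat u⟩⟩
  have m : Continuous (oddMatrix p) := by
    unfold oddMatrix qSq
    refine continuous_matrix fun i j => ?_
    fin_cases i <;> fin_cases j <;> simp <;> fun_prop
  exact (continuous_pi_iff.1 (((m.matrix_map Complex.continuous_ofReal)).matrix_mulVec
    (continuous_pi c))) i

/-- The u-derivative of a transform is itself the transform of a decaying function, and hence
continuous in q. -/
theorem continuous_dynRow (hH : TransverseDecay H) (hPW : TransverseDecay PW)
    (hPV : TransverseDecay PV) (hPU : TransverseDecay PU) (u : ℝ) :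
    Continuous (dynRow p H PW PV PU u) := by
  obtain ⟨h0, -, h2, h3⟩ := hasHat_evenVars hH hPW hPV hPU
  have e : ∀ {F : Fun3}, TransverseDecay F →
      Continuous fun q => deriv (fun s => hat F s q) u := fun {F} hF => by
    simp only [fun q => (hF.hasDerivAt_hat u q).deriv]
    exact TransverseDecay.continuous_hat (hF.fderiv_apply (1, 0, 0)) u
  exact ((continuous_const.mul (e h0.1)).add (continuous_const.mul (e h2.1))).add
    (continuous_const.mul (e h3.1))

theorem eqCoframe_eq_zero_iff (hκ : p.κ ≠ 0) (hl : p.lam = 0)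
    (hH : TransverseDecay H) (hPW : TransverseDecay PW)
    (hPV : TransverseDecay PV) (hPU : TransverseDecay PU) (hQW : TransverseDecay QW)
    (hQV : TransverseDecay QV) (hQU : TransverseDecay QU) :
    eqCoframe p H (potVec PW QW) (potVec PV QV) (potVec PU QU) = 0 ↔
      ∀ u q, evenRow p H PW PV PU 0 u q = 0 := by
  rw [(hasHat_eqCoframe hl hH hPW hPV hPU hQW hQV hQU).eq_zero_iff]
  refine ⟨fun h u => forall_eq_zero_of_ne (continuous_evenRow hH hPW hPV hPU 0 u)
    fun q hq => (mul_eq_zero.1 (h u q)).resolve_left ?_, fun h u q => by rw [h, mul_zero]⟩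
  exact neg_ne_zero.2 (mul_ne_zero (Complex.ofReal_ne_zero.2 (weakConst_ne_zero hκ))
    (sq_add_sq_ne_zero hq))

theorem eqLong_eq_zero_iff (hρ : p.ρ ≠ 0) (hH : TransverseDecay H) (hPW : TransverseDecay PW)
    (hPV : TransverseDecay PV) (hPU : TransverseDecay PU) (hQW : TransverseDecay QW)
    (hQV : TransverseDecay QV) (hQU : TransverseDecay QU) :
    eqLong p (potVec PW QW) (potVec PV QV) (potVec PU QU) = 0 ↔
      ∀ u q, dynRow p H PW PV PU u q = 0 := by
  rw [(hasHat_eqLong hH hPW hPV hPU hQW hQV hQU).eq_zero_iff]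
  refine ⟨fun h u => forall_eq_zero_of_ne (continuous_dynRow hH hPW hPV hPU u)
    fun q hq => (mul_eq_zero.1 (h u q)).resolve_left ?_, fun h u q => by rw [h, mul_zero]⟩
  exact neg_ne_zero.2 (mul_ne_zero (div_ne_zero
    (Complex.ofReal_ne_zero.2 (strongConst_ne_zero hρ)) (by norm_num)) (sq_add_sq_ne_zero hq))

/-- The three parts along q and the three orthogonal parts are combinations of rows with constant,
q-independent coefficients. Both triangular-looking systems are inverted explicitly, by half sums
and half differences of the right and left equations. -/
theorem connection_eqs_iff (hκ : p.κ ≠ 0) (hH : TransverseDecay H) (hPW : TransverseDecay PW)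
    (hPV : TransverseDecay PV) (hPU : TransverseDecay PU) (hQW : TransverseDecay QW)
    (hQV : TransverseDecay QV) (hQU : TransverseDecay QU) :
    ((∀ A, eqCurl p H (potVec PW QW) (potVec PV QV) (potVec PU QU) A = 0) ∧
      (∀ A, eqRight p H (potVec PW QW) (potVec PV QV) (potVec PU QU) A = 0) ∧
      ∀ A, eqLeft p H (potVec PW QW) (potVec PV QV) (potVec PU QU) A = 0) ↔
    ∀ u q, (evenRow p H PW PV PU 1 u q = 0 ∧ evenRow p H PW PV PU 2 u q = 0 ∧
      evenRow p H PW PV PU 3 u q = 0) ∧ ∀ i, oddRow p QW QV QU i u q = 0 := by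
  have hk : (weakConst p : ℂ) ≠ 0 := Complex.ofReal_ne_zero.2 (weakConst_ne_zero hκ)
  have ce := fun i u => continuous_evenRow (p := p) hH hPW hPV hPU i u
  have co := fun i u => continuous_oddRow (p := p) hQW hQV hQU i u
  rw [eq_zero_iff_of_hasHat (hasHat_eqCurl hκ hH hPW hPV hPU hQW hQV hQU)
      (fun u => by fun_prop) (fun u => by fun_prop),
    eq_zero_iff_of_hasHat (hasHat_eqRight hκ hH hPW hPV hPU hQW hQV hQU)
      (fun u => by fun_prop) (fun u => by fun_prop),
    eq_zero_iff_of_hasHat (hasHat_eqLeft hκ hH hPW hPV hPU hQW hQV hQU)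
      (fun u => by fun_prop) (fun u => by fun_prop)]
  simp only [mul_eq_zero, hk, false_or, Fin.forall_fin_succ, IsEmpty.forall_iff, and_true]
  refine ⟨fun ⟨hc, hr, hl⟩ u q => ?_, fun h => ?_⟩
  · obtain ⟨c1, c2⟩ := hc u q
    obtain ⟨r1, r2⟩ := hr u q
    obtain ⟨l1, l2⟩ := hl u q
    have e1 : evenRow p H PW PV PU 1 u q = 0 := by simpa using c1
    have e2 : evenRow p H PW PV PU 2 u q = 0 := by linear_combination (r1 + l1) / 2
    have o0 : oddRow p QW QV QU 0 u q = 0 := by linear_combination (c2 + r2 - l2) / 2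
    refine ⟨⟨e1, e2, by linear_combination r1 - e2 + e1⟩, o0, ?_, ?_⟩
    · change oddRow p QW QV QU 1 u q = 0
      linear_combination l2 + 2 / 3 * o0
    · change oddRow p QW QV QU 2 u q = 0
      linear_combination (r2 + l2) / 2
  · refine ⟨fun u q => ?_, fun u q => ?_, fun u q => ?_⟩ <;>
    · obtain ⟨⟨e1, e2, e3⟩, o0, o1, o2⟩ := h u q
      have o1' : oddRow p QW QV QU 1 u q = 0 := o1
      have o2' : oddRow p QW QV QU 2 u q = 0 := o2
      simp [e1, e2, e3, o0, o1', o2']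

end

end MAG

end

theorem theorem9 (p : MAG.Params) (hκ : p.κ ≠ 0) (hρ : p.ρ ≠ 0)
    (H : MAG.Fun3) (W V U : Fin 2 → MAG.Fun3)
    (PW PV PU QW QV QU : MAG.Fun3)
    (hH : MAG.TransverseDecay H)
    (hPW : MAG.TransverseDecay PW) (hPV : MAG.TransverseDecay PV) (hPU : MAG.TransverseDecay PU)
    (hQW : MAG.TransverseDecay QW) (hQV : MAG.TransverseDecay QV) (hQU : MAG.TransverseDecay QU)
    (hW : ∀ A r, W A r = MAG.potVec PW QW A r)
    (hV : ∀ A r, V A r = MAG.potVec PV QV A r)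
    (hU : ∀ A r, U A r = MAG.potVec PU QU A r) :
    MAG.IsSolution p (MAG.ppCoframe H) (MAG.ansatzConn H W V U) ↔
      p.lam = 0 ∧
      ∀ (u : ℝ) (q : ℝ × ℝ),
        (p.v4 : ℂ) * deriv (fun s => MAG.hat (MAG.evenVars H PW PV PU 0) s q) u
            + ((2 / 3 * (MAG.varpi0 p - 6 * p.z1) : ℝ) : ℂ) *
              deriv (fun s => MAG.hat (MAG.evenVars H PW PV PU 2) s q) u
            + ((1 / 3 * MAG.varpi0 p : ℝ) : ℂ) *
              deriv (fun s => MAG.hat (MAG.evenVars H PW PV PU 3) s q) u = 0 ∧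
        Matrix.mulVec ((MAG.evenMatrix p q).map Complex.ofReal)
            (fun i => MAG.hat (MAG.evenVars H PW PV PU i) u q) = 0 ∧
        Matrix.mulVec ((MAG.oddMatrix p q).map Complex.ofReal)
            (fun i => MAG.hat (MAG.oddVars QW QV QU i) u q) = 0 := by
  obtain rfl : W = MAG.potVec PW QW := funext fun A => funext (hW A)
  obtain rfl : V = MAG.potVec PV QV := funext fun A => funext (hV A)
  obtain rfl : U = MAG.potVec PU QU := funext fun A => funext (hU A)
  rw [MAG.isSolution_iff hκ hH.1 (MAG.contDiff_potVec hPW.1 hQW.1)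
    (MAG.contDiff_potVec hPV.1 hQV.1) (MAG.contDiff_potVec hPU.1 hQU.1)]
  -- The condition `lam = 0` is shared by both sides and has to be available before the coframe
  -- equation is transformed, since that equation contains `lam * H`.
  refine and_congr_right fun hl => ?_
  rw [MAG.eqCoframe_eq_zero_iff hκ hl hH hPW hPV hPU hQW hQV hQU,
    MAG.eqLong_eq_zero_iff hρ hH hPW hPV hPU hQW hQV hQU,
    MAG.connection_eqs_iff hκ hH hPW hPV hPU hQW hQV hQU]
  constructor
  · rintro ⟨h0, hd, hc⟩ u q
    obtain ⟨⟨h1, h2, h3⟩, ho⟩ := hc u q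
    refine ⟨hd u q, funext fun i => ?_, funext fun i => ho i⟩
    revert i
    exact Fin.forall_fin_succ.2 ⟨h0 u q, Fin.forall_fin_succ.2 ⟨h1, Fin.forall_fin_two.2 ⟨h2, h3⟩⟩⟩
  · intro h
    exact ⟨fun u q => congrFun (h u q).2.1 0, fun u q => (h u q).1, fun u q =>
      ⟨⟨congrFun (h u q).2.1 1, congrFun (h u q).2.1 2, congrFun (h u q).2.1 3⟩,
        fun i => congrFun (h u q).2.2 i⟩⟩
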